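/- An \emph{operator system} is a complex $*$-vector space $X$ with cones $M_n(X)^+$ of hermitian matrices, $n\in\mathbb N$, satisfying $M_n(X)^+\cap(-M_n(X)^+)=\{0\}$ and $a^*M_n(X)^+a\subseteq M_m(X)^+$ for all $a\in M_{n,m}(\mathbb C)$, and with an Archimedean matrix order unit $1_X$. Matrices over $X$ carry the norms $$\|x\|=\inf\Big\{t\ge 0:\begin{pmatrix}t1&x\\x^*&t1\end{pmatrix}\in M_{2n}(X)^+\Big\}\qquad(x\in M_n(X)),$$ and for a linear map $\phi$ into a C$^*$-algebra $A$, $\|\phi\|_k$ is the norm of its amplification $M_k(X)\to M_k(A)$, with $\|\phi\|=\|\phi\|_1$. A subsystem is a $*$-closed subspace containing the unit, with the inherited cones; u.c.p. means unital completely positive; all C$^*$-algebras are unital. $X$ is \emph{exact} if it admits a nuclear embedding: a unital complete order embedding $\iota:X\to\mathcal B(H)$, for some Hilbert space $H$, such that for every finite $F\subset X$ and $\varepsilon>0$ there are $n$ and u.c.p. maps $\alpha:X\to M_n(\mathbb C)$, $\beta:M_n(\mathbb C)\to\mathcal B(H)$ with $\|\beta(\alpha(x))-\iota(x)\|<\varepsilon$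 for all $x\in F$. $X$ is \emph{CP-stable} if for every finite-dimensional subsystem $E_0\subset X$ and $\delta>0$ there are a finite-dimensional subsystem $E_0\subset S\subset X$, an integer $k>0$ and $\varepsilon>0$ such that for every C$^*$-algebra $A$ and every unital linear map $\phi:S\to A$ with $\|\phi\|_k<1+\varepsilon$ there is a u.c.p. map $\psi:E_0\to A$ with $\|\phi|_{E_0}-\psi\|<\delta$. For a finite-dimensional operator system $E$ and a faithful state $f$ on $E$ (a unital linear functional, nonnegative on positive elements and nonzero on nonzero positive elements), the \emph{dual operator system} $E^*$ is the space of linear functionals on $E$, with $g^*(x)=\overline{g(x^*)}$, with $(g_{ij})\in M_n(E^*)^+$ if and only if $x\mapsto(g_{ij}(x))$ is a completely positive map $E\to M_n(\mathbb C)$, and with order unit $f$. \textbf{Proposition (Kavruk).} Let $E$ be a nonzero finite-dimensional operator system. Then $E$ has a faithful state, and for every choice of faithful state as order unit of $E^*$: $E$ is exact if and only if the dual operator system $E^*$ is CP-stable. -/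

import Mathlib

open scoped ComplexOrder CStarAlgebra Matrix

universe u v

/-- The matrix `a⋆ x a`, for a scalar matrix `a` and a matrix `x` over a complex vector space. -/
def scalarConj {V : Type*} [AddCommGroup V] [Module ℂ V] {n m : ℕ}
    (a : Matrix (Fin n) (Fin m) ℂ) (x : Matrix (Fin n) (Fin n) V) : Matrix (Fin m) (Fin m) V :=
  Matrix.of fun i j => ∑ k, ∑ l, (star (a k i) * a l j) • x k l

/-- An (abstract, Choi--Effros) operator system structure on a complex `*`-vector space:
a compatible family of proper cones of hermitian matrices, with an Archimedean matrix order unit. -/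
class OperatorSystem (V : Type u) [AddCommGroup V] [Module ℂ V] [StarAddMonoid V]
    [StarModule ℂ V] where
  /-- the order unit -/
  unit : V
  /-- the cone of positive `n × n` matrices -/
  posCone (n : ℕ) : Set (Matrix (Fin n) (Fin n) V)
  star_unit : star unit = unit
  isHermitian {n : ℕ} {x : Matrix (Fin n) (Fin n) V} : x ∈ posCone n → x.IsHermitian
  add_mem {n : ℕ} {x y : Matrix (Fin n) (Fin n) V} :
    x ∈ posCone n → y ∈ posCone n → x + y ∈ posCone n
  smul_mem {n : ℕ} {x : Matrix (Fin n) (Fin n) V} {r : ℝ} :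
    0 ≤ r → x ∈ posCone n → (r : ℂ) • x ∈ posCone n
  eq_zero {n : ℕ} {x : Matrix (Fin n) (Fin n) V} : x ∈ posCone n → -x ∈ posCone n → x = 0
  scalarConj_mem {n m : ℕ} (a : Matrix (Fin n) (Fin m) ℂ) {x : Matrix (Fin n) (Fin n) V} :
    x ∈ posCone n → scalarConj a x ∈ posCone m
  exists_smul_unit_add_mem {n : ℕ} {x : Matrix (Fin n) (Fin n) V} : x.IsHermitian →
    ∃ r : ℝ, 0 < r ∧ (r : ℂ) • Matrix.diagonal (fun _ => unit) + x ∈ posCone n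
  archimedean {n : ℕ} {x : Matrix (Fin n) (Fin n) V} :
    (∀ r : ℝ, 0 < r → (r : ℂ) • Matrix.diagonal (fun _ => unit) + x ∈ posCone n) → x ∈ posCone n

namespace OperatorSystem

section Basic

variable {V : Type u} [AddCommGroup V] [Module ℂ V] [StarAddMonoid V] [StarModule ℂ V]
  [OperatorSystem V]

variable (V) in
/-- The unit `1_n` of the `n × n` matrices over `V`. -/
def matUnit (n : ℕ) : Matrix (Fin n) (Fin n) V := Matrix.diagonal fun _ => (unit : V)

/-- The norm of an `n × n` matrix over `V`: the infimum of all `t ≥ 0` for which the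
`2n × 2n` block matrix `[[t 1_n, x], [x⋆, t 1_n]]` is positive. -/
noncomputable def matNorm {n : ℕ} (x : Matrix (Fin n) (Fin n) V) : ℝ :=
  sInf {t : ℝ | 0 ≤ t ∧ Matrix.reindex finSumFinEquiv finSumFinEquiv
    (Matrix.fromBlocks ((t : ℂ) • matUnit V n) x xᴴ ((t : ℂ) • matUnit V n)) ∈ posCone (n + n)}

/-- The positive elements of `V`. -/
def IsPos (x : V) : Prop := (Matrix.of fun _ _ : Fin 1 => x) ∈ posCone 1

/-- A linear map from an operator system into a unital C⋆-algebra is unital and completely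
positive. -/
def IsUCP {A : Type v} [CStarAlgebra A] [PartialOrder A] [StarOrderedRing A]
    (φ : V →ₗ[ℂ] A) : Prop :=
  φ unit = 1 ∧ ∀ (n : ℕ), ∀ x ∈ posCone (V := V) n,
    (0 : CStarMatrix (Fin n) (Fin n) A) ≤ CStarMatrix.ofMatrix (x.map φ)

/-- A linear map from an operator system into a unital C⋆-algebra is unital and a
complete order isomorphism onto its range. -/
def IsUnitalCompleteOrderEmbedding {A : Type v} [CStarAlgebra A] [PartialOrder A]
    [StarOrderedRing A] (φ : V →ₗ[ℂ] A) : Prop :=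
  φ unit = 1 ∧ ∀ (n : ℕ) (x : Matrix (Fin n) (Fin n) V), x ∈ posCone n ↔
    (0 : CStarMatrix (Fin n) (Fin n) A) ≤ CStarMatrix.ofMatrix (x.map φ)

/-- `‖φ‖_k < r`, where `‖φ‖_k` is the norm of the `k`-th amplification `M_k(V) → M_k(A)`
(so `k = 1` is the norm of `φ` itself). -/
def AmpNormLT {A : Type v} [CStarAlgebra A] [PartialOrder A] [StarOrderedRing A]
    (φ : V →ₗ[ℂ] A) (k : ℕ) (r : ℝ) : Prop :=
  ∃ c : ℝ, c < r ∧ ∀ x : Matrix (Fin k) (Fin k) V,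
    ‖CStarMatrix.ofMatrix (x.map φ)‖ ≤ c * matNorm x

variable (V) in
/-- A subsystem of an operator system: a `*`-closed linear subspace containing the unit. -/
structure Subsystem extends Submodule ℂ V where
  star_mem' : ∀ x ∈ carrier, star x ∈ carrier
  unit_mem' : (unit : V) ∈ carrier

variable (S : Subsystem V)

instance : StarAddMonoid S.toSubmodule where
  star x := ⟨star x.1, S.star_mem' x.1 x.2⟩
  star_involutive x := Subtype.ext (star_star x.1)
  star_add x y := Subtype.ext (star_add x.1 y.1)

instance : StarModule ℂ S.toSubmodule where
  star_smul c x := Subtype.ext (star_smul c x.1)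

theorem map_subtype_scalarConj {n m : ℕ} (a : Matrix (Fin n) (Fin m) ℂ)
    (x : Matrix (Fin n) (Fin n) S.toSubmodule) :
    (scalarConj a x).map S.toSubmodule.subtype = scalarConj a (x.map S.toSubmodule.subtype) := by
  ext i j
  simp [scalarConj]

theorem map_subtype_unit (n : ℕ) (r : ℂ) (x : Matrix (Fin n) (Fin n) S.toSubmodule) :
    (r • Matrix.diagonal (fun _ => (⟨unit, S.unit_mem'⟩ : S.toSubmodule)) + x).map
      S.toSubmodule.subtype =
    r • Matrix.diagonal (fun _ => (unit : V)) + x.map S.toSubmodule.subtype := by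
  ext i j
  by_cases h : i = j <;> simp [Matrix.diagonal, h]

/-- A subsystem is an operator system, with the inherited unit and matrix cones. -/
instance : OperatorSystem S.toSubmodule where
  unit := ⟨unit, S.unit_mem'⟩
  posCone n := {x | x.map S.toSubmodule.subtype ∈ posCone (V := V) n}
  star_unit := Subtype.ext star_unit
  isHermitian {n x} h := by
    ext i j
    exact congrFun (congrFun (isHermitian h) i) j
  add_mem {n x y} hx hy := by
    have h : (x + y).map S.toSubmodule.subtype
        = x.map S.toSubmodule.subtype + y.map S.toSubmodule.subtype := by ext i j; rfl
    rw [Set.mem_ofPred_eq, h]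
    exact add_mem hx hy
  smul_mem {n x r} hr hx := by
    have h : ((r : ℂ) • x).map S.toSubmodule.subtype
        = (r : ℂ) • x.map S.toSubmodule.subtype := by ext i j; rfl
    rw [Set.mem_ofPred_eq, h]
    exact smul_mem hr hx
  eq_zero {n x} hx hx' := by
    have h : (-x).map S.toSubmodule.subtype = -x.map S.toSubmodule.subtype := by ext i j; rfl
    rw [Set.mem_ofPred_eq, h] at hx'
    have h0 := eq_zero hx hx'
    ext i j
    exact congrFun (congrFun h0 i) j
  scalarConj_mem {n m} a {x} hx := by
    rw [Set.mem_ofPred_eq, map_subtype_scalarConj]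
    exact scalarConj_mem a hx
  exists_smul_unit_add_mem {n x} hx := by
    have h : (x.map S.toSubmodule.subtype).IsHermitian := by
      ext i j
      exact congrArg Subtype.val (congrFun (congrFun hx i) j)
    obtain ⟨r, hr, h'⟩ := exists_smul_unit_add_mem h
    refine ⟨r, hr, ?_⟩
    rw [Set.mem_ofPred_eq, map_subtype_unit]
    exact h'
  archimedean {n x} hx := by
    refine archimedean fun r hr => ?_
    have := hx r hr
    rwa [Set.mem_ofPred_eq, map_subtype_unit] at this

end Basic

/-- CP-stability: for every finite-dimensional subsystem `E` and `δ > 0` there are a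
finite-dimensional subsystem `S ⊇ E` and `k, ε > 0` such that every unital linear map
`φ : S → A` into a unital C⋆-algebra with `‖φ‖_k < 1 + ε` is, on `E`, within `δ` of a u.c.p.
map `E → A`. -/
def CPStable (X : Type u) [AddCommGroup X] [Module ℂ X] [StarAddMonoid X] [StarModule ℂ X]
    [OperatorSystem X] : Prop :=
  ∀ E : Subsystem X, FiniteDimensional ℂ E.toSubmodule → ∀ δ : ℝ, 0 < δ →
    ∃ (S : Subsystem X) (hES : E.toSubmodule ≤ S.toSubmodule),
      FiniteDimensional ℂ S.toSubmodule ∧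
      ∃ (k : ℕ) (ε : ℝ), 0 < k ∧ 0 < ε ∧
        ∀ (A : Type v) [CStarAlgebra A] [PartialOrder A] [StarOrderedRing A]
          (φ : S.toSubmodule →ₗ[ℂ] A), φ unit = 1 → AmpNormLT φ k (1 + ε) →
          ∃ ψ : E.toSubmodule →ₗ[ℂ] A, IsUCP ψ ∧
            AmpNormLT (φ.comp (Submodule.inclusion hES) - ψ) 1 δ

/-- Exactness: there is a nuclear embedding, i.e. a unital complete order embedding into some
`B(H)` which is a point-norm limit of u.c.p. maps that factor through matrix algebras
by u.c.p. maps. -/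
def IsExact (X : Type u) [AddCommGroup X] [Module ℂ X] [StarAddMonoid X] [StarModule ℂ X]
    [OperatorSystem X] : Prop :=
  ∃ (H : Type u) (_ : NormedAddCommGroup H) (_ : InnerProductSpace ℂ H) (_ : CompleteSpace H)
    (ι : X →ₗ[ℂ] (H →L[ℂ] H)), IsUnitalCompleteOrderEmbedding ι ∧
    ∀ (F : Finset X) (ε : ℝ), 0 < ε →
      ∃ (n : ℕ) (α : X →ₗ[ℂ] CStarMatrix (Fin n) (Fin n) ℂ)
        (β : CStarMatrix (Fin n) (Fin n) ℂ →CP (H →L[ℂ] H)),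
        IsUCP α ∧ β 1 = 1 ∧ ∀ x ∈ F, ‖β (α x) - ι x‖ < ε

/-- A faithful state on an operator system. -/
structure FaithfulState (E : Type u) [AddCommGroup E] [Module ℂ E] [StarAddMonoid E]
    [StarModule ℂ E] [OperatorSystem E] extends E →ₗ[ℂ] ℂ where
  map_unit' : toFun unit = 1
  nonneg' : ∀ x : E, IsPos x → 0 ≤ toFun x
  faithful' : ∀ x : E, IsPos x → toFun x = 0 → x = 0

/-- The dual space of a finite-dimensional operator system `E`, to be regarded as an operator
system whose order unit is the given faithful state of `E`. -/
def OSDual {E : Type u} [AddCommGroup E] [Module ℂ E] [StarAddMonoid E]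
    [StarModule ℂ E] [OperatorSystem E] (_f : FaithfulState E) : Type u := E →ₗ[ℂ] ℂ

section Aux

/-- In a finite-dimensional real space with an Archimedean order unit, a strictly positive
functional dominates a multiple of every functional. -/
theorem exists_nonneg_smul_add {W : Type*} [AddCommGroup W] [Module ℝ W] [FiniteDimensional ℝ W]
    (C : Set W) (e : W) (hadd : ∀ x ∈ C, ∀ y ∈ C, x + y ∈ C)
    (hsmul : ∀ r : ℝ, 0 ≤ r → ∀ x ∈ C, r • x ∈ C)
    (hunit : ∀ x, ∃ r : ℝ, 0 < r ∧ r • e + x ∈ C)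
    (harch : ∀ x, (∀ r : ℝ, 0 < r → r • e + x ∈ C) → x ∈ C)
    (f g : W →ₗ[ℝ] ℝ) (hf : ∀ x ∈ C, 0 ≤ f x) (hf0 : ∀ x ∈ C, f x = 0 → x = 0) :
    ∃ r : ℝ, 0 < r ∧ ∀ x ∈ C, 0 ≤ r * f x + g x := by
  let b := Module.finBasis ℝ W
  let L := b.equivFun
  have he : ∀ r : ℝ, 0 ≤ r → r • e ∈ C := by
    obtain ⟨r, hr, h⟩ := hunit 0
    intro s hs
    have := hsmul (s / r) (by positivity) _ h
    rw [add_zero, smul_smul, div_mul_cancel₀ _ hr.ne'] at this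
    exact this
  have h0 : (0 : W) ∈ C := by simpa using he 0 le_rfl
  choose ρ hρ hρC using hunit
  let s : Fin (Module.finrank ℝ W) → ℝ := fun i => ρ (b i) + ρ (-b i)
  have hs : ∀ i, 0 < s i := fun i => add_pos (hρ _) (hρ _)
  have key1 : ∀ i (c : ℝ), (|c| * s i) • e + c • b i ∈ C := by
    intro i c
    rcases le_total 0 c with hc | hc
    · have h1 := hadd _ (hsmul c hc _ (hρC (b i))) _ (he (c * ρ (-b i))
        (mul_nonneg hc (hρ _).le))
      convert h1 using 1
      rw [abs_of_nonneg hc]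
      module
    · have h1 := hadd _ (hsmul (-c) (by linarith) _ (hρC (-b i))) _ (he (-c * ρ (b i))
        (mul_nonneg (by linarith) (hρ _).le))
      convert h1 using 1
      rw [abs_of_nonpos hc]
      module
  have hsumC : ∀ (t : Finset (Fin (Module.finrank ℝ W))) (w : Fin (Module.finrank ℝ W) → W),
      (∀ i, w i ∈ C) → ∑ i ∈ t, w i ∈ C := by
    intro t w hw
    induction t using Finset.cons_induction with
    | empty => simpa using h0
    | cons a t ha ih => rw [Finset.sum_cons]; exact hadd _ (hw a) _ ih
  let R : ℝ := ∑ i, s i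
  have hR : 0 ≤ R := Finset.sum_nonneg fun i _ => (hs i).le
  have key2 : ∀ (x : W) (r : ℝ), R * ‖L x‖ ≤ r → r • e + x ∈ C := by
    intro x r hr
    have h1 := hsumC Finset.univ _ fun i => key1 i (L x i)
    rw [Finset.sum_add_distrib, ← Finset.sum_smul] at h1
    have h2 : ∑ i, L x i • b i = x := b.sum_equivFun x
    rw [h2] at h1
    have h3 : ∑ i, |L x i| * s i ≤ r := by
      refine le_trans ?_ hr
      rw [Finset.sum_mul]
      refine Finset.sum_le_sum fun i _ => ?_
      rw [mul_comm]
      exact mul_le_mul_of_nonneg_left (norm_le_pi_norm (L x) i) (hs i).le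
    have h4 := hadd _ h1 _ (he (r - ∑ i, |L x i| * s i) (by linarith))
    convert h4 using 1
    module
  let D : Set (Fin (Module.finrank ℝ W) → ℝ) := {z | L.symm z ∈ C}
  have hD : IsClosed D := by
    refine isClosed_of_closure_subset fun z hz => harch _ fun r hr => ?_
    obtain ⟨w, hw, hwz⟩ := Metric.mem_closure_iff.1 hz (r / (R + 1)) (by positivity)
    have h1 : r • e + L.symm (z - w) ∈ C := by
      refine key2 _ _ ?_
      rw [LinearEquiv.apply_symm_apply, ← dist_eq_norm]
      have : R * dist z w ≤ R * (r / (R + 1)) := mul_le_mul_of_nonneg_left hwz.le hR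
      refine this.trans ?_
      rw [mul_div_assoc', div_le_iff₀ (by positivity)]
      nlinarith
    have h2 := hadd _ h1 _ hw
    convert h2 using 1
    rw [map_sub]
    abel
  let K := Metric.sphere (0 : Fin (Module.finrank ℝ W) → ℝ) 1 ∩ D
  have hK : IsCompact K := (isCompact_sphere _ _).inter_right hD
  let f' := f ∘ₗ L.symm.toLinearMap
  let g' := g ∘ₗ L.symm.toLinearMap
  have hfc : Continuous f' := f'.continuous_of_finiteDimensional
  have hgc : Continuous g' := g'.continuous_of_finiteDimensional
  have hfK : ∀ z ∈ K, 0 < f' z := by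
    intro z hz
    refine lt_of_le_of_ne (hf _ hz.2) fun h => ?_
    have h1 := hf0 _ hz.2 h.symm
    have h2 : z = 0 := by simpa using h1
    have h3 := hz.1
    simp [h2] at h3
  have hq : ContinuousOn (fun z => -(g' z) / f' z) K :=
    (hgc.neg.continuousOn).div hfc.continuousOn fun z hz => (hfK z hz).ne'
  obtain ⟨M, hM⟩ := (hK.image_of_continuousOn hq).bddAbove
  refine ⟨max M 1, by positivity, fun x hx => ?_⟩
  by_cases hx0 : x = 0
  · simp [hx0]
  have hLx : 0 < ‖L x‖ := by simpa using hx0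
  have hz : ‖L x‖⁻¹ • L x ∈ K := by
    constructor
    · simp [norm_smul, hLx.ne']
    · change L.symm _ ∈ C
      rw [map_smul, LinearEquiv.symm_apply_apply]
      exact hsmul _ (by positivity) _ hx
  have h1 := hM ⟨_, hz, rfl⟩
  have h2 : f' (‖L x‖⁻¹ • L x) = ‖L x‖⁻¹ * f x := by simp [f']
  have h3 : g' (‖L x‖⁻¹ • L x) = ‖L x‖⁻¹ * g x := by simp [g']
  have h4 := hfK _ hz
  simp only [h2, h3] at h1 h4
  have hfx : 0 < f x := by
    by_contra hcon
    have : ‖L x‖⁻¹ * f x ≤ 0 := mul_nonpos_of_nonneg_of_nonpos (by positivity) (not_lt.1 hcon)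
    linarith
  rw [div_le_iff₀ h4] at h1
  have h5 : -(g x) ≤ M * f x := by
    have := mul_le_mul_of_nonneg_left h1 hLx.le
    field_simp at this
    linarith
  have := mul_le_mul_of_nonneg_right (le_max_left M 1) hfx.le
  linarith

end Aux

namespace OSDual

variable {E : Type u} [AddCommGroup E] [Module ℂ E] [StarAddMonoid E] [StarModule ℂ E]
  [OperatorSystem E] {f : FaithfulState E}

instance : AddCommGroup (OSDual f) := inferInstanceAs (AddCommGroup (E →ₗ[ℂ] ℂ))

instance : Module ℂ (OSDual f) := inferInstanceAs (Module ℂ (E →ₗ[ℂ] ℂ))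

/-- The functional on `E` underlying an element of the dual. -/
def toDual : OSDual f →ₗ[ℂ] (E →ₗ[ℂ] ℂ) := LinearMap.id

/-- The involution `g⋆(x) = conj (g (x⋆))` on the dual. -/
noncomputable instance : StarAddMonoid (OSDual f) where
  star g := ({ toFun := fun x => star (toDual g (star x))
               map_add' := by simp
               map_smul' := by simp [star_smul] } : E →ₗ[ℂ] ℂ)
  star_involutive g := LinearMap.ext fun x => by
    change star (star (toDual g (star (star x)))) = toDual g x
    rw [star_star, star_star]
  star_add g h := LinearMap.ext fun x => by
    change star (toDual g (star x) + toDual h (star x)) = _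
    rw [star_add]
    rfl

theorem toDual_star (g : OSDual f) (x : E) : toDual (star g) x = star (toDual g (star x)) := rfl

instance : StarModule ℂ (OSDual f) where
  star_smul c g := by
    refine LinearMap.ext fun x => ?_
    change star (c * toDual g (star x)) = star c * star (toDual g (star x))
    rw [star_mul']

/-- A matrix `(F_ij)` of functionals is positive if `x ↦ (F_ij x)` is a completely positive map
from `E` to `M_n(ℂ)`. -/
def cone (f : FaithfulState E) (n : ℕ) : Set (Matrix (Fin n) (Fin n) (OSDual f)) :=
  {F | ∀ (m : ℕ), ∀ x ∈ posCone (V := E) m,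
    (Matrix.of fun p q : Fin n × Fin m => toDual (F p.1 q.1) (x p.2 q.2)).PosSemidef}

/-- The pairing of matrices over `E` with matrices over its dual. -/
noncomputable def pair {n : ℕ} (F : Matrix (Fin n) (Fin n) (OSDual f)) :
    Matrix (Fin n) (Fin n) E →ₗ[ℂ] ℂ where
  toFun y := ∑ i, ∑ j, toDual (F i j) (y i j)
  map_add' y z := by simp [Finset.sum_add_distrib]
  map_smul' c y := by simp [Finset.mul_sum]

theorem pair_apply {n : ℕ} (F : Matrix (Fin n) (Fin n) (OSDual f))
    (y : Matrix (Fin n) (Fin n) E) : pair F y = ∑ i, ∑ j, toDual (F i j) (y i j) := rfl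

theorem pair_conjTranspose {n : ℕ} (F : Matrix (Fin n) (Fin n) (OSDual f))
    (y : Matrix (Fin n) (Fin n) E) : pair Fᴴ y = star (pair F yᴴ) := by
  simp only [pair_apply, Matrix.conjTranspose_apply, toDual_star, star_sum]
  exact Finset.sum_comm

theorem ext_pair {n : ℕ} {F G : Matrix (Fin n) (Fin n) (OSDual f)}
    (h : ∀ y : Matrix (Fin n) (Fin n) E, y.IsHermitian → pair F y = pair G y) : F = G := by
  have h1 : ∀ y : Matrix (Fin n) (Fin n) E, pair F y = pair G y := by
    intro y
    have h2 := h (y + yᴴ) (by simp [Matrix.IsHermitian, add_comm])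
    have h3 := h (Complex.I • (y - yᴴ)) (by
      simp only [Matrix.IsHermitian, Matrix.conjTranspose_smul, Matrix.conjTranspose_sub,
        Matrix.conjTranspose_conjTranspose, RCLike.star_def, Complex.conj_I]
      module)
    simp only [map_smul, map_add, map_sub, smul_eq_mul] at h2 h3
    have h4 := mul_left_cancel₀ Complex.I_ne_zero h3
    linear_combination (h2 + h4) / 2
  ext i j
  refine LinearMap.ext fun v => ?_
  have h2 := h1 (Matrix.single i j v)
  have h3 : ∀ H : Matrix (Fin n) (Fin n) (OSDual f),
      pair H (Matrix.single i j v) = toDual (H i j) v := by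
    intro H
    rw [pair_apply, Finset.sum_eq_single i, Finset.sum_eq_single j]
    · simp
    · intro l _ hl
      simp [Matrix.single_apply_of_col_ne _ _ hl.symm]
    · simp
    · intro k _ hk
      refine Finset.sum_eq_zero fun l _ => ?_
      simp [Matrix.single_apply_of_row_ne hk.symm]
    · simp
  rw [h3, h3] at h2
  exact h2

/-- Every hermitian matrix is a difference of positive matrices. -/
theorem exists_sub {n : ℕ} {y : Matrix (Fin n) (Fin n) E} (hy : y.IsHermitian) :
    ∃ a ∈ posCone (V := E) n, ∃ b ∈ posCone (V := E) n, y = a - b := by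
  obtain ⟨r, hr, h⟩ := exists_smul_unit_add_mem hy
  obtain ⟨s, hs, h'⟩ := exists_smul_unit_add_mem (V := E) (n := n) (x := 0) (by simp)
  refine ⟨_, h, _, smul_mem (r := r / s) (by positivity) h', ?_⟩
  rw [add_zero, smul_smul, ← Complex.ofReal_mul, div_mul_cancel₀ _ hs.ne']
  abel

theorem isHermitian_of_pair {n : ℕ} {F : Matrix (Fin n) (Fin n) (OSDual f)}
    (h : ∀ y ∈ posCone (V := E) n, 0 ≤ pair F y) : F.IsHermitian := by
  refine ext_pair fun y hy => ?_
  rw [pair_conjTranspose, hy.eq]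
  obtain ⟨a, ha, b, hb, rfl⟩ := exists_sub hy
  rw [map_sub, star_sub, (IsSelfAdjoint.of_nonneg (h a ha)).star_eq,
    (IsSelfAdjoint.of_nonneg (h b hb)).star_eq]

theorem sum4 {n m : ℕ} (T : Fin n → Fin m → Fin n → Fin m → ℂ) :
    ∑ i, ∑ j, ∑ k, ∑ l, T k i l j = ∑ k, ∑ i, ∑ l, ∑ j, T k i l j := by
  calc _ = ∑ i, ∑ k, ∑ j, ∑ l, T k i l j := Finset.sum_congr rfl fun i _ => Finset.sum_comm
    _ = ∑ k, ∑ i, ∑ j, ∑ l, T k i l j := Finset.sum_comm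
    _ = _ := Finset.sum_congr rfl fun k _ => Finset.sum_congr rfl fun i _ => Finset.sum_comm

theorem pair_scalarConj {n m : ℕ} (F : Matrix (Fin n) (Fin n) (OSDual f))
    (x : Matrix (Fin m) (Fin m) E) (a : Matrix (Fin m) (Fin n) ℂ) :
    pair F (scalarConj a x) = ∑ i, ∑ k, ∑ j, ∑ l,
      star (a k i) * a l j * toDual (F i j) (x k l) := by
  simp only [pair_apply, scalarConj, Matrix.of_apply, map_sum, map_smul, smul_eq_mul]
  exact Finset.sum_congr rfl fun i _ => Finset.sum_comm

theorem mem_cone_iff {n : ℕ} {F : Matrix (Fin n) (Fin n) (OSDual f)} :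
    F ∈ cone f n ↔ ∀ y ∈ posCone (V := E) n, 0 ≤ pair F y := by
  have key : ∀ (m : ℕ) (x : Matrix (Fin m) (Fin m) E) (c : Fin n × Fin m → ℂ),
      star c ⬝ᵥ ((Matrix.of fun p q : Fin n × Fin m => toDual (F p.1 q.1) (x p.2 q.2)) *ᵥ c)
        = pair F (scalarConj (Matrix.of fun k i => c (i, k)) x) := by
    intro m x c
    rw [pair_scalarConj]
    simp only [dotProduct, Matrix.mulVec, Fintype.sum_prod_type, Matrix.of_apply, Pi.star_apply,
      Finset.mul_sum]
    refine Finset.sum_congr rfl fun i _ => Finset.sum_congr rfl fun k _ =>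
      Finset.sum_congr rfl fun j _ => Finset.sum_congr rfl fun l _ => ?_
    ring
  constructor
  · intro h y hy
    have h1 := (h n y hy).dotProduct_mulVec_nonneg (fun p => if p.1 = p.2 then 1 else 0)
    rw [key] at h1
    convert h1 using 2
    ext i j
    simp [scalarConj]
  · intro h m x hx
    refine Matrix.PosSemidef.of_dotProduct_mulVec_nonneg ?_ fun c => ?_
    · ext p q
      have h1 : star (F q.1 p.1) = F p.1 q.1 := congrFun (congrFun (isHermitian_of_pair h) p.1) q.1
      have h2 : star (x q.2 p.2) = x p.2 q.2 := congrFun (congrFun (isHermitian hx) p.2) q.2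
      rw [Matrix.conjTranspose_apply, Matrix.of_apply, Matrix.of_apply, ← h1, toDual_star, ← h2,
        star_star]
    · rw [key]
      exact h _ (scalarConj_mem _ hx)

/-- The faithful state `f`, as an element of the dual. -/
def stateElt (f : FaithfulState E) : OSDual f := f.toLinearMap

theorem pair_diagonal {n : ℕ} (y : Matrix (Fin n) (Fin n) E) :
    pair (Matrix.diagonal fun _ => stateElt f) y = ∑ i, f.toLinearMap (y i i) := by
  rw [pair_apply]
  refine Finset.sum_congr rfl fun i _ => ?_
  rw [Finset.sum_eq_single i]
  · rw [Matrix.diagonal_apply_eq]; rfl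
  · intro j _ hj
    rw [Matrix.diagonal_apply_ne _ hj.symm]; simp
  · simp

theorem isPos_form {n : ℕ} {y : Matrix (Fin n) (Fin n) E} (hy : y ∈ posCone n)
    (c : Fin n → ℂ) : IsPos (∑ k, ∑ l, (star (c k) * c l) • y k l) :=
  scalarConj_mem (Matrix.of fun k (_ : Fin 1) => c k) hy

theorem isPos_diag {n : ℕ} {y : Matrix (Fin n) (Fin n) E} (hy : y ∈ posCone n) (i : Fin n) :
    IsPos (y i i) := by
  have := isPos_form hy (Pi.single i 1)
  simpa [Pi.single_apply] using this

theorem state_nonneg {n : ℕ} {y : Matrix (Fin n) (Fin n) E} (hy : y ∈ posCone n) :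
    0 ≤ ∑ i, f.toLinearMap (y i i) :=
  Finset.sum_nonneg fun i _ => f.nonneg' _ (isPos_diag hy i)

theorem eq_zero_of_state {n : ℕ} {y : Matrix (Fin n) (Fin n) E} (hy : y ∈ posCone n)
    (h : ∑ i, f.toLinearMap (y i i) = 0) : y = 0 := by
  have hd : ∀ i, y i i = 0 := fun i => f.faithful' _ (isPos_diag hy i)
    ((Finset.sum_eq_zero_iff_of_nonneg fun i _ => f.nonneg' _ (isPos_diag hy i)).1 h i
      (Finset.mem_univ i))
  ext i j
  by_cases hij : i = j
  · subst hij; simpa using hd i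
  have hform : ∀ z : ℂ, IsPos (z • y i j + star z • y j i) := by
    intro z
    have h1 := isPos_form hy (Pi.single i 1 + Pi.single j z)
    have h2 : (∑ k, ∑ l, (star ((Pi.single i 1 + Pi.single j z : Fin n → ℂ) k) *
        (Pi.single i 1 + Pi.single j z : Fin n → ℂ) l) • y k l)
        = z • y i j + star z • y j i := by
      simp only [Pi.add_apply, Pi.single_apply, star_add, add_mul, mul_add, add_smul,
        Finset.sum_add_distrib]
      simp [hd, apply_ite, add_comm]
    rwa [h2] at h1
  have hz : ∀ z : ℂ, z • y i j + star z • y j i = 0 := by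
    intro z
    have h1 := hform (-z)
    have h2 : IsPos (-(z • y i j + star z • y j i)) := by
      convert h1 using 1
      simp [add_comm]
    have h3 := eq_zero (hform z) h2
    exact congrFun (congrFun h3 0) 0
  have h1 := hz 1
  have h2 := hz Complex.I
  have h3 : (2 * Complex.I) • y i j = 0 := by
    have : (2 * Complex.I) • y i j = Complex.I • ((1 : ℂ) • y i j + star (1 : ℂ) • y j i)
        + (Complex.I • y i j + star Complex.I • y j i) := by
      simp only [RCLike.star_def, Complex.conj_I, map_one]
      module
    rw [this, h1, h2]; simp
  simpa using h3

/-- The dual of a finite-dimensional operator system, with a faithful state as order unit. -/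
noncomputable instance [FiniteDimensional ℂ E] : OperatorSystem (OSDual f) where
  unit := stateElt f
  posCone n := cone f n
  star_unit := by
    have h : (Matrix.diagonal fun _ : Fin 1 => stateElt f).IsHermitian :=
      isHermitian_of_pair fun y hy => by rw [pair_diagonal]; exact state_nonneg hy
    simpa using congrFun (congrFun h 0) 0
  isHermitian h := isHermitian_of_pair (mem_cone_iff.1 h)
  add_mem {n F G} hF hG := by
    rw [mem_cone_iff] at *
    intro y hy
    have h : pair (F + G) y = pair F y + pair G y := by
      simp [pair_apply, Finset.sum_add_distrib]
    rw [h]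
    exact add_nonneg (hF y hy) (hG y hy)
  smul_mem {n F r} hr hF := by
    rw [mem_cone_iff] at *
    intro y hy
    have h : pair ((r : ℂ) • F) y = r * pair F y := by
      simp [pair_apply, Finset.mul_sum]
    rw [h]
    exact mul_nonneg (by exact_mod_cast hr) (hF y hy)
  eq_zero {n F} hF hF' := by
    rw [mem_cone_iff] at hF hF'
    have h0 : ∀ y ∈ posCone (V := E) n, pair F y = 0 := by
      intro y hy
      have h : pair (-F) y = -pair F y := by simp [pair_apply]
      have h1 := hF' y hy
      rw [h] at h1
      exact le_antisymm (neg_nonneg.1 h1) (hF y hy)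
    refine ext_pair fun y hy => ?_
    obtain ⟨a, ha, b, hb, rfl⟩ := exists_sub hy
    rw [map_sub, h0 a ha, h0 b hb]
    simp [pair_apply]
  scalarConj_mem {n m} a {F} hF := by
    rw [mem_cone_iff] at *
    intro y hy
    have h : pair (scalarConj a F) y = pair F (scalarConj aᵀ y) := by
      rw [pair_scalarConj]
      simp only [pair_apply, scalarConj, Matrix.of_apply, map_sum, map_smul, LinearMap.sum_apply,
        LinearMap.smul_apply, smul_eq_mul, Matrix.transpose_apply]
      exact sum4 fun k i l j => star (a k i) * a l j * toDual (F k l) (y i j)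
    rw [h]
    exact hF _ (scalarConj_mem _ hy)
  exists_smul_unit_add_mem {n F} hF := by
    let W := selfAdjoint (Matrix (Fin n) (Fin n) E)
    let P : Matrix (Fin n) (Fin n) (OSDual f) → W →ₗ[ℝ] ℝ := fun G =>
      Complex.reLm ∘ₗ (pair G).restrictScalars ℝ ∘ₗ (selfAdjoint.submodule ℝ _).subtype
    have hP : ∀ G (w : W), P G w = (pair G w.1).re := fun G w => rfl
    have : FiniteDimensional ℝ E := FiniteDimensional.complexToReal E
    have : FiniteDimensional ℝ W :=
      inferInstanceAs (FiniteDimensional ℝ (selfAdjoint.submodule ℝ (Matrix (Fin n) (Fin n) E)))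
    have hsm : ∀ (r : ℝ) (y : Matrix (Fin n) (Fin n) E), r • y = (r : ℂ) • y := fun r y => by
      ext i j; rfl
    let e : W := ⟨matUnit E n, by
      change (matUnit E n)ᴴ = _
      simp [matUnit, Matrix.diagonal_conjTranspose, star_unit, Pi.star_def]⟩
    obtain ⟨r, hr, h⟩ := exists_nonneg_smul_add (W := W) {w | w.1 ∈ posCone n} e
      (fun x hx y hy => add_mem hx hy)
      (fun r hr x hx => by
        rw [Set.mem_ofPred_eq]
        change r • x.1 ∈ _
        rw [hsm]; exact smul_mem hr hx)
      (fun x => by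
        obtain ⟨r, hr, h⟩ := exists_smul_unit_add_mem (V := E) (x := x.1) x.2
        refine ⟨r, hr, ?_⟩
        rw [Set.mem_ofPred_eq]
        change r • matUnit E n + x.1 ∈ _
        rw [hsm]; exact h)
      (fun x hx => archimedean fun r hr => by
        have h1 := hx r hr
        rw [Set.mem_ofPred_eq] at h1
        change r • matUnit E n + x.1 ∈ _ at h1
        rwa [hsm] at h1)
      (P (Matrix.diagonal fun _ => stateElt f)) (P F)
      (fun x hx => by
        rw [hP, pair_diagonal]
        exact (Complex.nonneg_iff.1 (state_nonneg hx)).1)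
      (fun x hx h0 => by
        rw [hP, pair_diagonal] at h0
        refine Subtype.ext (eq_zero_of_state (f := f) hx ?_)
        exact Complex.ext h0 (Complex.nonneg_iff.1 (state_nonneg hx)).2.symm)
    refine ⟨r, hr, mem_cone_iff.2 fun y hy => ?_⟩
    have h1 := h ⟨y, isHermitian hy⟩ hy
    simp only [hP] at h1
    have h2 : pair ((r : ℂ) • (Matrix.diagonal fun _ => stateElt f) + F) y
        = r * pair (Matrix.diagonal fun _ => stateElt f) y + pair F y := by
      simp [pair_apply, Finset.mul_sum, Finset.sum_add_distrib]
    have h3 : (pair F y).im = 0 := by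
      have := pair_conjTranspose F y
      rw [hF.eq, (isHermitian hy).eq] at this
      exact Complex.conj_eq_iff_im.1 this.symm
    have h4 := (Complex.nonneg_iff.1 (state_nonneg (f := f) hy)).2
    rw [← pair_diagonal] at h4
    rw [h2, Complex.nonneg_iff]
    constructor
    · simpa using h1
    · simp [h3, ← h4]
  archimedean {n F} hF := by
    refine mem_cone_iff.2 fun y hy => ?_
    have h1 : ∀ r : ℝ, 0 < r → 0 ≤ r * pair (Matrix.diagonal fun _ => stateElt f) y + pair F y := by
      intro r hr
      have h2 : pair ((r : ℂ) • (Matrix.diagonal fun _ => stateElt f) + F) y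
          = r * pair (Matrix.diagonal fun _ => stateElt f) y + pair F y := by
        simp [pair_apply, Finset.mul_sum, Finset.sum_add_distrib]
      rw [← h2]
      exact mem_cone_iff.1 (hF r hr) y hy
    have h4 := Complex.nonneg_iff.1 (state_nonneg (f := f) hy)
    rw [← pair_diagonal] at h4
    rw [Complex.nonneg_iff]
    constructor
    · refine le_of_forall_pos_le_add fun δ hδ => ?_
      have h5 := (Complex.nonneg_iff.1 (h1 (δ /
        ((pair (Matrix.diagonal fun _ => stateElt f) y).re + 1)) (div_pos hδ (by linarith [h4.1])))).1
      simp only [Complex.add_re, Complex.re_ofReal_mul] at h5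
      have h6 : δ / ((pair (Matrix.diagonal fun _ => stateElt f) y).re + 1) *
          (pair (Matrix.diagonal fun _ => stateElt f) y).re ≤ δ := by
        rw [div_mul_eq_mul_div, div_le_iff₀ (by linarith [h4.1])]
        nlinarith
      linarith
    · have h5 := (Complex.nonneg_iff.1 (h1 1 one_pos)).2
      simpa [← h4.2] using h5

end OSDual

end OperatorSystem

/-! ### Positive elements of a C⋆-algebra. -/

section CStarAux

variable {B : Type*} [CStarAlgebra B] [PartialOrder B] [StarOrderedRing B]

/-! Duality turns a completely positive map `E → M_n(ℂ)` into a positive element of `M_n(E^*)`, and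
a hermitian matrix over `E` into an evaluation map on `E^*`. In this dictionary both properties say
that one fixed matrix algebra suffices to test positivity on all matrix levels up to a given error.

Exact implies CP-stable. Let `β ∘ α`, through `M_n(ℂ)`, approximate a nuclear embedding `ι`. Then
`α` is an element of `M_n(E^*)⁺`, and a positive `F` in `M_m(E^*)` is a positive functional on
`M_m(E)`. That functional extends along `ι` to `M_m(B(H))`, so `F = g ∘ ι` with `g` completely
positive, and `F` is close to `g ∘ β ∘ α`: it is almost the image of `α` under the positive Choi
kernel of `g ∘ β`. Hence a map on `E^*` that is almost positive on the single element `α` is almost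
positive on every `F`, for all `m`, with an error measured against `F(1)`
(`nearly_completelyPositive`). If the `n`-th amplification of a unital map is almost contractive,
its hermitian part is almost positive on `α` (`hermPart_almost_positive`) and close to the map
(`norm_sub_hermPart_le`). Adding a small multiple of `x ↦ x(1)1` and rescaling gives a u.c.p. map
(`exists_isUCP_near`).

CP-stable implies exact. A hermitian `y` in `M_N(E)` with `f(y) = 1` is a unital map `E^* → M_N(ℂ)`.
If its `k`-th amplification is almost contractive, CP-stability puts a u.c.p. map, that is, a
positive matrix over `E`, near it, so `y` is almost positive (`exists_near_positive`). Almost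
contractivity follows from positive pairings with the order interval of `M_{2k}(E^*)`, which by
compactness is controlled by finitely many strictly positive matrices (`exists_finite_generators`).
Normalised to be unital, these are u.c.p. maps `E → M_{2k}(ℂ)`, and their direct sum `α` almost
reflects positivity on all levels (`exists_almost_reflecting`). Extending functionals along `α`
factors every u.c.p. map from `E` into a matrix algebra almost through `α`, uniformly in the map
(`exists_almost_factorization`). The Hilbert sum of all these maps is a complete order embedding,
because they determine the cones (`mem_posCone_of_forall_isUnitalPos`), and summing the
factorizations makes it nuclear.

Throughout, extending completely positive maps is reduced to the Riesz extension of one positive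
functional on matrices (`exists_positive_extension`). Faithful states come from summing a basis of
the dual made of positive functionals. -/

theorem CStarAlgebra.exists_eq_star_mul_self {b : B} (hb : 0 ≤ b) : ∃ c, b = star c * c :=
  CStarAlgebra.nonneg_iff_eq_star_mul_self.1 hb

/-- Take `p = b⁻`: it annihilates `b⁺`, so compressing by it isolates the negative part, and a
self-adjoint `p` with `p³ = 0` vanishes by the C⋆-identity. -/
theorem CStarAlgebra.exists_negPart {b : B} (hb : IsSelfAdjoint b) :
    ∃ p : B, 0 ≤ p ∧ 0 ≤ p * p * p ∧ star p = p ∧ p * b * p = -(p * p * p) ∧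
      (p * p * p = 0 → 0 ≤ b) := by
  have hP0 : 0 ≤ b⁻ := CFC.negPart_nonneg b
  have hPs : star b⁻ = b⁻ := (IsSelfAdjoint.of_nonneg hP0).star_eq
  refine ⟨b⁻, hP0, ?_, hPs, ?_, fun h => ?_⟩
  · have := star_left_conjugate_nonneg hP0 b⁻
    rwa [hPs] at this
  · calc b⁻ * b * b⁻ = b⁻ * (b⁺ - b⁻) * b⁻ := by rw [CFC.posPart_sub_negPart b hb]
      _ = _ := by rw [mul_sub, CFC.negPart_mul_posPart, zero_sub, neg_mul]
  · rw [← CFC.negPart_eq_zero_iff b hb]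
    have h6 : b⁻ * b⁻ = 0 := by
      rw [← CStarRing.star_mul_self_eq_zero_iff, star_mul, hPs, ← mul_assoc, h, zero_mul]
    rw [← CStarRing.star_mul_self_eq_zero_iff, hPs, h6]

theorem CStarAlgebra.norm_smul_one_add_nonneg {b : B} (hb : IsSelfAdjoint b) :
    0 ≤ (‖b‖ : ℂ) • (1 : B) + b := by
  have h2 := hb.neg_algebraMap_norm_le_self
  rwa [Algebra.algebraMap_eq_smul_one, neg_le_iff_add_nonneg', ← Complex.coe_smul] at h2

theorem CStarAlgebra.nonneg_of_forall_smul_one_add {b : B}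
    (hb : ∀ r : ℝ, 0 < r → 0 ≤ (r : ℂ) • (1 : B) + b) : 0 ≤ b := by
  have h1 : Filter.Tendsto (fun r : ℝ => (r : ℂ) • (1 : B) + b) (nhdsWithin 0 (Set.Ioi 0))
      (nhds (((0 : ℝ) : ℂ) • (1 : B) + b)) := by
    refine Filter.Tendsto.mono_left (Continuous.tendsto ?_ 0) nhdsWithin_le_nhds
    fun_prop
  have h2 := CStarAlgebra.isClosed_nonneg.mem_of_tendsto h1 (by
    filter_upwards [self_mem_nhdsWithin] with r hr
    exact hb r hr)
  simpa using h2

end CStarAux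

/-! ### Positivity of matrices over a C⋆-algebra, tested by forms. -/

namespace CStarMatrix

section Form

variable {n A : Type*} [Fintype n] [CStarAlgebra A]

/-- The `A`-valued sesquilinear form `∑ aᵢ⋆ Mᵢⱼ aⱼ` of a matrix `M` over `A`. -/
def form (M : CStarMatrix n n A) (a : n → A) : A := ∑ i, ∑ j, star (a i) * M i j * a j

theorem form_add (M N : CStarMatrix n n A) (a : n → A) :
    form (M + N) a = form M a + form N a := by
  simp [form, mul_add, add_mul, Finset.sum_add_distrib]

theorem form_neg (M : CStarMatrix n n A) (a : n → A) : form (-M) a = -form M a := by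
  simp [form]

theorem form_smul (c : ℂ) (M : CStarMatrix n n A) (a : n → A) :
    form (c • M) a = c • form M a := by
  simp [form, Finset.smul_sum]

theorem form_star (M : CStarMatrix n n A) (a : n → A) : form (star M) a = star (form M a) := by
  simp only [form, star_sum, star_mul, star_star, star_apply]
  rw [Finset.sum_comm]
  simp [mul_assoc]

theorem form_star_mul (N : CStarMatrix n n A) (a : n → A) :
    form (star N * N) a = ∑ l, star (∑ j, N l j * a j) * ∑ j, N l j * a j := by
  simp only [form, mul_apply, star_apply, Finset.sum_mul, Finset.mul_sum, star_sum, star_mul]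
  calc _ = ∑ i, ∑ l, ∑ j, star (a i) * (star (N l i) * N l j) * a j :=
        Finset.sum_congr rfl fun i _ => Finset.sum_comm
    _ = ∑ l, ∑ i, ∑ j, star (a i) * (star (N l i) * N l j) * a j := Finset.sum_comm
    _ = ∑ l, ∑ j, ∑ i, star (a i) * (star (N l i) * N l j) * a j :=
        Finset.sum_congr rfl fun i _ => Finset.sum_comm
    _ = _ := by
        refine Finset.sum_congr rfl fun l _ => ?_
        refine Finset.sum_congr rfl fun j _ => Finset.sum_congr rfl fun i _ => ?_
        simp [mul_assoc]

theorem form_single [DecidableEq n] (M : CStarMatrix n n A) (i : n) :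
    form M (Pi.single i 1) = M i i := by
  simp [form, Pi.single_apply, apply_ite, ite_mul]

variable [DecidableEq n] [PartialOrder A] [StarOrderedRing A]

theorem form_nonneg {M : CStarMatrix n n A} (hM : 0 ≤ M) (a : n → A) : 0 ≤ form M a := by
  obtain ⟨N, rfl⟩ := CStarAlgebra.exists_eq_star_mul_self hM
  rw [form_star_mul]
  exact Finset.sum_nonneg fun l _ => star_mul_self_nonneg _

theorem diag_nonneg {M : CStarMatrix n n A} (hM : 0 ≤ M) (i : n) : 0 ≤ M i i := by
  simpa [form_single] using form_nonneg hM (Pi.single i 1)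

theorem eq_zero_of_diag {M : CStarMatrix n n A} (hM : 0 ≤ M) (h : ∀ i, M i i = 0) : M = 0 := by
  obtain ⟨N, rfl⟩ := CStarAlgebra.exists_eq_star_mul_self hM
  have : N = 0 := by
    ext l i
    have h1 := h i
    rw [mul_apply] at h1
    simp only [star_apply] at h1
    rw [Finset.sum_eq_zero_iff_of_nonneg fun l _ => star_mul_self_nonneg _] at h1
    exact (CStarRing.star_mul_self_eq_zero_iff _).1 (h1 l (Finset.mem_univ _))
  simp [this]

/-- With `P = M⁻`, testing the form on the columns of `P` gives the diagonal of `P M P = -P³`. So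
the positive matrix `P³` has zero diagonal and therefore vanishes. -/
theorem nonneg_of_isSelfAdjoint_of_form {M : CStarMatrix n n A} (hM : IsSelfAdjoint M)
    (h : ∀ a : n → A, 0 ≤ form M a) : 0 ≤ M := by
  obtain ⟨P, hP0, h2, hPs, h1, h3⟩ := CStarAlgebra.exists_negPart hM
  refine h3 (eq_zero_of_diag h2 fun j => le_antisymm ?_ (diag_nonneg h2 j))
  have h4 := h fun i => P i j
  have h5 : form M (fun i => P i j) = (P * M * P) j j := by
    simp only [form, mul_apply, Finset.sum_mul]
    rw [Finset.sum_comm]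
    refine Finset.sum_congr rfl fun i _ => Finset.sum_congr rfl fun l _ => ?_
    conv_rhs => rw [← hPs, star_apply, hPs]
  rw [h5, h1] at h4
  exact neg_nonneg.1 h4

theorem nonneg_iff_form {M : CStarMatrix n n A} : 0 ≤ M ↔ ∀ a : n → A, 0 ≤ form M a := by
  refine ⟨form_nonneg, fun h => ?_⟩
  have key : ∀ c : ℂ, (∀ a, form (c • (M - star M)) a = 0) → IsSelfAdjoint (c • (M - star M)) →
      c • (M - star M) = 0 := fun c h0 hs =>
    le_antisymm (neg_nonneg.1 (nonneg_of_isSelfAdjoint_of_form hs.neg fun a => by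
      rw [form_neg, h0, neg_zero])) (nonneg_of_isSelfAdjoint_of_form hs fun a => by rw [h0])
  -- Self-adjointness is automatic: all values of the form are self-adjoint, so the self-adjoint
  -- matrix `i(M - M⋆)` has zero form, and both it and its negative are positive.
  have h1 : Complex.I • (M - star M) = 0 := by
    refine key _ (fun a => ?_) ?_
    · rw [form_smul, sub_eq_add_neg, form_add, form_neg, form_star,
        (IsSelfAdjoint.of_nonneg (h a)).star_eq, add_neg_cancel, smul_zero]
    · rw [IsSelfAdjoint, star_smul, star_sub, star_star]
      rw [RCLike.star_def, Complex.conj_I, neg_smul, ← smul_neg, neg_sub]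
  have h2 : M - star M = 0 := (smul_eq_zero_iff_right Complex.I_ne_zero).1 h1
  exact nonneg_of_isSelfAdjoint_of_form (sub_eq_zero.1 h2).symm h

theorem nonneg_one_iff {a : A} :
    0 ≤ (ofMatrix (Matrix.of fun _ _ : Fin 1 => a) : CStarMatrix (Fin 1) (Fin 1) A) ↔ 0 ≤ a := by
  rw [nonneg_iff_form]
  constructor
  · intro h
    simpa [form] using h fun _ => 1
  · intro h b
    simpa [form] using star_left_conjugate_nonneg h (b 0)

end Form

end CStarMatrix

/-! ### C⋆-algebras as operator systems. -/

namespace OperatorSystem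

section CStar

variable {A : Type u} [CStarAlgebra A]

theorem form_scalarConj {n m : ℕ} (a : Matrix (Fin n) (Fin m) ℂ) (x : Matrix (Fin n) (Fin n) A)
    (b : Fin m → A) : CStarMatrix.form (CStarMatrix.ofMatrix (scalarConj a x)) b =
      CStarMatrix.form (CStarMatrix.ofMatrix x) fun k => ∑ i, a k i • b i := by
  simp only [CStarMatrix.form, scalarConj, CStarMatrix.ofMatrix_apply, Matrix.of_apply, star_sum,
    Finset.sum_mul, Finset.mul_sum, star_smul]
  calc _ = ∑ i, ∑ k, ∑ j, ∑ l, star (b i) * (star (a k i) * a l j) • x k l * b j :=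
        Finset.sum_congr rfl fun i _ => Finset.sum_comm
    _ = ∑ k, ∑ i, ∑ j, ∑ l, star (b i) * (star (a k i) * a l j) • x k l * b j := Finset.sum_comm
    _ = ∑ k, ∑ i, ∑ l, ∑ j, star (b i) * (star (a k i) * a l j) • x k l * b j :=
        Finset.sum_congr rfl fun i _ => Finset.sum_congr rfl fun i _ => Finset.sum_comm
    _ = ∑ k, ∑ l, ∑ i, ∑ j, star (b i) * (star (a k i) * a l j) • x k l * b j :=
        Finset.sum_congr rfl fun i _ => Finset.sum_comm
    _ = ∑ k, ∑ l, ∑ j, ∑ i, star (b i) * (star (a k i) * a l j) • x k l * b j :=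
        Finset.sum_congr rfl fun i _ => Finset.sum_congr rfl fun i _ => Finset.sum_comm
    _ = _ := by
        refine Finset.sum_congr rfl fun k _ => Finset.sum_congr rfl fun l _ =>
          Finset.sum_congr rfl fun j _ => Finset.sum_congr rfl fun i _ => ?_
        simp [smul_smul, mul_comm]

variable [PartialOrder A] [StarOrderedRing A]

/-- A unital C⋆-algebra is an operator system. -/
noncomputable instance : OperatorSystem A where
  unit := 1
  posCone n := {x | (0 : CStarMatrix (Fin n) (Fin n) A) ≤ CStarMatrix.ofMatrix x}
  star_unit := star_one A
  isHermitian {n x} h := (IsSelfAdjoint.of_nonneg (R := CStarMatrix (Fin n) (Fin n) A) h).star_eq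
  add_mem {n x y} hx hy := add_nonneg (α := CStarMatrix (Fin n) (Fin n) A) hx hy
  smul_mem {n x r} hr hx := by
    have := smul_nonneg (β := CStarMatrix (Fin n) (Fin n) A) hr hx
    exact this
  eq_zero {n x} hx hx' := le_antisymm (α := CStarMatrix (Fin n) (Fin n) A)
    (neg_nonneg (α := CStarMatrix (Fin n) (Fin n) A).1 hx') hx
  scalarConj_mem {n m} a {x} hx := by
    refine CStarMatrix.nonneg_iff_form.2 fun b => ?_
    rw [form_scalarConj]
    exact CStarMatrix.form_nonneg hx _
  exists_smul_unit_add_mem {n x} hx := by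
    have h1 : IsSelfAdjoint (CStarMatrix.ofMatrix x) := hx
    refine ⟨‖CStarMatrix.ofMatrix x‖ + 1, by positivity, ?_⟩
    have h3 := add_nonneg (CStarAlgebra.norm_smul_one_add_nonneg h1)
      (zero_le_one (α := CStarMatrix (Fin n) (Fin n) A))
    refine h3.trans_eq ?_
    change _ = ((‖CStarMatrix.ofMatrix x‖ + 1 : ℝ) : ℂ) • (1 : CStarMatrix (Fin n) (Fin n) A) +
      CStarMatrix.ofMatrix x
    push_cast
    rw [add_smul, one_smul]
    abel
  archimedean {n x} hx :=
    CStarAlgebra.nonneg_of_forall_smul_one_add (B := CStarMatrix (Fin n) (Fin n) A) hx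

theorem mem_posCone_iff {n : ℕ} {x : Matrix (Fin n) (Fin n) A} :
    x ∈ posCone n ↔ (0 : CStarMatrix (Fin n) (Fin n) A) ≤ CStarMatrix.ofMatrix x := Iff.rfl

theorem mem_posCone_iff_form {n : ℕ} {x : Matrix (Fin n) (Fin n) A} :
    x ∈ posCone n ↔ ∀ a, 0 ≤ CStarMatrix.form (CStarMatrix.ofMatrix x) a :=
  CStarMatrix.nonneg_iff_form

theorem isPos_iff_nonneg {a : A} : IsPos a ↔ 0 ≤ a := CStarMatrix.nonneg_one_iff

theorem unit_eq_one : (unit : A) = 1 := rfl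

end CStar

end OperatorSystem

/-! ### Norm estimates and scalar tests for positivity. -/

theorem CStarAlgebra.norm_one_le_one (B : Type*) [CStarAlgebra B] : ‖(1 : B)‖ ≤ 1 := by
  rcases subsingleton_or_nontrivial B with hB | hB
  · rw [Subsingleton.elim (1 : B) 0, norm_zero]
    exact zero_le_one
  · exact CStarRing.norm_one.le

theorem CStarAlgebra.norm_le_of_star_mul_self_le {B : Type*} [CStarAlgebra B] [PartialOrder B]
    [StarOrderedRing B] {b : B} {t : ℝ} (ht : 0 ≤ t)
    (h : 0 ≤ ((t : ℂ) * t) • (1 : B) - star b * b) : ‖b‖ ≤ t := by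
  have h1 : star b * b ≤ algebraMap ℝ B (t * t) := by
    rw [Algebra.algebraMap_eq_smul_one, ← Complex.coe_smul]
    push_cast
    exact sub_nonneg.1 h
  rw [← CStarAlgebra.norm_le_iff_le_algebraMap _ (by positivity) (star_mul_self_nonneg b),
    CStarRing.norm_star_mul_self] at h1
  exact abs_le_of_sq_le_sq' (by nlinarith) ht |>.2

theorem CStarAlgebra.nonneg_of_norm_le {B : Type*} [CStarAlgebra B] [PartialOrder B]
    [StarOrderedRing B] {b : B} (hb : IsSelfAdjoint b) {t : ℝ} (h : ‖b‖ ≤ t) :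
    0 ≤ (t : ℂ) • (1 : B) + b := by
  have h1 := add_nonneg (CStarAlgebra.norm_smul_one_add_nonneg hb)
    (smul_nonneg (sub_nonneg.2 h) (zero_le_one (α := B)))
  convert h1 using 1
  rw [← Complex.coe_smul]
  push_cast
  module

namespace CStarMatrix

theorem norm_ofMatrix_one {A : Type*} [CStarAlgebra A] [PartialOrder A] [StarOrderedRing A]
    (a : A) : ‖(ofMatrix (Matrix.of fun _ _ : Fin 1 => a) : CStarMatrix (Fin 1) (Fin 1) A)‖
      = ‖a‖ := by
  refine le_antisymm ?_ (norm_entry_le_norm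
    (M := (ofMatrix (Matrix.of fun _ _ : Fin 1 => a) : CStarMatrix (Fin 1) (Fin 1) A))
    (i := 0) (j := 0))
  refine CStarAlgebra.norm_le_of_star_mul_self_le (norm_nonneg a) ?_
  have h := CStarAlgebra.star_mul_le_algebraMap_norm_sq (a := a)
  rw [Algebra.algebraMap_eq_smul_one, ← Complex.coe_smul, pow_two] at h
  push_cast at h
  refine (nonneg_one_iff.2 (sub_nonneg.2 h)).trans_eq ?_
  ext i j
  fin_cases i; fin_cases j
  simp [mul_apply, star_apply]

open ContinuousLinearMap in
theorem nonneg_iff_inner {n H : Type*} [Fintype n] [DecidableEq n] [NormedAddCommGroup H]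
    [InnerProductSpace ℂ H] [CompleteSpace H] {M : CStarMatrix n n (H →L[ℂ] H)} :
    0 ≤ M ↔ ∀ v : n → H, 0 ≤ ∑ i, ∑ j, inner ℂ (v i) (M i j (v j)) := by
  constructor
  · intro h v
    obtain ⟨N, rfl⟩ := CStarAlgebra.exists_eq_star_mul_self h
    have h1 : ∑ i, ∑ j, inner ℂ (v i) ((star N * N : CStarMatrix n n (H →L[ℂ] H)) i j (v j)) =
        ∑ l, inner ℂ (∑ j, N l j (v j)) (∑ j, N l j (v j)) := by
      have h2 : ∀ (S T : H →L[ℂ] H) (x y : H), inner ℂ x ((star S * T) y) = inner ℂ (S x) (T y) :=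
        fun S T x y => adjoint_inner_right S x (T y)
      simp only [mul_apply, star_apply, sum_apply, inner_sum, sum_inner, h2]
      calc _ = ∑ i, ∑ l, ∑ j, inner ℂ (N l i (v i)) (N l j (v j)) :=
            Finset.sum_congr rfl fun i _ => Finset.sum_comm
        _ = ∑ l, ∑ i, ∑ j, inner ℂ (N l i (v i)) (N l j (v j)) := Finset.sum_comm
        _ = _ := Finset.sum_congr rfl fun i _ => Finset.sum_comm
    rw [h1]
    exact Finset.sum_nonneg fun l _ => by
      rw [inner_self_eq_norm_sq_to_K]
      positivity
  · intro h
    refine nonneg_iff_form.2 fun a => ?_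
    rw [nonneg_iff_isPositive, isPositive_iff_complex]
    intro x
    have h1 : inner ℂ (form M a x) x = star (∑ i, ∑ j, inner ℂ (a i x) (M i j (a j x))) := by
      have h2 : ∀ (S T R : H →L[ℂ] H), inner ℂ ((star S * T * R) x) x =
          inner ℂ (T (R x)) (S x) := fun S T R => adjoint_inner_left S x (T (R x))
      simp only [form, sum_apply, sum_inner, star_sum, h2]
      simp
    have h2 := h fun i => a i x
    rw [h1, (IsSelfAdjoint.of_nonneg h2).star_eq]
    rw [Complex.nonneg_iff] at h2
    exact ⟨Complex.ext rfl h2.2, h2.1⟩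

/-- This is the identification of `M_m(M_ι(ℂ))` with scalar matrices indexed by `m × ι`, in the form
in which complete positivity of maps into matrix algebras is checked throughout. -/
theorem nonneg_iff_quadratic {m ι : Type*} [Fintype m] [DecidableEq m] [Fintype ι] [DecidableEq ι]
    {Z : CStarMatrix m m (CStarMatrix ι ι ℂ)} :
    0 ≤ Z ↔ ∀ c : m → ι → ℂ, 0 ≤ ∑ p, ∑ q, ∑ i, ∑ j, star (c p i) * Z p q i j * c q j := by
  have key : ∀ (M N P : CStarMatrix ι ι ℂ) (k l : ι), (star M * N * P) k l =
      ∑ i, ∑ j, star (M i k) * N i j * P j l := by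
    intro M N P k l
    simp only [mul_apply, star_apply, Finset.sum_mul]
    exact Finset.sum_comm
  have hsum : ∀ (T : m → m → CStarMatrix ι ι ℂ) (k l : ι),
      (∑ p, ∑ q, T p q) k l = ∑ p, ∑ q, T p q k l := by
    intro T k l
    have : ∀ (s : Finset m) (T : m → CStarMatrix ι ι ℂ), (∑ p ∈ s, T p) k l = ∑ p ∈ s, T p k l :=
      fun s T => by
        induction s using Finset.cons_induction with
        | empty => simp
        | cons a s ha ih => rw [Finset.sum_cons, Finset.sum_cons, add_apply, ih]
    simp [this]
  constructor
  · intro h c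
    rcases isEmpty_or_nonempty ι with _ | ⟨⟨i0⟩⟩
    · simp
    -- A vector is encoded as a matrix all of whose columns equal it; any diagonal entry of the form
    -- is then the scalar quadratic form.
    have h1 := diag_nonneg (form_nonneg h fun p => ofMatrix (Matrix.of fun i _ => c p i)) i0
    rw [form, hsum] at h1
    simp only [key] at h1
    exact h1
  · intro h
    refine nonneg_iff_form.2 fun a => nonneg_iff_form.2 fun w => ?_
    have h1 : ∀ M N P : CStarMatrix ι ι ℂ, form (star M * N * P) w =
        ∑ i, ∑ j, star (∑ k, M i k * w k) * N i j * ∑ l, P j l * w l := by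
      intro M N P
      simp only [form, key, Finset.sum_mul, Finset.mul_sum, star_sum, star_mul']
      calc _ = ∑ k, ∑ i, ∑ l, ∑ j, star (w k) * (star (M i k) * N i j * P j l) * w l :=
            Finset.sum_congr rfl fun _ _ => Finset.sum_comm
        _ = ∑ i, ∑ k, ∑ l, ∑ j, star (w k) * (star (M i k) * N i j * P j l) * w l :=
            Finset.sum_comm
        _ = ∑ i, ∑ k, ∑ j, ∑ l, star (w k) * (star (M i k) * N i j * P j l) * w l :=
            Finset.sum_congr rfl fun _ _ => Finset.sum_congr rfl fun _ _ => Finset.sum_comm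
        _ = ∑ i, ∑ j, ∑ k, ∑ l, star (w k) * (star (M i k) * N i j * P j l) * w l :=
            Finset.sum_congr rfl fun _ _ => Finset.sum_comm
        _ = ∑ i, ∑ j, ∑ l, ∑ k, star (w k) * (star (M i k) * N i j * P j l) * w l :=
            Finset.sum_congr rfl fun _ _ => Finset.sum_congr rfl fun _ _ => Finset.sum_comm
        _ = _ := by
            refine Finset.sum_congr rfl fun i _ => Finset.sum_congr rfl fun j _ =>
              Finset.sum_congr rfl fun l _ => Finset.sum_congr rfl fun k _ => ?_
            ring
    have h2 : ∀ (s : Finset m) (T : m → CStarMatrix ι ι ℂ),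
        form (∑ p ∈ s, T p) w = ∑ p ∈ s, form (T p) w := fun s T => by
      induction s using Finset.cons_induction with
      | empty => simp [form]
      | cons a s ha ih => rw [Finset.sum_cons, Finset.sum_cons, form_add, ih]
    change 0 ≤ form (∑ p, ∑ q, star (a p) * Z p q * a q) w
    simp only [h2, h1]
    exact h fun p i => ∑ l, a p i l * w l

end CStarMatrix

/-! ### Cones with an Archimedean order unit: extension, separation, compactness. -/

theorem Submodule.exists_basis_mem_of_span_eq_top {K V : Type*} [Field K] [AddCommGroup V]
    [Module K V] [FiniteDimensional K V] {P : Set V} (hP : Submodule.span K P = ⊤) :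
    ∃ (d : ℕ) (b : Module.Basis (Fin d) K V), ∀ i, b i ∈ P := by
  let b := Module.Basis.ofSpan hP.ge
  have : Finite _ := Module.Finite.finite_basis b
  have : Fintype _ := Fintype.ofFinite ((linearIndepOn_empty K id).extend (Set.empty_subset P))
  refine ⟨_, b.reindex (Fintype.equivFin _), fun i => ?_⟩
  rw [Module.Basis.reindex_apply]
  exact Module.Basis.ofSpan_subset hP.ge ⟨_, rfl⟩

/-- A cone with an Archimedean order unit in a real vector space. -/
structure IsOrderUnitCone {W : Type*} [AddCommGroup W] [Module ℝ W] (C : Set W) (e : W) :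
    Prop where
  add_mem : ∀ x ∈ C, ∀ y ∈ C, x + y ∈ C
  smul_mem : ∀ r : ℝ, 0 ≤ r → ∀ x ∈ C, r • x ∈ C
  exists_unit : ∀ x, ∃ r : ℝ, 0 < r ∧ r • e + x ∈ C
  archimedean : ∀ x, (∀ r : ℝ, 0 < r → r • e + x ∈ C) → x ∈ C

namespace IsOrderUnitCone

variable {W : Type*} [AddCommGroup W] [Module ℝ W] {C : Set W} {e : W}

theorem unit_mem (hC : IsOrderUnitCone C e) {r : ℝ} (hr : 0 ≤ r) : r • e ∈ C := by
  obtain ⟨s, hs, h⟩ := hC.exists_unit 0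
  have := hC.smul_mem (r / s) (by positivity) _ h
  rwa [add_zero, smul_smul, div_mul_cancel₀ _ hs.ne'] at this

theorem zero_mem (hC : IsOrderUnitCone C e) : (0 : W) ∈ C := by simpa using hC.unit_mem le_rfl

/-- Positive functionals given through a linear map whose range contains the order unit extend. -/
theorem exists_extension (hC : IsOrderUnitCone C e) {U : Type*} [AddCommGroup U] [Module ℝ U]
    (L : U →ₗ[ℝ] W) (u : U) (hu : L u = e) (g : U →ₗ[ℝ] ℝ) (hg : ∀ v, L v ∈ C → 0 ≤ g v) :
    ∃ G : W →ₗ[ℝ] ℝ, (∀ x ∈ C, 0 ≤ G x) ∧ ∀ v, G (L v) = g v := by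
  obtain ⟨σ, hσ⟩ := L.rangeRestrict.exists_rightInverse_of_surjective L.range_rangeRestrict
  have hσ' : ∀ y : LinearMap.range L, L (σ y) = y := fun y =>
    congrArg Subtype.val (LinearMap.congr_fun hσ y)
  -- Positivity applied to both signs of a kernel element shows that `g` factors through the range
  -- of `L`.
  have hker : ∀ v w, L v = L w → g v = g w := by
    intro v w h
    have h1 := hg (v - w) (by rw [map_sub, h, sub_self]; exact hC.zero_mem)
    have h2 := hg (w - v) (by rw [map_sub, h, sub_self]; exact hC.zero_mem)
    rw [map_sub] at h1 h2
    linarith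
  let s : PointedCone ℝ W :=
    { carrier := C
      add_mem' := fun hx hy => hC.add_mem _ hx _ hy
      zero_mem' := hC.zero_mem
      smul_mem' := fun r x hx => hC.smul_mem r r.2 x hx }
  -- The range contains the order unit, which is the cofinality that the Riesz theorem needs.
  obtain ⟨G, hG, hG'⟩ := riesz_extension s ⟨LinearMap.range L, g ∘ₗ σ⟩
    (fun x hx => hg _ (by rw [hσ']; exact hx)) (fun y => by
      obtain ⟨r, -, hr⟩ := hC.exists_unit y
      exact ⟨⟨r • e, r • u, by rw [map_smul, hu]⟩, hr⟩)
  refine ⟨G, hG', fun v => ?_⟩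
  rw [hG ⟨L v, v, rfl⟩]
  exact hker _ _ (hσ' _)

/-- A point outside a cone with Archimedean order unit is separated from it. -/
theorem exists_separating (hC : IsOrderUnitCone C e) {x : W} (hx : x ∉ C) :
    ∃ G : W →ₗ[ℝ] ℝ, (∀ y ∈ C, 0 ≤ G y) ∧ G x < 0 := by
  -- A negative multiple of `e` in the cone would absorb the unit and put `x` in `C`.
  have hneg : ∀ r : ℝ, 0 < r → (-r) • e ∉ C := by
    intro r hr h
    obtain ⟨s, hs, h1⟩ := hC.exists_unit x
    have h2 := hC.add_mem _ h1 _ (hC.smul_mem (s / r) (by positivity) _ h)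
    rw [smul_smul, mul_neg, div_mul_cancel₀ _ hr.ne'] at h2
    apply hx
    convert h2 using 1
    module
  have hmono : ∀ r s : ℝ, r ≤ s → r • e + x ∈ C → s • e + x ∈ C := by
    intro r s hrs h
    have := hC.add_mem _ h _ (hC.unit_mem (sub_nonneg.2 hrs))
    convert this using 1
    module
  obtain ⟨r, hr, hrx⟩ : ∃ r : ℝ, 0 < r ∧ r • e + x ∉ C := by
    by_contra! h
    exact hx (hC.archimedean x h)
  let T : Set ℝ := {t | t • e + x ∈ C}
  have hTne : T.Nonempty := (hC.exists_unit x).imp fun _ h => h.2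
  have hTlb : ∀ t ∈ T, r ≤ t := fun t ht => by
    by_contra! h
    exact hrx (hmono t r h.le ht)
  have hTb : BddBelow T := ⟨r, hTlb⟩
  let t₀ := sInf T
  have ht₀ : r ≤ t₀ := le_csInf hTne hTlb
  have htT : ∀ t, t₀ < t → t • e + x ∈ C := by
    intro t ht
    obtain ⟨s, hs, hst⟩ := exists_lt_of_csInf_lt hTne ht
    exact hmono s t hst.le hs
  -- On the span of `e` and `x` the functional is `a e + b x ↦ a - t₀ b`, where `t₀` is the infimum
  -- of all `t` with `t e + x ∈ C`. Its value at `x` is `-t₀ < 0`.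
  obtain ⟨G, hG, hGL⟩ := hC.exists_extension
    ((LinearMap.toSpanSingleton ℝ W e).coprod (LinearMap.toSpanSingleton ℝ W x)) (1, 0)
    (by simp) (LinearMap.fst ℝ ℝ ℝ - t₀ • LinearMap.snd ℝ ℝ ℝ) (by
      rintro ⟨a, b⟩ h
      simp only [LinearMap.coprod_apply, LinearMap.toSpanSingleton_apply] at h
      simp only [LinearMap.sub_apply, LinearMap.smul_apply, LinearMap.fst_apply,
        LinearMap.snd_apply, smul_eq_mul, sub_nonneg]
      rcases lt_trichotomy b 0 with hb | rfl | hb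
      · by_contra! hcon
        have h1 : t₀ < a / b := by
          rw [lt_div_iff_of_neg hb]
          linarith
        obtain ⟨t, ht, ht'⟩ := exists_between h1
        have h2 := hC.add_mem _ (hC.smul_mem (-b) (by linarith) _ (htT t ht)) _ h
        refine hneg (b * t - a) ?_ ?_
        · rw [lt_div_iff_of_neg hb] at ht'
          linarith
        · convert h2 using 1
          module
      · by_contra! hcon
        refine hneg (-a) (by linarith) ?_
        convert h using 1
        module
      · have h1 : a / b ∈ T := by
          have := hC.smul_mem b⁻¹ (by positivity) _ h
          change _ ∈ C
          convert this using 1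
          rw [smul_add, smul_smul, smul_smul, inv_mul_cancel₀ hb.ne', one_smul, div_eq_inv_mul]
        have h2 : t₀ ≤ a / b := csInf_le hTb h1
        rwa [le_div_iff₀ hb] at h2)
  refine ⟨G, hG, ?_⟩
  have := hGL (0, 1)
  simp at this
  rw [this]
  linarith

variable [FiniteDimensional ℝ W]

/-- The dual of a finite-dimensional space has a basis of functionals that are positive on a given
proper cone with Archimedean order unit. -/
theorem exists_positive_dual_basis (hC : IsOrderUnitCone C e)
    (hneg : ∀ x, x ∈ C → -x ∈ C → x = 0) :
    ∃ (d : ℕ) (g : Module.Basis (Fin d) ℝ (Module.Dual ℝ W)), ∀ i, ∀ x ∈ C, 0 ≤ g i x := by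
  let P : Set (Module.Dual ℝ W) := {g | ∀ x ∈ C, 0 ≤ g x}
  -- By separation, a vector killed by all positive functionals lies in the cone together with its
  -- negative, so it is zero.
  have hP : Submodule.span ℝ P = ⊤ := by
    rw [← Subspace.dualCoannihilator_dualAnnihilator_eq (W := Submodule.span ℝ P),
      Submodule.dualAnnihilator_eq_top_iff, eq_bot_iff]
    intro x hx
    rw [Submodule.mem_dualCoannihilator] at hx
    have hmem : ∀ y : W, (∀ g ∈ P, g y = 0) → y ∈ C := by
      intro y hy
      by_contra hyC
      obtain ⟨G, hG, hG'⟩ := hC.exists_separating hyC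
      exact hG'.ne (hy G hG)
    exact hneg x (hmem x fun g hg => hx g (Submodule.subset_span hg))
      (hmem (-x) fun g hg => by rw [map_neg, hx g (Submodule.subset_span hg), neg_zero])
  exact Submodule.exists_basis_mem_of_span_eq_top hP

/-- The order interval `[0, e]` is controlled, up to `ε e`, by finitely many elements in the
interior of the cone. -/
theorem exists_finite_generators (hC : IsOrderUnitCone C e)
    (hneg : ∀ x, x ∈ C → -x ∈ C → x = 0) {ε : ℝ} (hε : 0 < ε) :
    ∃ (N : ℕ) (T : Fin N → W), (∀ i, ∃ r : ℝ, 0 < r ∧ T i - r • e ∈ C) ∧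
      ∀ g : W →ₗ[ℝ] ℝ, (∀ i, 0 ≤ g (T i)) → ∀ x ∈ C, e - x ∈ C → 0 ≤ g x + ε * g e := by
  obtain ⟨d, γ, hγ⟩ := hC.exists_positive_dual_basis hneg
  have hinj : Function.Injective (LinearMap.pi fun i => γ i : W →ₗ[ℝ] Fin d → ℝ) := by
    rw [injective_iff_map_eq_zero]
    intro x hx
    rw [← Module.forall_dual_apply_eq_zero_iff ℝ x]
    intro φ
    rw [← γ.sum_repr φ, LinearMap.sum_apply]
    refine Finset.sum_eq_zero fun i _ => ?_
    have : γ i x = 0 := congrFun hx i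
    simp [this]
  have hdim : Module.finrank ℝ W = Module.finrank ℝ (Fin d → ℝ) := by
    rw [← Subspace.dual_finrank_eq, Module.finrank_eq_card_basis γ]
    simp
  let L := LinearEquiv.ofInjectiveOfFinrankEq _ hinj hdim
  have hL : ∀ x i, L x i = γ i x := fun x i => rfl
  let b : Fin d → W := fun i => L.symm (Pi.single i 1)
  have hb : ∀ x, x = ∑ i, L x i • b i := by
    intro x
    apply L.injective
    simp only [map_sum, map_smul, b, LinearEquiv.apply_symm_apply]
    ext j
    simp [Finset.sum_apply, Pi.single_apply]
  choose ρ hρ hρC using hC.exists_unit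
  let R : ℝ := 1 + ∑ i, (ρ (b i) + ρ (-b i))
  have hR : 0 < R := add_pos_of_pos_of_nonneg one_pos
    (Finset.sum_nonneg fun i _ => (add_pos (hρ _) (hρ _)).le)
  have hRle : ∀ i, ρ (b i) + ρ (-b i) ≤ R := fun i =>
    (Finset.single_le_sum (f := fun i => ρ (b i) + ρ (-b i))
      (fun i _ => (add_pos (hρ _) (hρ _)).le) (Finset.mem_univ i)).trans (by simp [R])
  have hmono : ∀ (r s : ℝ) (x : W), r ≤ s → r • e + x ∈ C → s • e + x ∈ C := by
    intro r s x hrs h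
    have := hC.add_mem _ h _ (hC.unit_mem (sub_nonneg.2 hrs))
    convert this using 1
    module
  -- Small enough that `± t b_i` is dominated by `(ε / 2) e`.
  let t : ℝ := ε / 2 / R
  have ht : 0 < t := by positivity
  have htR : t * R = ε / 2 := div_mul_cancel₀ _ hR.ne'
  have hbC : ∀ i, (ε / 2) • e + t • b i ∈ C := fun i => by
    have := hC.smul_mem t ht.le _ (hmono _ R _ (by linarith [hRle i, hρ (-b i)]) (hρC (b i)))
    rwa [smul_add, smul_smul, htR] at this
  have hbC' : ∀ i, (ε / 2) • e + -(t • b i) ∈ C := fun i => by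
    have := hC.smul_mem t ht.le _ (hmono _ R _ (by linarith [hRle i, hρ (b i)]) (hρC (-b i)))
    rwa [smul_add, smul_smul, htR, smul_neg] at this
  let v : Option (Fin d) → W := fun o => o.elim 0 fun i => t • b i
  have hv : ∀ o (s : Bool), (ε / 2) • e + (bif s then v o else -v o) ∈ C := by
    rintro (_ | i) (_ | _)
    · simpa [v] using hC.unit_mem (by positivity : 0 ≤ ε / 2)
    · simpa [v] using hC.unit_mem (by positivity : 0 ≤ ε / 2)
    · exact hbC' i
    · exact hbC i
  let K : Set (Fin d → ℝ) := L '' {x | x ∈ C ∧ e - x ∈ C}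
  -- The coordinates are positive functionals, so the order interval lies in the box from `0` to the
  -- coordinates of `e`.
  have hK : TotallyBounded K := by
    refine (isCompact_Icc (a := (0 : Fin d → ℝ)) (b := L e)).totallyBounded.subset ?_
    rintro _ ⟨x, ⟨hx, hx'⟩, rfl⟩
    refine ⟨fun i => hγ i x hx, fun i => ?_⟩
    have := hγ i _ hx'
    rw [map_sub] at this
    exact sub_nonneg.1 this
  obtain ⟨c, hcK, hcf, hcov⟩ := Metric.finite_approx_of_totallyBounded hK (t / (d + 1))
    (by positivity)
  have : Fintype c := hcf.fintype
  -- Each point `z` of a finite net is moved into the interior by `ε e` and then shifted by `0` or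
  -- `± t b_i`. Nonnegativity of `g` at these points bounds every `t |g(b_i)|` by `q = g(z) + ε
  -- g(e)`. The mesh `t / (d + 1)` then makes the change from `z` to `x` cost at most `q`.
  let Φ : c × Option (Fin d) × Bool → W := fun p =>
    L.symm p.1 + ε • e + (bif p.2.2 then v p.2.1 else -v p.2.1)
  refine ⟨_, Φ ∘ (Fintype.equivFin _).symm, fun i => ⟨ε / 2, by positivity, ?_⟩,
    fun g hg x hx hx' => ?_⟩
  · obtain ⟨x, hx, hxp⟩ := hcK ((Fintype.equivFin (c × Option (Fin d) × Bool)).symm i).1.2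
    have h1 := hC.add_mem _ hx.1 _
      (hv ((Fintype.equivFin _).symm i).2.1 ((Fintype.equivFin _).symm i).2.2)
    convert h1 using 1
    simp only [Function.comp_apply, Φ]
    rw [← hxp, LinearEquiv.symm_apply_apply]
    module
  · have hg' : ∀ p, 0 ≤ g (Φ p) := fun p => by
      have := hg (Fintype.equivFin _ p)
      rwa [Function.comp_apply, Equiv.symm_apply_apply] at this
    obtain ⟨z, hz, hxz⟩ : ∃ z ∈ c, L x ∈ Metric.ball z (t / (d + 1)) := by
      simpa using hcov ⟨x, ⟨hx, hx'⟩, rfl⟩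
    let q : ℝ := g (L.symm z) + ε * g e
    have hq : ∀ o s, 0 ≤ q + (bif s then g (v o) else -g (v o)) := by
      intro o s
      have := hg' (⟨z, hz⟩, o, s)
      cases s <;> simpa [Φ, q] using this
    have hq0 : 0 ≤ q := by simpa [v] using hq none true
    have hqi : ∀ i, t * |g (b i)| ≤ q := by
      intro i
      have h1 := hq (some i) true
      have h2 := hq (some i) false
      simp only [v, Option.elim, map_smul, smul_eq_mul, cond_true, cond_false] at h1 h2
      rw [← abs_of_pos ht, ← abs_mul, abs_le]
      constructor <;> linarith
    have hxe : x = L.symm z + ∑ i, (L x i - z i) • b i := by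
      have h1 := hb x
      have h2 := hb (L.symm z)
      rw [LinearEquiv.apply_symm_apply] at h2
      simp only [sub_smul, Finset.sum_sub_distrib]
      rw [← h1, ← h2]
      abel
    have hbound : ∀ i, -(q / (d + 1)) ≤ (L x i - z i) * g (b i) := by
      intro i
      have h1 : |L x i - z i| ≤ t / (d + 1) := by
        rw [Metric.mem_ball, dist_eq_norm] at hxz
        exact (norm_le_pi_norm (L x - z) i).trans hxz.le
      have h2 : |(L x i - z i) * g (b i)| ≤ q / (d + 1) := by
        rw [abs_mul]
        calc _ ≤ t / (d + 1) * |g (b i)| := by gcongr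
          _ = t * |g (b i)| / (d + 1) := by ring
          _ ≤ _ := by gcongr; exact hqi i
      exact (abs_le.1 h2).1
    have hsum : -(d * (q / (d + 1))) ≤ ∑ i, (L x i - z i) * g (b i) := by
      have := Finset.card_nsmul_le_sum Finset.univ _ _ fun i _ => hbound i
      simpa using this
    have hfin : d * (q / (d + 1)) ≤ q := by
      rw [mul_div_assoc', div_le_iff₀ (by positivity)]
      nlinarith
    have hgx : g x = g (L.symm z) + ∑ i, (L x i - z i) * g (b i) := by
      conv_lhs => rw [hxe]
      simp
    rw [hgx]
    simp only [q] at *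
    linarith

end IsOrderUnitCone

/-- A real functional on the self-adjoint part extends to a complex functional. -/
theorem selfAdjoint.exists_complex_extension {M : Type*} [AddCommGroup M] [Module ℂ M]
    [StarAddMonoid M] [StarModule ℂ M] (G : selfAdjoint M →ₗ[ℝ] ℝ) :
    ∃ S : M →ₗ[ℂ] ℂ, ∀ w : selfAdjoint M, S w = G w := by
  let T : M →ₗ[ℝ] ℂ := Complex.ofRealCLM.toLinearMap ∘ₗ G ∘ₗ realPart +
    Complex.I • (Complex.ofRealCLM.toLinearMap ∘ₗ G ∘ₗ imaginaryPart)
  have hT : ∀ x, T x = G (realPart x) + Complex.I * G (imaginaryPart x) := fun x => rfl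
  refine ⟨{ toFun := T, map_add' := map_add T, map_smul' := fun c x => ?_ }, fun w => ?_⟩
  · rw [hT, hT, realPart_smul, imaginaryPart_smul]
    simp only [map_sub, map_add, map_smul, smul_eq_mul, RingHom.id_apply]
    apply Complex.ext <;> simp
  · change T w = _
    rw [hT, realPart_coe, imaginaryPart_coe]
    simp

/-! ### Scalar conjugation, positive kernels and positive functionals. -/

namespace OperatorSystem

section Basic

variable {V : Type u} [AddCommGroup V] [Module ℂ V]

theorem scalarConj_apply {n m : ℕ} (a : Matrix (Fin n) (Fin m) ℂ) (x : Matrix (Fin n) (Fin n) V)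
    (i j : Fin m) : scalarConj a x i j = ∑ k, ∑ l, (star (a k i) * a l j) • x k l := rfl

theorem scalarConj_add {n m : ℕ} (a : Matrix (Fin n) (Fin m) ℂ) (x y : Matrix (Fin n) (Fin n) V) :
    scalarConj a (x + y) = scalarConj a x + scalarConj a y := by
  ext i j
  simp [scalarConj_apply, Finset.sum_add_distrib]

theorem scalarConj_smul {n m : ℕ} (a : Matrix (Fin n) (Fin m) ℂ) (c : ℂ)
    (x : Matrix (Fin n) (Fin n) V) : scalarConj a (c • x) = c • scalarConj a x := by
  ext i j
  simp [scalarConj_apply, Finset.smul_sum, smul_comm c]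

theorem scalarConj_scalarConj {n m p : ℕ} (a : Matrix (Fin n) (Fin m) ℂ)
    (b : Matrix (Fin m) (Fin p) ℂ) (x : Matrix (Fin n) (Fin n) V) :
    scalarConj b (scalarConj a x) = scalarConj (a * b) x := by
  ext i j
  simp only [scalarConj_apply, Matrix.mul_apply, Finset.smul_sum, star_sum, star_mul',
    Finset.sum_mul, Finset.mul_sum, Finset.sum_smul, smul_smul]
  calc _ = ∑ r, ∑ k, ∑ s, ∑ l, (star (b r i) * b s j * (star (a k r) * a l s)) • x k l :=
        Finset.sum_congr rfl fun _ _ => Finset.sum_comm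
    _ = ∑ k, ∑ r, ∑ s, ∑ l, (star (b r i) * b s j * (star (a k r) * a l s)) • x k l :=
        Finset.sum_comm
    _ = ∑ k, ∑ r, ∑ l, ∑ s, (star (b r i) * b s j * (star (a k r) * a l s)) • x k l :=
        Finset.sum_congr rfl fun _ _ => Finset.sum_congr rfl fun _ _ => Finset.sum_comm
    _ = ∑ k, ∑ l, ∑ r, ∑ s, (star (b r i) * b s j * (star (a k r) * a l s)) • x k l :=
        Finset.sum_congr rfl fun _ _ => Finset.sum_comm
    _ = ∑ k, ∑ l, ∑ s, ∑ r, (star (b r i) * b s j * (star (a k r) * a l s)) • x k l :=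
        Finset.sum_congr rfl fun _ _ => Finset.sum_congr rfl fun _ _ => Finset.sum_comm
    _ = _ := by
        refine Finset.sum_congr rfl fun _ _ => Finset.sum_congr rfl fun _ _ =>
          Finset.sum_congr rfl fun _ _ => Finset.sum_congr rfl fun _ _ => ?_
        congr 1
        ring

theorem scalarConj_one {n : ℕ} (x : Matrix (Fin n) (Fin n) V) : scalarConj 1 x = x := by
  ext i j
  simp [scalarConj_apply, Matrix.one_apply, apply_ite, ite_smul]

theorem scalarConj_diagonal {n m : ℕ} (a : Matrix (Fin n) (Fin m) ℂ) (v : V) :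
    scalarConj a (Matrix.diagonal fun _ => v) = Matrix.of fun i j => (aᴴ * a) i j • v := by
  ext i j
  simp [scalarConj_apply, Matrix.diagonal_apply, Matrix.mul_apply, Finset.sum_smul, smul_ite]

variable [StarAddMonoid V] [StarModule ℂ V]

theorem conjTranspose_scalarConj {n m : ℕ} (a : Matrix (Fin n) (Fin m) ℂ)
    (x : Matrix (Fin n) (Fin n) V) : (scalarConj a x)ᴴ = scalarConj a xᴴ := by
  ext i j
  simp only [Matrix.conjTranspose_apply, scalarConj_apply, star_sum, star_smul, star_mul', star_star]
  rw [Finset.sum_comm]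
  simp only [mul_comm]

variable [OperatorSystem V]

theorem smul_matUnit_mem {n : ℕ} {r : ℝ} (hr : 0 ≤ r) : (r : ℂ) • matUnit V n ∈ posCone n := by
  obtain ⟨s, hs, h⟩ := exists_smul_unit_add_mem (V := V) (n := n) (x := 0) (by simp)
  have := smul_mem (r := r / s) (by positivity) h
  rwa [add_zero, smul_smul, ← Complex.ofReal_mul, div_mul_cancel₀ _ hs.ne'] at this

theorem matUnit_mem (n : ℕ) : matUnit V n ∈ posCone n := by
  simpa using smul_matUnit_mem (V := V) (n := n) zero_le_one

theorem isPos_unit : IsPos (unit : V) := by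
  have h : (Matrix.of fun _ _ : Fin 1 => (unit : V)) = matUnit V 1 := by
    ext i j
    fin_cases i; fin_cases j
    simp [matUnit]
  rw [IsPos, h]
  exact matUnit_mem 1

theorem zero_mem (n : ℕ) : (0 : Matrix (Fin n) (Fin n) V) ∈ posCone n := by
  simpa using smul_matUnit_mem (V := V) (n := n) le_rfl

theorem sum_mem {ι : Type*} {n : ℕ} (s : Finset ι) (x : ι → Matrix (Fin n) (Fin n) V)
    (h : ∀ i ∈ s, x i ∈ posCone n) : ∑ i ∈ s, x i ∈ posCone n := by
  induction s using Finset.cons_induction with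
  | empty => simpa using zero_mem n
  | cons a s ha ih =>
    rw [Finset.sum_cons]
    exact add_mem (h a (by simp)) (ih fun i hi => h i (by simp [hi]))

theorem matUnit_isHermitian (n : ℕ) : (matUnit V n).IsHermitian := isHermitian (matUnit_mem n)

/-- Positive scalar kernels act on positive matrices. -/
theorem kernel_mem {m n : ℕ} {D : Fin m → Fin n → Fin m → Fin n → ℂ}
    (hD : ∀ c : Fin m → Fin n → ℂ, 0 ≤ ∑ i, ∑ p, ∑ j, ∑ q, star (c i p) * D i p j q * c j q)
    {Z : Matrix (Fin n) (Fin n) V} (hZ : Z ∈ posCone n) :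
    (Matrix.of fun i j => ∑ p, ∑ q, D i p j q • Z p q) ∈ posCone m := by
  let M : CStarMatrix (Fin m × Fin n) (Fin m × Fin n) ℂ :=
    CStarMatrix.ofMatrix (Matrix.of fun x y => D x.1 x.2 y.1 y.2)
  have hM : 0 ≤ M := CStarMatrix.nonneg_iff_form.2 fun a => by
    simpa [CStarMatrix.form, Fintype.sum_prod_type, M] using hD fun i p => a (i, p)
  -- A Gram factorization writes the action of the kernel as a sum of scalar conjugations.
  obtain ⟨N, hN⟩ := CStarAlgebra.exists_eq_star_mul_self hM
  have hD' : ∀ i p j q, D i p j q = ∑ r, star (N r (i, p)) * N r (j, q) := by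
    intro i p j q
    have := congrFun (congrFun hN (i, p)) (j, q)
    rw [CStarMatrix.mul_apply] at this
    exact this
  have h := sum_mem Finset.univ (fun r => scalarConj (Matrix.of fun p i => N r (i, p)) Z)
    fun r _ => scalarConj_mem _ hZ
  convert h using 1
  ext i j
  simp only [Matrix.sum_apply, scalarConj_apply, Matrix.of_apply, hD', Finset.sum_smul]
  calc _ = ∑ p, ∑ r, ∑ q, (star (N r (i, p)) * N r (j, q)) • Z p q :=
        Finset.sum_congr rfl fun _ _ => Finset.sum_comm
    _ = _ := Finset.sum_comm

/-- The tensor product of a positive scalar matrix and a positive element is positive. -/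
theorem smul_pos_mem {m : ℕ} {P : Matrix (Fin m) (Fin m) ℂ}
    (hP : ∀ c : Fin m → ℂ, 0 ≤ ∑ i, ∑ j, star (c i) * P i j * c j) {v : V} (hv : IsPos v) :
    (Matrix.of fun i j => P i j • v) ∈ posCone m := by
  have := kernel_mem (D := fun i (_ : Fin 1) j (_ : Fin 1) => P i j)
    (fun c => by simpa using hP fun i => c i 0) hv
  simpa using this

theorem isOrderUnitCone (V : Type u) [AddCommGroup V] [Module ℂ V] [StarAddMonoid V]
    [StarModule ℂ V] [OperatorSystem V] (n : ℕ) :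
    IsOrderUnitCone {w : selfAdjoint (Matrix (Fin n) (Fin n) V) | w.1 ∈ posCone n}
      ⟨matUnit V n, matUnit_isHermitian n⟩ where
  add_mem _ hx _ hy := add_mem hx hy
  smul_mem _ hr _ hx := smul_mem hr hx
  exists_unit x := exists_smul_unit_add_mem x.2
  archimedean _ hx := archimedean hx

theorem exists_sub_pos {n : ℕ} {y : Matrix (Fin n) (Fin n) V} (hy : y.IsHermitian) :
    ∃ a ∈ posCone n, ∃ r : ℝ, 0 < r ∧ y = a - (r : ℂ) • matUnit V n := by
  obtain ⟨r, hr, h⟩ := exists_smul_unit_add_mem hy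
  exact ⟨_, h, r, hr, by rw [matUnit]; abel⟩

/-- Positive functionals on matrices, given through a unital `*`-linear map, extend. -/
theorem exists_positive_extension {U : Type v} [AddCommGroup U] [Module ℂ U] [StarAddMonoid U]
    [StarModule ℂ U] (L : U →ₗ[ℂ] V) (hL : ∀ x, L (star x) = star (L x)) (e : U)
    (he : star e = e) (heL : L e = unit) {n : ℕ} (s : Matrix (Fin n) (Fin n) U →ₗ[ℂ] ℂ)
    (hs : ∀ y : Matrix (Fin n) (Fin n) U, y.IsHermitian → y.map L ∈ posCone n → 0 ≤ s y) :
    ∃ S : Matrix (Fin n) (Fin n) V →ₗ[ℂ] ℂ, (∀ x ∈ posCone n, 0 ≤ S x) ∧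
      ∀ y, S (y.map L) = s y := by
  let LR : selfAdjoint (Matrix (Fin n) (Fin n) U) →ₗ[ℝ] selfAdjoint (Matrix (Fin n) (Fin n) V) :=
    { toFun := fun y => ⟨y.1.map L, by
        have hy : star y.1 = y.1 := y.2
        change star (y.1.map L) = _
        ext i j
        rw [Matrix.star_apply, Matrix.map_apply, ← hL, Matrix.map_apply]
        exact congrArg L (congrFun (congrFun hy i) j)⟩
      map_add' := fun x y => Subtype.ext (by ext i j; simp)
      map_smul' := fun r x => Subtype.ext (by
        ext i j
        exact map_smul (L.restrictScalars ℝ) r _) }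
  let eU : selfAdjoint (Matrix (Fin n) (Fin n) U) := ⟨Matrix.diagonal fun _ => e, by
    change (Matrix.diagonal fun _ => e)ᴴ = _
    rw [Matrix.diagonal_conjTranspose]
    simp [Pi.star_def, he]⟩
  have heU : LR eU = ⟨matUnit V n, matUnit_isHermitian n⟩ := Subtype.ext (by
    change (Matrix.diagonal fun _ => e).map L = _
    rw [Matrix.diagonal_map (map_zero L)]
    simp [matUnit, heL])
  let sR : selfAdjoint (Matrix (Fin n) (Fin n) U) →ₗ[ℝ] ℝ :=
    Complex.reLm ∘ₗ s.restrictScalars ℝ ∘ₗ (selfAdjoint.submodule ℝ _).subtype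
  have hsR : ∀ y, sR y = (s y.1).re := fun y => rfl
  obtain ⟨G, hG, hGL⟩ := (isOrderUnitCone V n).exists_extension LR eU heU sR fun y hy =>
    (Complex.nonneg_iff.1 (hs _ y.2 hy)).1
  obtain ⟨S, hS⟩ := selfAdjoint.exists_complex_extension G
  -- Positivity is assumed only where the image is positive; shifting by a multiple of the unit
  -- makes `s` real on all hermitian matrices.
  have him : ∀ y : selfAdjoint (Matrix (Fin n) (Fin n) U), (s y.1).im = 0 := by
    have h1 : ∀ y : selfAdjoint (Matrix (Fin n) (Fin n) U), (LR y).1 ∈ posCone n →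
        (s y.1).im = 0 := fun y hy => (Complex.nonneg_iff.1 (hs _ y.2 hy)).2.symm
    intro y
    obtain ⟨r, hr, h⟩ := (isOrderUnitCone V n).exists_unit (LR y)
    rw [← heU, ← map_smul, ← map_add] at h
    have h2 := h1 _ h
    have h3 := h1 (r • eU) (by
      rw [map_smul, heU]
      exact (isOrderUnitCone V n).unit_mem hr.le)
    have h4 : s (r • eU + y).1 = s (r • eU).1 + s y.1 := map_add s _ _
    rw [h4, Complex.add_im, h3, zero_add] at h2
    exact h2
  refine ⟨S, fun x hx => ?_, fun y => ?_⟩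
  · have h := hS ⟨x, isHermitian hx⟩
    simp only at h
    rw [h]
    exact_mod_cast hG _ hx
  · have hLm : ∀ y : selfAdjoint (Matrix (Fin n) (Fin n) U), S (y.1.map L) = s y.1 := by
      intro y
      have h := hS (LR y)
      rw [hGL, hsR] at h
      exact h.trans (Complex.ext (by simp) (by simp [him]))
    have h1 : ∀ y z : Matrix (Fin n) (Fin n) U, (y + z).map L = y.map L + z.map L := fun y z => by
      ext; simp
    have h2 : ∀ (c : ℂ) (y : Matrix (Fin n) (Fin n) U), (c • y).map L = c • y.map L :=
      fun c y => by ext; simp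
    rw [← realPart_add_I_smul_imaginaryPart y, h1, h2, map_add, map_add, map_smul, map_smul,
      hLm, hLm]

/-- Hermitian matrices that are not positive are detected by positive functionals. -/
theorem mem_posCone_of_functional {n : ℕ} {y : Matrix (Fin n) (Fin n) V} (hy : y.IsHermitian)
    (h : ∀ S : Matrix (Fin n) (Fin n) V →ₗ[ℂ] ℂ, (∀ x ∈ posCone n, 0 ≤ S x) → 0 ≤ (S y).re) :
    y ∈ posCone n := by
  by_contra hcon
  obtain ⟨G, hG, hGy⟩ := (isOrderUnitCone V n).exists_separating (x := ⟨y, hy⟩) hcon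
  obtain ⟨S, hS⟩ := selfAdjoint.exists_complex_extension G
  have h1 := h S fun x hx => by
    have h := hS ⟨x, isHermitian hx⟩
    simp only at h
    rw [h]
    exact_mod_cast hG _ hx
  have h2 := hS ⟨y, hy⟩
  simp only at h2
  rw [h2, Complex.ofReal_re] at h1
  linarith

/-- The order interval `[0, 1]` of matrices is controlled by finitely many strictly positive
matrices. -/
theorem exists_finite_generators (V : Type u) [AddCommGroup V] [Module ℂ V] [StarAddMonoid V]
    [StarModule ℂ V] [OperatorSystem V] [FiniteDimensional ℂ V] (n : ℕ) {ε : ℝ} (hε : 0 < ε) :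
    ∃ (N : ℕ) (T : Fin N → Matrix (Fin n) (Fin n) V),
      (∀ i, ∃ r : ℝ, 0 < r ∧ T i - (r : ℂ) • matUnit V n ∈ posCone n) ∧
      ∀ S : Matrix (Fin n) (Fin n) V →ₗ[ℂ] ℂ, (∀ i, 0 ≤ (S (T i)).re) →
        ∀ x ∈ posCone n, matUnit V n - x ∈ posCone n → 0 ≤ (S x).re + ε * (S (matUnit V n)).re := by
  have : FiniteDimensional ℝ V := FiniteDimensional.complexToReal V
  have : FiniteDimensional ℝ (selfAdjoint (Matrix (Fin n) (Fin n) V)) :=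
    inferInstanceAs (FiniteDimensional ℝ (selfAdjoint.submodule ℝ (Matrix (Fin n) (Fin n) V)))
  obtain ⟨N, T, hT, h⟩ := (isOrderUnitCone V n).exists_finite_generators
    (fun x hx hx' => Subtype.ext (eq_zero hx hx')) hε
  exact ⟨N, fun i => (T i).1, hT, fun S hS x hx hx' =>
    h (Complex.reLm ∘ₗ S.restrictScalars ℝ ∘ₗ (selfAdjoint.submodule ℝ _).subtype) hS
      ⟨x, isHermitian hx⟩ hx hx'⟩

/-- Every nonzero finite-dimensional operator system has a faithful state. -/
theorem nonempty_faithfulState (V : Type u) [AddCommGroup V] [Module ℂ V] [StarAddMonoid V]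
    [StarModule ℂ V] [OperatorSystem V] [FiniteDimensional ℂ V] [Nontrivial V] :
    Nonempty (FaithfulState V) := by
  have : FiniteDimensional ℝ V := FiniteDimensional.complexToReal V
  have : FiniteDimensional ℝ (selfAdjoint (Matrix (Fin 1) (Fin 1) V)) :=
    inferInstanceAs (FiniteDimensional ℝ (selfAdjoint.submodule ℝ (Matrix (Fin 1) (Fin 1) V)))
  obtain ⟨d, γ, hγ⟩ := (isOrderUnitCone V 1).exists_positive_dual_basis
    (fun x hx hx' => Subtype.ext (eq_zero hx hx'))
  -- A sum of positive functionals that vanishes at a positive element vanishes termwise there; as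
  -- the `γ i` span the dual, the sum is faithful.
  obtain ⟨S, hS⟩ := selfAdjoint.exists_complex_extension (∑ i, γ i)
  have hpos : ∀ w : selfAdjoint (Matrix (Fin 1) (Fin 1) V), w.1 ∈ posCone 1 →
      0 ≤ (∑ i, γ i) w := fun w hw => by
    rw [LinearMap.sum_apply]
    exact Finset.sum_nonneg fun i _ => hγ i w hw
  have hfaith : ∀ w : selfAdjoint (Matrix (Fin 1) (Fin 1) V), w.1 ∈ posCone 1 →
      (∑ i, γ i) w = 0 → w = 0 := fun w hw h0 => by
    rw [LinearMap.sum_apply, Finset.sum_eq_zero_iff_of_nonneg fun i _ => hγ i w hw] at h0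
    rw [← Module.forall_dual_apply_eq_zero_iff ℝ w]
    intro φ
    rw [← γ.sum_repr φ, LinearMap.sum_apply]
    refine Finset.sum_eq_zero fun i _ => ?_
    simp [h0 i (Finset.mem_univ i)]
  let s : V →ₗ[ℂ] ℂ :=
    { toFun := fun x => S (Matrix.of fun _ _ => x)
      map_add' := fun x y => by rw [← map_add]; rfl
      map_smul' := fun c x => by rw [RingHom.id_apply, ← map_smul]; rfl }
  have hs : ∀ x, s x = S (Matrix.of fun _ _ => x) := fun x => rfl
  have hs0 : ∀ x, IsPos x → 0 ≤ s x := fun x hx => by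
    have h := hS ⟨_, isHermitian hx⟩
    simp only at h
    rw [hs, h]
    exact_mod_cast hpos ⟨_, isHermitian hx⟩ hx
  have hsf : ∀ x, IsPos x → s x = 0 → x = 0 := fun x hx h0 => by
    have h := hS ⟨_, isHermitian hx⟩
    simp only at h
    rw [hs, h] at h0
    have h1 := hfaith ⟨_, isHermitian hx⟩ hx (by exact_mod_cast h0)
    exact congrFun (congrFun (congrArg Subtype.val h1) 0) 0
  -- If the unit were zero, every hermitian element would be positive together with its negative,
  -- and the space would be trivial.
  have hu : s unit ≠ 0 := by
    intro h
    have h0 := hsf _ isPos_unit h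
    obtain ⟨x, hx⟩ := exists_ne (0 : V)
    have hall : ∀ y : Matrix (Fin 1) (Fin 1) V, y.IsHermitian → y = 0 := by
      have h1 : ∀ y : Matrix (Fin 1) (Fin 1) V, y.IsHermitian → y ∈ posCone 1 := by
        intro y hy
        obtain ⟨r, -, hr⟩ := exists_smul_unit_add_mem hy
        simpa [h0] using hr
      exact fun y hy => eq_zero (h1 y hy) (h1 _ hy.neg)
    apply hx
    have h2 := realPart_add_I_smul_imaginaryPart (Matrix.of fun _ _ => x : Matrix (Fin 1) (Fin 1) V)
    rw [hall _ (realPart _).2, hall _ (imaginaryPart _).2] at h2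
    have h3 := congrFun (congrFun h2 0) 0
    simpa using h3.symm
  have hupos : 0 ≤ s unit := hs0 _ isPos_unit
  exact ⟨{ toLinearMap := (s unit)⁻¹ • s
           map_unit' := by simp [hu]
           nonneg' := fun x hx => mul_nonneg (inv_nonneg.2 hupos) (hs0 x hx)
           faithful' := fun x hx h => hsf x hx (by simpa [hu] using h) }⟩

end Basic

end OperatorSystem

/-! ### Block matrices and the order norm. -/

namespace OperatorSystem

section Block

variable {V : Type u}

/-- The index `i` in the first half of `Fin (n + n)`. -/
def lo {n : ℕ} (i : Fin n) : Fin (n + n) := Fin.castAdd n i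

/-- The index `i` in the second half of `Fin (n + n)`. -/
def up {n : ℕ} (i : Fin n) : Fin (n + n) := Fin.natAdd n i

/-- A `2n × 2n` matrix assembled from four `n × n` blocks. -/
def blk {n : ℕ} (a b c d : Matrix (Fin n) (Fin n) V) : Matrix (Fin (n + n)) (Fin (n + n)) V :=
  Matrix.reindex finSumFinEquiv finSumFinEquiv (Matrix.fromBlocks a b c d)

variable {n : ℕ} (a b c d : Matrix (Fin n) (Fin n) V) (i j : Fin n) (u w : Fin n → V)

theorem finSumFinEquiv_symm_lo : finSumFinEquiv.symm (lo i) = Sum.inl i :=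
  finSumFinEquiv_symm_apply_castAdd i

theorem finSumFinEquiv_symm_up : finSumFinEquiv.symm (up i) = Sum.inr i :=
  finSumFinEquiv_symm_apply_natAdd i

@[simp]
theorem lo_inj : lo i = lo j ↔ i = j := by simp [lo]

@[simp]
theorem up_inj : up i = up j ↔ i = j := by
  simp only [up, Fin.ext_iff, Fin.val_natAdd]
  omega

@[simp]
theorem lo_ne_up : lo i ≠ up j := by
  simp only [lo, up, ne_eq, Fin.ext_iff, Fin.val_natAdd, Fin.val_castAdd]
  omega

@[simp]
theorem up_ne_lo : up i ≠ lo j := (lo_ne_up j i).symm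

@[simp]
theorem append_lo : Fin.append u w (lo i) = u i := Fin.append_left u w i

@[simp]
theorem append_up : Fin.append u w (up i) = w i := Fin.append_right u w i

theorem sum_lo_up {M : Type*} [AddCommMonoid M] (g : Fin (n + n) → M) :
    ∑ i, g i = ∑ i, g (lo i) + ∑ i, g (up i) := Fin.sum_univ_add g

@[simp]
theorem blk_lo_lo : blk a b c d (lo i) (lo j) = a i j := by
  simp [blk, finSumFinEquiv_symm_lo]

@[simp]
theorem blk_lo_up : blk a b c d (lo i) (up j) = b i j := by
  simp [blk, finSumFinEquiv_symm_lo, finSumFinEquiv_symm_up]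

@[simp]
theorem blk_up_lo : blk a b c d (up i) (lo j) = c i j := by
  simp [blk, finSumFinEquiv_symm_lo, finSumFinEquiv_symm_up]

@[simp]
theorem blk_up_up : blk a b c d (up i) (up j) = d i j := by
  simp [blk, finSumFinEquiv_symm_up]

theorem ext_blk {V : Type*} {n : ℕ} {x y : Matrix (Fin (n + n)) (Fin (n + n)) V}
    (h₁ : ∀ i j, x (lo i) (lo j) = y (lo i) (lo j)) (h₂ : ∀ i j, x (lo i) (up j) = y (lo i) (up j))
    (h₃ : ∀ i j, x (up i) (lo j) = y (up i) (lo j)) (h₄ : ∀ i j, x (up i) (up j) = y (up i) (up j)) :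
    x = y := by
  ext i j
  induction i using Fin.addCases <;> induction j using Fin.addCases
  · exact h₁ _ _
  · exact h₂ _ _
  · exact h₃ _ _
  · exact h₄ _ _

end Block

section Norm

variable {V : Type u} [AddCommGroup V] [Module ℂ V] [StarAddMonoid V] [StarModule ℂ V]
  [OperatorSystem V]

/-- The matrix `[[t 1, x], [x⋆, t 1]]`. -/
def block {n : ℕ} (t : ℝ) (x : Matrix (Fin n) (Fin n) V) :
    Matrix (Fin (n + n)) (Fin (n + n)) V :=
  blk ((t : ℂ) • matUnit V n) x xᴴ ((t : ℂ) • matUnit V n)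

theorem matNorm_eq {n : ℕ} (x : Matrix (Fin n) (Fin n) V) :
    matNorm x = sInf {t : ℝ | 0 ≤ t ∧ block t x ∈ posCone (n + n)} := rfl

theorem matUnit_add (n : ℕ) : matUnit V (n + n) = blk (matUnit V n) 0 0 (matUnit V n) := by
  refine ext_blk ?_ ?_ ?_ ?_ <;> intro i j <;> simp [matUnit, Matrix.diagonal_apply]

theorem block_add {n : ℕ} (r t : ℝ) (x : Matrix (Fin n) (Fin n) V) :
    block (r + t) x = (r : ℂ) • matUnit V (n + n) + block t x := by
  rw [matUnit_add]
  refine ext_blk ?_ ?_ ?_ ?_ <;> intro i j <;> simp [block, add_smul]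

theorem block_isHermitian {n : ℕ} (t : ℝ) (x : Matrix (Fin n) (Fin n) V) :
    (block t x).IsHermitian := by
  have h : star ((t : ℂ) • matUnit V n) = (t : ℂ) • matUnit V n := by
    rw [star_smul]
    simp [Matrix.star_eq_conjTranspose, (matUnit_isHermitian (V := V) n).eq]
  have h' : ∀ i j, star (((t : ℂ) • matUnit V n) j i) = ((t : ℂ) • matUnit V n) i j := fun i j =>
    congrFun (congrFun h i) j
  refine ext_blk ?_ ?_ ?_ ?_ <;> intro i j <;> rw [Matrix.conjTranspose_apply]
  · simpa only [block, blk_lo_lo] using h' i j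
  · simp [block]
  · simp [block]
  · simpa only [block, blk_up_up] using h' i j

theorem block_mono {n : ℕ} {s t : ℝ} (h : s ≤ t) {x : Matrix (Fin n) (Fin n) V}
    (hx : block s x ∈ posCone (n + n)) : block t x ∈ posCone (n + n) := by
  have := add_mem (smul_matUnit_mem (V := V) (n := n + n) (sub_nonneg.2 h)) hx
  rwa [← block_add, sub_add_cancel] at this

theorem exists_block_mem {n : ℕ} (x : Matrix (Fin n) (Fin n) V) :
    ∃ t : ℝ, 0 ≤ t ∧ block t x ∈ posCone (n + n) := by
  obtain ⟨r, hr, h⟩ := exists_smul_unit_add_mem (block_isHermitian 0 x)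
  refine ⟨r, hr.le, ?_⟩
  rw [← add_zero r, block_add]
  exact h

theorem matNorm_nonneg {n : ℕ} (x : Matrix (Fin n) (Fin n) V) : 0 ≤ matNorm x :=
  Real.sInf_nonneg fun _ h => h.1

theorem matNorm_le {n : ℕ} {x : Matrix (Fin n) (Fin n) V} {t : ℝ} (ht : 0 ≤ t)
    (h : block t x ∈ posCone (n + n)) : matNorm x ≤ t :=
  csInf_le ⟨0, fun _ h => h.1⟩ ⟨ht, h⟩

theorem block_mem_of_matNorm_lt {n : ℕ} {x : Matrix (Fin n) (Fin n) V} {t : ℝ}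
    (h : matNorm x < t) : block t x ∈ posCone (n + n) := by
  obtain ⟨s, hs, hst⟩ := exists_lt_of_csInf_lt (exists_block_mem x) h
  exact block_mono hst.le hs.2

/-- Letting `t` decrease to the norm avoids asking whether the infimum is attained, and keeps `t`
strictly positive. -/
theorem le_mul_matNorm {n : ℕ} {x : Matrix (Fin n) (Fin n) V} {c r : ℝ}
    (h : ∀ t : ℝ, 0 < t → block t x ∈ posCone (n + n) → r ≤ c * t) : r ≤ c * matNorm x := by
  have h1 : Filter.Tendsto (fun t : ℝ => c * t) (nhdsWithin (matNorm x) (Set.Ioi (matNorm x)))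
      (nhds (c * matNorm x)) :=
    ((continuous_const.mul continuous_id).tendsto _).mono_left nhdsWithin_le_nhds
  refine ge_of_tendsto h1 ?_
  filter_upwards [self_mem_nhdsWithin] with t ht
  exact h t ((matNorm_nonneg x).trans_lt ht) (block_mem_of_matNorm_lt ht)

/-- Tensoring with the rank one matrix `[[s, w], [w̄, s]]`, `s = |w|`. -/
theorem blk_rank_one_mem {n : ℕ} {P : Matrix (Fin n) (Fin n) V} (hP : P ∈ posCone n) {s : ℝ}
    (hs : 0 < s) {w : ℂ} (hw : star w * w = (s : ℂ) * s) :
    blk ((s : ℂ) • P) (w • P) (star w • P) ((s : ℂ) • P) ∈ posCone (n + n) := by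
  have h := smul_mem (inv_nonneg.2 hs.le) (scalarConj_mem (Matrix.of fun k =>
    Fin.append (fun i => if k = i then (s : ℂ) else 0) fun i => if k = i then w else 0) hP)
  have hs' : (s : ℂ) ≠ 0 := by exact_mod_cast hs.ne'
  convert h using 1
  refine ext_blk ?_ ?_ ?_ ?_ <;> intro i j <;>
    simp [scalarConj_apply, apply_ite, ite_smul, smul_smul, hs']
  · rw [mul_comm ((starRingEnd ℂ) w), inv_mul_cancel_left₀ hs']
  · rw [← RCLike.star_def, hw, inv_mul_cancel_left₀ hs', Complex.coe_smul]

/-- If `-c ≤ z ≤ c` then `‖z + i τ‖² ≤ c² + τ²`. -/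
theorem block_add_smul_I_mem {n : ℕ} {z : Matrix (Fin n) (Fin n) V} {c s τ : ℝ} (hc : 0 < c)
    (hs : 0 < s) (hsτ : s * s = c * c + τ * τ) (h₁ : (c : ℂ) • matUnit V n + z ∈ posCone n)
    (h₂ : (c : ℂ) • matUnit V n - z ∈ posCone n) :
    block s (z + (Complex.I * τ) • matUnit V n) ∈ posCone (n + n) := by
  have hz : zᴴ = z := by
    have h3 := isHermitian h₁
    have h4 : z = ((c : ℂ) • matUnit V n + z) + ((-c : ℝ) : ℂ) • matUnit V n := by
      push_cast
      module
    have h5 : (((-c : ℝ) : ℂ) • matUnit V n)ᴴ = ((-c : ℝ) : ℂ) • matUnit V n := by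
      rw [Matrix.conjTranspose_smul, (matUnit_isHermitian (V := V) n).eq]
      simp
    rw [h4, Matrix.conjTranspose_add, h3.eq, h5]
  have hw : ∀ e : ℝ, e * e = c * c →
      star ((e : ℂ) + Complex.I * τ) * ((e : ℂ) + Complex.I * τ) = (s : ℂ) * s := by
    intro e he
    have h3 : ((s : ℂ) * s) = e * e + τ * τ := by rw [he.symm] at hsτ; exact_mod_cast hsτ
    rw [h3]
    simp only [star_add, star_mul', RCLike.star_def, Complex.conj_ofReal, Complex.conj_I]
    linear_combination (-(τ : ℂ) * τ) * Complex.I_mul_I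
  -- The weights `w = ± c + iτ`, both of modulus `s`, satisfy `(c + z)(c + iτ) + (c - z)(-c + iτ) =
  -- 2c (z + iτ)`, while the diagonal blocks add up to `2cs`.
  have h3 := smul_mem (inv_nonneg.2 (by positivity : 0 ≤ 2 * c)) (add_mem
    (blk_rank_one_mem h₁ hs (hw c rfl)) (blk_rank_one_mem h₂ hs (hw (-c) (by ring))))
  have hc' : (c : ℂ) ≠ 0 := by exact_mod_cast hc.ne'
  convert h3 using 1
  have hU := (matUnit_isHermitian (V := V) n).eq
  rw [block, Matrix.conjTranspose_add, Matrix.conjTranspose_smul, hz, hU]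
  refine ext_blk ?_ ?_ ?_ ?_ <;> intro i j <;>
    simp only [blk_lo_lo, blk_lo_up, blk_up_lo, blk_up_up,
      Matrix.smul_apply, Matrix.add_apply, Matrix.sub_apply, star_add, star_mul', RCLike.star_def,
      Complex.conj_ofReal, Complex.conj_I, Complex.ofReal_inv, Complex.ofReal_mul,
      Complex.ofReal_ofNat, Complex.ofReal_neg, map_neg] <;>
    match_scalars <;> field_simp <;> ring

/-- Conjugate by `diag(1, -1)`. Together with `block_add_block_neg` this places `block t x / (2t)`
in the order interval from `0` to `1` when `t > 0`. -/
theorem block_neg_mem {n : ℕ} {t : ℝ} {x : Matrix (Fin n) (Fin n) V}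
    (h : block t x ∈ posCone (n + n)) : block t (-x) ∈ posCone (n + n) := by
  have h := scalarConj_mem (Matrix.diagonal (Fin.append (fun _ : Fin n => (1 : ℂ))
    fun _ : Fin n => -1)) h
  convert h using 1
  refine ext_blk ?_ ?_ ?_ ?_ <;> intro i j <;>
    simp [scalarConj_apply, block, Matrix.diagonal_apply, apply_ite, ite_smul]

theorem block_add_block_neg {n : ℕ} (t : ℝ) (x : Matrix (Fin n) (Fin n) V) :
    ((2 * t : ℝ) : ℂ) • matUnit V (n + n) - block t x = block t (-x) := by
  rw [matUnit_add]
  refine ext_blk ?_ ?_ ?_ ?_ <;> intro i j <;> simp [block]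
  all_goals module

theorem isPos_of_block_mem {t : ℝ} {x : V}
    (h : block t (Matrix.of fun _ _ : Fin 1 => x) ∈ posCone (1 + 1)) {z : ℂ}
    (hz : star z * z = 1) : IsPos (((2 * t : ℝ) : ℂ) • unit + (z • x + star z • star x)) := by
  have h1 := scalarConj_mem (Matrix.of fun k (_ : Fin 1) =>
    Fin.append (fun _ : Fin 1 => (1 : ℂ)) (fun _ : Fin 1 => z) k) h
  rw [IsPos]
  convert h1 using 1
  ext i j
  rw [scalarConj_apply, sum_lo_up, Fin.sum_univ_one, Fin.sum_univ_one, sum_lo_up, sum_lo_up]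
  simp only [Fin.sum_univ_one, Matrix.of_apply, append_lo, append_up, block,
    blk_lo_lo, blk_lo_up, blk_up_lo, blk_up_up,
    Matrix.conjTranspose_apply, Matrix.smul_apply, hz, matUnit, Matrix.diagonal_apply_eq, star_one,
    one_mul, mul_one]
  push_cast
  module

/-- Positive functionals are bounded by their value at the unit. -/
theorem norm_apply_le_mul_matNorm {h : V →ₗ[ℂ] ℂ} (hh : ∀ x, IsPos x → 0 ≤ h x)
    (hstar : ∀ x, h (star x) = star (h x)) (x : V) :
    ‖h x‖ ≤ (h unit).re * matNorm (Matrix.of fun _ _ : Fin 1 => x) := by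
  have hu := Complex.nonneg_iff.1 (hh _ isPos_unit)
  refine le_mul_matNorm fun t ht hb => ?_
  by_cases h0 : h x = 0
  · rw [h0, norm_zero]
    exact mul_nonneg hu.1 ht.le
  have hn : (‖h x‖ : ℂ) ≠ 0 := by exact_mod_cast norm_ne_zero_iff.2 h0
  have hzz : star (h x) * h x = (‖h x‖ : ℂ) * ‖h x‖ := by
    have := Complex.conj_mul' (h x)
    rw [RCLike.star_def, this, sq]
  -- The phase is chosen to turn `h x` into `-‖h x‖`.
  have h1 := hh _ (isPos_of_block_mem hb (z := -(star (h x) / ‖h x‖)) (by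
    simp only [star_neg, star_div₀, RCLike.star_def, Complex.conj_ofReal]
    rw [neg_mul_neg, div_mul_div_comm, ← RCLike.star_def, star_star, mul_comm (h x), hzz,
      div_self (mul_ne_zero hn hn)]))
  have h2 : h ((((2 * t : ℝ) : ℂ)) • unit + (-(star (h x) / ‖h x‖) • x +
      star (-(star (h x) / (‖h x‖ : ℂ))) • star x)) = 2 * t * h unit - 2 * ‖h x‖ := by
    rw [map_add, map_add, map_smul, map_smul, map_smul, hstar]
    simp only [smul_eq_mul, star_neg, star_div₀, Complex.star_def, Complex.conj_ofReal]
    rw [← Complex.star_def, star_star]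
    push_cast
    field_simp
    linear_combination (-2) * hzz
  rw [h2] at h1
  have h3 := (Complex.nonneg_iff.1 h1).1
  simp at h3
  linarith

end Norm

section CStarNorm

variable {A : Type u} [CStarAlgebra A] [PartialOrder A] [StarOrderedRing A]

theorem form_block {n : ℕ} (t : ℝ) (x : Matrix (Fin n) (Fin n) A) (u w : Fin n → A) :
    CStarMatrix.form (CStarMatrix.ofMatrix (block t x)) (Fin.append u w) =
      (t : ℂ) • ∑ i, star (u i) * u i + ∑ i, star (u i) * ∑ j, x i j * w j +
        (∑ j, star (∑ i, x j i * w i) * u j + (t : ℂ) • ∑ i, star (w i) * w i) := by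
  have h : ∀ v : Fin n → A, ∑ i, ∑ j, star (v i) * ((t : ℂ) • matUnit A n) i j * v j =
      (t : ℂ) • ∑ i, star (v i) * v i := by
    intro v
    simp [matUnit, Finset.smul_sum, unit_eq_one, Matrix.one_apply, mul_ite, ite_mul]
  rw [CStarMatrix.form, sum_lo_up]
  simp only [sum_lo_up, append_lo, append_up, CStarMatrix.ofMatrix_apply, block, blk_lo_lo,
    blk_lo_up, blk_up_lo, blk_up_up, Finset.sum_add_distrib, h]
  congr 2
  · simp only [Finset.mul_sum, mul_assoc]
  · simp only [Matrix.conjTranspose_apply, star_sum, star_mul, Finset.sum_mul]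
    rw [Finset.sum_comm]

/-- A Schur complement argument: on the vector `(-x a, t a)` the form of the block is `t` times the
form of `t² - x⋆x` at `a`. -/
theorem norm_le_of_block_mem {n : ℕ} {t : ℝ} (ht : 0 < t) {x : Matrix (Fin n) (Fin n) A}
    (h : block t x ∈ posCone (n + n)) : ‖CStarMatrix.ofMatrix x‖ ≤ t := by
  refine CStarAlgebra.norm_le_of_star_mul_self_le ht.le (CStarMatrix.nonneg_iff_form.2 fun a => ?_)
  have h1 := mem_posCone_iff_form.1 h (Fin.append (fun i => -∑ j, x i j * a j) fun i => (t : ℂ) • a i)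
  have h2 : CStarMatrix.form (CStarMatrix.ofMatrix (block t x))
      (Fin.append (fun i => -∑ j, x i j * a j) fun i => (t : ℂ) • a i) =
      (t : ℂ) • CStarMatrix.form (((t : ℂ) * t) • (1 : CStarMatrix (Fin n) (Fin n) A) -
        star (CStarMatrix.ofMatrix x) * CStarMatrix.ofMatrix x) a := by
    have h3 : CStarMatrix.form (1 : CStarMatrix (Fin n) (Fin n) A) a = ∑ i, star (a i) * a i := by
      simp [CStarMatrix.form, CStarMatrix.one_apply, mul_ite, ite_mul]
    rw [sub_eq_add_neg, CStarMatrix.form_add, CStarMatrix.form_neg, CStarMatrix.form_star_mul,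
      CStarMatrix.form_smul, h3, form_block]
    simp only [mul_smul_comm, smul_mul_assoc, ← Finset.smul_sum, star_neg, star_smul, neg_mul,
      mul_neg, neg_neg, Finset.sum_neg_distrib, CStarMatrix.ofMatrix_apply, RCLike.star_def,
      Complex.conj_ofReal]
    module
  rw [h2] at h1
  have h4 := smul_nonneg (inv_nonneg.2 ht.le) h1
  rw [← Complex.coe_smul, smul_smul] at h4
  have ht' : (t : ℂ) ≠ 0 := by exact_mod_cast ht.ne'
  rwa [Complex.ofReal_inv, inv_mul_cancel₀ ht', one_smul] at h4

end CStarNorm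

/-! ### Positive maps, and functionals on matrices as maps into matrix algebras. -/

section UCP

variable {V : Type u} [AddCommGroup V] [Module ℂ V] [StarAddMonoid V] [StarModule ℂ V]
  [OperatorSystem V] {A : Type v} [CStarAlgebra A] [PartialOrder A] [StarOrderedRing A]

/-- A linear map that is positive on matrices of size `n` commutes with the involution there. -/
theorem map_conjTranspose_of_pos {φ : V →ₗ[ℂ] A} {n : ℕ}
    (hφ : ∀ x ∈ posCone (V := V) n, x.map φ ∈ posCone n) {x : Matrix (Fin n) (Fin n) V}
    (hx : x.IsHermitian) : (x.map φ).IsHermitian := by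
  obtain ⟨a, ha, r, hr, rfl⟩ := exists_sub_pos hx
  have h1 := (isHermitian (hφ _ ha)).sub (isHermitian (hφ _ (smul_matUnit_mem hr.le)))
  convert h1 using 1
  ext i j
  simp

theorem map_star_of_pos {φ : V →ₗ[ℂ] A} (hφ : ∀ x, IsPos x → 0 ≤ φ x) (x : V) :
    φ (star x) = star (φ x) := by
  have h1 : ∀ x : V, IsSelfAdjoint x → IsSelfAdjoint (φ x) := by
    intro x hx
    have h2 : (Matrix.of fun _ _ : Fin 1 => x).IsHermitian := by
      ext i j
      exact hx
    have h3 := map_conjTranspose_of_pos (φ := φ) (n := 1) (fun y hy => by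
      have h4 : (Matrix.of fun _ _ : Fin 1 => y 0 0) = y := by
        ext i j; fin_cases i; fin_cases j; rfl
      have h5 := isPos_iff_nonneg.2 (hφ (y 0 0) (by rwa [IsPos, h4]))
      rw [IsPos] at h5
      convert h5 using 1
      ext i j; fin_cases i; fin_cases j; rfl) h2
    exact congrFun (congrFun h3 0) 0
  have h6 := realPart_add_I_smul_imaginaryPart x
  have h7 := (h1 _ (realPart x).2).star_eq
  have h8 := (h1 _ (imaginaryPart x).2).star_eq
  have h9 : star x = (realPart x : V) - Complex.I • (imaginaryPart x : V) := by
    conv_lhs => rw [← h6]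
    rw [star_add, star_smul, (realPart x).2.star_eq, (imaginaryPart x).2.star_eq]
    simp [sub_eq_add_neg]
  rw [h9]
  conv_rhs => rw [← h6]
  rw [map_add, map_sub, map_smul, star_add, star_smul, h7, h8]
  simp [sub_eq_add_neg]

theorem IsUCP.isPos {φ : V →ₗ[ℂ] A} (hφ : IsUCP φ) {x : V} (hx : IsPos x) : 0 ≤ φ x :=
  isPos_iff_nonneg.1 (hφ.2 1 _ hx)

theorem IsUCP.map_star {φ : V →ₗ[ℂ] A} (hφ : IsUCP φ) (x : V) : φ (star x) = star (φ x) :=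
  map_star_of_pos (fun _ => hφ.isPos) x

theorem block_map {φ : V →ₗ[ℂ] A} (h1 : φ unit = 1) (hφ : ∀ x, φ (star x) = star (φ x)) {n : ℕ}
    (t : ℝ) (x : Matrix (Fin n) (Fin n) V) : (block t x).map φ = block t (x.map φ) := by
  have h : ∀ i j, φ (((t : ℂ) • matUnit V n) i j) = ((t : ℂ) • matUnit A n) i j := by
    intro i j
    by_cases hij : i = j <;> simp [matUnit, hij, h1, unit_eq_one]
  refine ext_blk ?_ ?_ ?_ ?_ <;> intro i j
  · simpa only [block, Matrix.map_apply, blk_lo_lo] using h i j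
  · simp [block]
  · simp [block, hφ]
  · simpa only [block, Matrix.map_apply, blk_up_up] using h i j

theorem IsUCP.norm_le {φ : V →ₗ[ℂ] A} (hφ : IsUCP φ) (x : V) :
    ‖φ x‖ ≤ matNorm (Matrix.of fun _ _ : Fin 1 => x) := by
  rw [← one_mul (matNorm _)]
  refine le_mul_matNorm fun t ht hb => ?_
  have h1 : (block t (Matrix.of fun _ _ : Fin 1 => x)).map φ ∈ posCone (1 + 1) := hφ.2 _ _ hb
  rw [block_map hφ.1 hφ.map_star] at h1
  rw [one_mul, ← CStarMatrix.norm_ofMatrix_one]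
  exact norm_le_of_block_mem ht h1

end UCP

section Functional

variable {V : Type u} [AddCommGroup V] [Module ℂ V]

/-- The map `V → M_n(ℂ)` associated with a functional on the `n × n` matrices over `V`. -/
def functionalMap {n : ℕ} (S : Matrix (Fin n) (Fin n) V →ₗ[ℂ] ℂ) :
    V →ₗ[ℂ] CStarMatrix (Fin n) (Fin n) ℂ where
  toFun v := CStarMatrix.ofMatrix (Matrix.of fun i j => S (Matrix.single i j v))
  map_add' v w := by
    ext i j
    simp [Matrix.single_add]
  map_smul' c v := by
    ext i j
    simp [← Matrix.smul_single]

theorem functionalMap_apply {n : ℕ} (S : Matrix (Fin n) (Fin n) V →ₗ[ℂ] ℂ) (v : V) (i j : Fin n) :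
    functionalMap S v i j = S (Matrix.single i j v) := rfl

/-- The quadratic form of an amplification is the functional evaluated on a scalar conjugate. Hence
positive functionals on `M_n(V)` give completely positive maps `V → M_n(ℂ)`. -/
theorem sum_functionalMap {n m : ℕ} (S : Matrix (Fin n) (Fin n) V →ₗ[ℂ] ℂ)
    (x : Matrix (Fin m) (Fin m) V) (c : Fin m → Fin n → ℂ) :
    ∑ p, ∑ q, ∑ i, ∑ j, star (c p i) * functionalMap S (x p q) i j * c q j =
      S (scalarConj (Matrix.of c) x) := by
  conv_rhs => rw [Matrix.matrix_eq_sum_single (scalarConj (Matrix.of c) x)]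
  simp only [scalarConj_apply, map_sum, Matrix.of_apply]
  have h : ∀ i j, S (Matrix.single i j (∑ p, ∑ q, (star (c p i) * c q j) • x p q)) =
      ∑ p, ∑ q, star (c p i) * functionalMap S (x p q) i j * c q j := by
    intro i j
    change (S ∘ₗ Matrix.singleLinearMap ℂ i j) (∑ p, ∑ q, (star (c p i) * c q j) • x p q) = _
    simp only [map_sum, map_smul, smul_eq_mul]
    refine Finset.sum_congr rfl fun p _ => Finset.sum_congr rfl fun q _ => ?_
    rw [mul_right_comm]
    rfl
  simp only [h]
  calc _ = ∑ p, ∑ i, ∑ q, ∑ j, star (c p i) * functionalMap S (x p q) i j * c q j :=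
        Finset.sum_congr rfl fun _ _ => Finset.sum_comm
    _ = ∑ i, ∑ p, ∑ q, ∑ j, star (c p i) * functionalMap S (x p q) i j * c q j := Finset.sum_comm
    _ = ∑ i, ∑ p, ∑ j, ∑ q, star (c p i) * functionalMap S (x p q) i j * c q j :=
        Finset.sum_congr rfl fun _ _ => Finset.sum_congr rfl fun _ _ => Finset.sum_comm
    _ = _ := Finset.sum_congr rfl fun _ _ => Finset.sum_comm

variable [StarAddMonoid V] [StarModule ℂ V] [OperatorSystem V]

theorem functionalMap_mem {n m : ℕ} {S : Matrix (Fin n) (Fin n) V →ₗ[ℂ] ℂ}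
    (hS : ∀ x ∈ posCone n, 0 ≤ S x) {x : Matrix (Fin m) (Fin m) V} (hx : x ∈ posCone m) :
    0 ≤ CStarMatrix.ofMatrix (x.map (functionalMap S)) := by
  refine CStarMatrix.nonneg_iff_quadratic.2 fun c => ?_
  have := hS _ (scalarConj_mem (Matrix.of c) hx)
  rw [← sum_functionalMap] at this
  exact this

end Functional

end OperatorSystem

/-! ### Positive bases and the pairing with the dual. -/

namespace OperatorSystem

section PosBasis

variable {V : Type u} [AddCommGroup V] [Module ℂ V] [StarAddMonoid V] [StarModule ℂ V]
  [OperatorSystem V]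

theorem IsPos.isSelfAdjoint {x : V} (hx : IsPos x) : IsSelfAdjoint x :=
  congrFun (congrFun (isHermitian hx) 0) 0

theorem IsPos.add {x y : V} (hx : IsPos x) (hy : IsPos y) : IsPos (x + y) := add_mem hx hy

theorem IsPos.smul {x : V} (hx : IsPos x) {r : ℝ} (hr : 0 ≤ r) : IsPos ((r : ℂ) • x) :=
  smul_mem hr hx

theorem isPos_smul_unit {r : ℝ} (hr : 0 ≤ r) : IsPos ((r : ℂ) • (unit : V)) := isPos_unit.smul hr

theorem exists_isPos_add {x : V} (hx : IsSelfAdjoint x) :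
    ∃ r : ℝ, 0 < r ∧ IsPos ((r : ℂ) • unit + x) := by
  have h : (Matrix.of fun _ _ : Fin 1 => x).IsHermitian := by
    ext i j
    exact hx
  obtain ⟨r, hr, h1⟩ := exists_smul_unit_add_mem h
  refine ⟨r, hr, ?_⟩
  rw [IsPos]
  convert h1 using 1
  ext i j
  fin_cases i; fin_cases j
  simp

/-- Adding a multiple of the unit makes any self-adjoint element positive, so positive elements
span. Positivity of the basis makes the coordinate functionals self-adjoint and lets errors be
estimated by order. -/
theorem exists_isPos_basis (V : Type u) [AddCommGroup V] [Module ℂ V] [StarAddMonoid V]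
    [StarModule ℂ V] [OperatorSystem V] [FiniteDimensional ℂ V] :
    ∃ (d : ℕ) (b : Module.Basis (Fin d) ℂ V), ∀ i, IsPos (b i) := by
  refine Submodule.exists_basis_mem_of_span_eq_top (P := {x : V | IsPos x}) ?_
  rw [eq_top_iff]
  rintro x -
  have h : ∀ y : V, IsSelfAdjoint y → y ∈ Submodule.span ℂ {x : V | IsPos x} := by
    intro y hy
    obtain ⟨r, hr, h1⟩ := exists_isPos_add hy
    have h2 : y = ((r : ℂ) • unit + y) - (r : ℂ) • unit := by abel
    rw [h2]
    exact sub_mem (Submodule.subset_span h1) (Submodule.smul_mem _ _ (Submodule.subset_span isPos_unit))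
  rw [← realPart_add_I_smul_imaginaryPart x]
  exact Submodule.add_mem _ (h _ (realPart x).2) (Submodule.smul_mem _ _ (h _ (imaginaryPart x).2))

/-- Finitely many self-adjoint elements have a common bound. -/
theorem exists_common_bound {d : ℕ} {x : Fin d → V} (hx : ∀ i, IsSelfAdjoint (x i)) :
    ∃ c : ℝ, 0 < c ∧ ∀ i, IsPos ((c : ℂ) • unit + x i) ∧ IsPos ((c : ℂ) • unit - x i) := by
  choose r hr h using fun i => exists_isPos_add (hx i)
  choose s hs h' using fun i => exists_isPos_add (hx i).neg
  have hsum : ∀ t : Fin d → ℝ, (∀ i, 0 < t i) → ∀ i, t i ≤ ∑ j, t j := fun t ht i =>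
    Finset.single_le_sum (fun j _ => (ht j).le) (Finset.mem_univ i)
  have hr0 : 0 ≤ ∑ j, r j := Finset.sum_nonneg fun i _ => (hr i).le
  have hs0 : 0 ≤ ∑ j, s j := Finset.sum_nonneg fun i _ => (hs i).le
  refine ⟨1 + ∑ j, r j + ∑ j, s j, by positivity, fun i => ⟨?_, ?_⟩⟩
  · convert (h i).add (isPos_smul_unit (r := 1 + ∑ j, r j + ∑ j, s j - r i)
      (by linarith [hsum r hr i])) using 1
    push_cast
    module
  · convert (h' i).add (isPos_smul_unit (r := 1 + ∑ j, r j + ∑ j, s j - s i)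
      (by linarith [hsum s hs i])) using 1
    push_cast
    module

theorem functionalMap_form_nonneg {n : ℕ} {S : Matrix (Fin n) (Fin n) V →ₗ[ℂ] ℂ}
    (hS : ∀ x ∈ posCone n, 0 ≤ S x) {v : V} (hv : IsPos v) (c : Fin n → ℂ) :
    0 ≤ ∑ i, ∑ j, star (c i) * functionalMap S v i j * c j := by
  have h := hS _ (scalarConj_mem (Matrix.of fun _ => c) hv)
  rw [← sum_functionalMap] at h
  simpa using h

end PosBasis

namespace OSDual

variable {E : Type u} [AddCommGroup E] [Module ℂ E] [StarAddMonoid E] [StarModule ℂ E]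
  [OperatorSystem E] {f : FaithfulState E}

theorem pair_single {n : ℕ} (F : Matrix (Fin n) (Fin n) (OSDual f)) (i j : Fin n) (v : E) :
    pair F (Matrix.single i j v) = toDual (F i j) v := by
  rw [pair_apply, Finset.sum_eq_single i, Finset.sum_eq_single j]
  · simp
  · intro l _ hl
    simp [Matrix.single_apply_of_col_ne _ _ hl.symm]
  · simp
  · intro k _ hk
    refine Finset.sum_eq_zero fun l _ => ?_
    simp [Matrix.single_apply_of_row_ne hk.symm]
  · simp

/-- The matrix over the dual which represents a functional on matrices. -/
def ofFunctional (f : FaithfulState E) {n : ℕ} (S : Matrix (Fin n) (Fin n) E →ₗ[ℂ] ℂ) :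
    Matrix (Fin n) (Fin n) (OSDual f) :=
  Matrix.of fun i j => (S ∘ₗ Matrix.singleLinearMap ℂ i j : E →ₗ[ℂ] ℂ)

theorem pair_ofFunctional {n : ℕ} (S : Matrix (Fin n) (Fin n) E →ₗ[ℂ] ℂ) :
    pair (ofFunctional f S) = S := by
  refine LinearMap.ext fun y => ?_
  conv_rhs => rw [Matrix.matrix_eq_sum_single y]
  simp only [map_sum]
  rfl

@[ext]
theorem ext {x y : OSDual f} (h : ∀ v, toDual x v = toDual y v) : x = y := LinearMap.ext h

section

variable {d : ℕ} (f) (b : Module.Basis (Fin d) ℂ E)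

/-- The coordinate functionals of a basis, as elements of the dual. -/
noncomputable def coord (a : Fin d) : OSDual f := b.coord a

theorem toDual_coord (a : Fin d) (v : E) : toDual (coord f b a) v = b.repr v a := rfl

theorem star_coord (hb : ∀ a, IsPos (b a)) (a : Fin d) : IsSelfAdjoint (coord f b a) := by
  refine b.ext fun c => ?_
  change toDual (star (coord f b a)) (b c) = toDual (coord f b a) (b c)
  rw [toDual_star, (hb c).isSelfAdjoint.star_eq, toDual_coord, Module.Basis.repr_self,
    Finsupp.single_apply]
  split_ifs <;> simp

theorem sum_coord (x : OSDual f) : ∑ a, toDual x (b a) • coord f b a = x := by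
  refine OSDual.ext fun v => ?_
  conv_rhs => rw [← b.sum_repr v, map_sum]
  rw [map_sum, LinearMap.sum_apply]
  refine Finset.sum_congr rfl fun a _ => ?_
  rw [map_smul, map_smul, LinearMap.smul_apply, toDual_coord, smul_eq_mul, smul_eq_mul, mul_comm]

theorem map_eq_sum_coord {M : Type*} [AddCommGroup M] [Module ℂ M] (φ : OSDual f →ₗ[ℂ] M)
    (x : OSDual f) : φ x = ∑ a, toDual x (b a) • φ (coord f b a) := by
  conv_lhs => rw [← sum_coord f b x]
  simp

end

variable [FiniteDimensional ℂ E]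

theorem mem_posCone_iff_pair {n : ℕ} {F : Matrix (Fin n) (Fin n) (OSDual f)} :
    F ∈ posCone n ↔ ∀ y ∈ posCone (V := E) n, 0 ≤ pair F y := mem_cone_iff

/-- Bipolar duality: every positive functional on `M_n(E)` is pairing with a positive matrix over
the dual. -/
theorem mem_posCone_of_pair (f : FaithfulState E) {n : ℕ} {y : Matrix (Fin n) (Fin n) E}
    (hy : y.IsHermitian)
    (h : ∀ F : Matrix (Fin n) (Fin n) (OSDual f), F ∈ posCone n → 0 ≤ (pair F y).re) :
    y ∈ posCone n := by
  refine mem_posCone_of_functional hy fun S hS => ?_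
  have := h (ofFunctional f S) (mem_posCone_iff_pair.2 (by rwa [pair_ofFunctional]))
  rwa [pair_ofFunctional] at this

theorem isPos_iff {x : OSDual f} : IsPos x ↔ ∀ v, IsPos v → 0 ≤ toDual x v := by
  rw [IsPos, mem_posCone_iff_pair]
  constructor
  · intro h v hv
    simpa [pair_apply] using h _ hv
  · intro h y hy
    have h4 : (Matrix.of fun _ _ : Fin 1 => y 0 0) = y := by
      ext i j; fin_cases i; fin_cases j; rfl
    simpa [pair_apply] using h (y 0 0) (by rwa [IsPos, h4])

theorem toDual_unit (v : E) : toDual (unit : OSDual f) v = f.toLinearMap v := rfl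

theorem toDual_unit_unit : toDual (unit : OSDual f) unit = 1 := f.map_unit'

instance : FiniteDimensional ℂ (OSDual f) :=
  inferInstanceAs (FiniteDimensional ℂ (E →ₗ[ℂ] ℂ))

/-- Evaluation at a positive `v` is a positive functional on the dual whose value at the order unit
is `f(v)`. -/
theorem norm_toDual_apply_le (x : OSDual f) {v : E} (hv : IsPos v) :
    ‖toDual x v‖ ≤ (f.toLinearMap v).re * matNorm (Matrix.of fun _ _ : Fin 1 => x) :=
  norm_apply_le_mul_matNorm (V := OSDual f) (h := LinearMap.applyₗ v ∘ₗ toDual)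
    (fun x hx => isPos_iff.1 hx v hv) (fun x => by
      change toDual (star x) v = star (toDual x v)
      rw [toDual_star, hv.isSelfAdjoint.star_eq]) x

end OSDual

end OperatorSystem

/-! ### Choi kernels and approximate factorizations. -/

namespace OperatorSystem

theorem unitMatrix_mem (n : ℕ) : (Matrix.of fun p q : Fin n =>
    CStarMatrix.ofMatrix (Matrix.single p q (1 : ℂ))) ∈
      posCone (V := CStarMatrix (Fin n) (Fin n) ℂ) n := by
  rw [mem_posCone_iff, CStarMatrix.nonneg_iff_quadratic]
  intro c
  have h : ∑ p, ∑ q, ∑ i, ∑ j, star (c p i) *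
      CStarMatrix.ofMatrix (Matrix.of fun p q : Fin n =>
        CStarMatrix.ofMatrix (Matrix.single p q (1 : ℂ))) p q i j * c q j =
      star (∑ p, c p p) * ∑ q, c q q := by
    rw [star_sum, Finset.sum_mul_sum]
    refine Finset.sum_congr rfl fun p _ => Finset.sum_congr rfl fun q _ => ?_
    simp [CStarMatrix.ofMatrix_apply, Matrix.single_apply, ite_and]
  rw [h]
  exact star_mul_self_nonneg _

section NearlyCP

variable {E : Type u} [AddCommGroup E] [Module ℂ E] [StarAddMonoid E] [StarModule ℂ E]
  [OperatorSystem E] {f : FaithfulState E}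

open OSDual

/-- The matrix of functionals given by a linear map into `M_n(ℂ)`. -/
def ofMap (f : FaithfulState E) {n : ℕ} (α : E →ₗ[ℂ] CStarMatrix (Fin n) (Fin n) ℂ) :
    Matrix (Fin n) (Fin n) (OSDual f) :=
  Matrix.of fun p q => ({ toFun := fun v => α v p q
                          map_add' := fun v w => by simp
                          map_smul' := fun c v => by simp } : E →ₗ[ℂ] ℂ)

theorem toDual_ofMap {n : ℕ} (α : E →ₗ[ℂ] CStarMatrix (Fin n) (Fin n) ℂ) (p q : Fin n) (v : E) :
    toDual (ofMap f α p q) v = α v p q := rfl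

variable [FiniteDimensional ℂ E] {A : Type v} [CStarAlgebra A] [PartialOrder A] [StarOrderedRing A]

theorem ofMap_mem {n : ℕ} {α : E →ₗ[ℂ] CStarMatrix (Fin n) (Fin n) ℂ} (hα : IsUCP α) :
    ofMap f α ∈ posCone n := by
  refine mem_posCone_iff_pair.2 fun y hy => ?_
  have h := CStarMatrix.nonneg_iff_quadratic.1 (hα.2 n y hy) fun p i => if p = i then 1 else 0
  simpa [pair_apply, toDual_ofMap, CStarMatrix.ofMatrix_apply] using h

/-- If `E` has an approximate factorization through `M_n(ℂ)` then a linear map on the dual which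
is almost positive on the element of `M_n(E^*)` given by that factorization is almost completely
positive. -/
theorem nearly_completelyPositive {H : Type u} [NormedAddCommGroup H] [InnerProductSpace ℂ H]
    [CompleteSpace H] {ι : E →ₗ[ℂ] (H →L[ℂ] H)} (hι : IsUnitalCompleteOrderEmbedding ι) {n : ℕ}
    {α : E →ₗ[ℂ] CStarMatrix (Fin n) (Fin n) ℂ} (hα : IsUCP α)
    {β : CStarMatrix (Fin n) (Fin n) ℂ →CP (H →L[ℂ] H)} (hβ : β 1 = 1) {d : ℕ}
    {b : Module.Basis (Fin d) ℂ E} (hb : ∀ a, IsPos (b a)) {η : ℝ}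
    (hη : ∀ a, ‖β (α (b a)) - ι (b a)‖ ≤ η) {Φ : OSDual f →ₗ[ℂ] A} {C : ℝ}
    (hΦ : ∀ a, 0 ≤ (C : ℂ) • (1 : A) + Φ (coord f b a))
    (hΦ' : ∀ a, 0 ≤ (C : ℂ) • (1 : A) - Φ (coord f b a)) {r : ℝ}
    (hr : (r : ℂ) • matUnit A n + (ofMap f α).map Φ ∈ posCone n)
    {m : ℕ} {F : Matrix (Fin m) (Fin m) (OSDual f)} (hF : F ∈ posCone m) :
    ((r + d * (η * C) : ℝ) : ℂ) • (Matrix.of fun i j => toDual (F i j) unit • (1 : A)) +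
      F.map Φ ∈ posCone m := by
  -- Extending the functional of `F` gives a completely positive `g : B(H) → M_m(ℂ)` with `g ∘ ι =
  -- F`.
  obtain ⟨S, hS, hSF⟩ := exists_positive_extension (V := H →L[ℂ] H) ι
    (IsUCP.map_star ⟨hι.1, fun n x hx => (hι.2 n x).1 hx⟩) unit star_unit hι.1 (pair F)
    (fun y _ hy => mem_posCone_iff_pair.1 hF y ((hι.2 m y).2 hy))
  let g := functionalMap S
  have hg : ∀ v i j, g (ι v) i j = toDual (F i j) v := by
    intro v i j
    rw [← pair_single, ← hSF]
    change S (Matrix.single i j (ι v)) = _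
    congr 1
    ext k l : 2
    by_cases h : i = k ∧ j = l <;> simp [h]
  let u : Fin n → Fin n → CStarMatrix (Fin n) (Fin n) ℂ := fun p q =>
    CStarMatrix.ofMatrix (Matrix.single p q 1)
  have hu : ∀ z : CStarMatrix (Fin n) (Fin n) ℂ, z = ∑ p, ∑ q, z p q • u p q := by
    intro z
    refine (Matrix.matrix_eq_sum_single (CStarMatrix.ofMatrix.symm z)).trans ?_
    refine Finset.sum_congr rfl fun p _ => Finset.sum_congr rfl fun q _ => ?_
    ext i j
    simp [u, CStarMatrix.ofMatrix_apply, Matrix.single_apply]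
  let β' : CStarMatrix (Fin n) (Fin n) ℂ →ₗ[ℂ] (H →L[ℂ] H) := β.toLinearMap
  let ent : Fin m → Fin m → CStarMatrix (Fin m) (Fin m) ℂ →ₗ[ℂ] ℂ := fun i j =>
    { toFun := fun z => z i j, map_add' := fun _ _ => rfl, map_smul' := fun _ _ => rfl }
  -- The Choi matrix of `g ∘ β`; it is positive because the matrix of matrix units is.
  let D : Fin m → Fin n → Fin m → Fin n → ℂ := fun i p j q => g (β' (u p q)) i j
  have hgβ : ∀ z i j, g (β' z) i j = ∑ p, ∑ q, D i p j q * z p q := by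
    intro z i j
    change (ent i j ∘ₗ g ∘ₗ β') z = _
    conv_lhs => rw [hu z]
    simp only [map_sum, map_smul, smul_eq_mul]
    exact Finset.sum_congr rfl fun p _ => Finset.sum_congr rfl fun q _ => mul_comm _ _
  have hβu : (Matrix.of fun p q => β' (u p q)) ∈ posCone (V := H →L[ℂ] H) n :=
    β.map_cstarMatrix_nonneg' n _ (unitMatrix_mem n)
  have hQ := kernel_mem (D := D) (fun c => by
    have h := hS _ (scalarConj_mem (Matrix.of fun p i => c i p) hβu)
    have h1 := sum_functionalMap S (Matrix.of fun p q => β' (u p q)) fun p i => c i p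
    rw [← h1] at h
    refine h.trans_eq ?_
    calc _ = ∑ p, ∑ i, ∑ q, ∑ j, star (c i p) * D i p j q * c j q :=
          Finset.sum_congr rfl fun _ _ => Finset.sum_comm
      _ = ∑ i, ∑ p, ∑ q, ∑ j, star (c i p) * D i p j q * c j q := Finset.sum_comm
      _ = _ := Finset.sum_congr rfl fun _ _ => Finset.sum_congr rfl fun _ _ => Finset.sum_comm) hr
  let θ : Fin d → (H →L[ℂ] H) := fun a => β (α (b a)) - ι (b a)
  have hθs : ∀ a, IsSelfAdjoint (θ a) := by
    intro a
    refine IsSelfAdjoint.sub ?_ ?_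
    · have h := β.map_cstarMatrix_nonneg' 1 _ (CStarMatrix.nonneg_one_iff.2 (hα.isPos (hb a)))
      exact IsSelfAdjoint.of_nonneg (CStarMatrix.nonneg_one_iff.1 h)
    · exact IsSelfAdjoint.of_nonneg (isPos_iff_nonneg.1 ((hι.2 1 _).1 (hb a)))
  have hP : ∀ a, IsPos ((η : ℂ) • (1 : H →L[ℂ] H) + θ a) := fun a =>
    isPos_iff_nonneg.2 (CStarAlgebra.nonneg_of_norm_le (hθs a) (hη a))
  have hP' : ∀ a, IsPos ((η : ℂ) • (1 : H →L[ℂ] H) - θ a) := fun a => by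
    have := CStarAlgebra.nonneg_of_norm_le (hθs a).neg ((norm_neg _).trans_le (hη a))
    rw [← sub_eq_add_neg] at this
    exact isPos_iff_nonneg.2 this
  -- With `θ = β(α(b_a)) - ι(b_a)` and `φ` the value at the coordinate functional, `2(ηC - θ ⊗ φ) =
  -- (η + θ) ⊗ (C - φ) + (η - θ) ⊗ (C + φ)`, a sum of tensor products of positives once `g` is
  -- applied to the first factors.
  have hR : ∀ a, (Matrix.of fun i j => (η * C * toDual (F i j) unit) • (1 : A) -
      g (θ a) i j • Φ (coord f b a)) ∈ posCone m := by
    intro a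
    have h1 := smul_pos_mem (fun c => functionalMap_form_nonneg hS (hP a) c)
      (isPos_iff_nonneg.2 (hΦ' a))
    have h2 := smul_pos_mem (fun c => functionalMap_form_nonneg hS (hP' a) c)
      (isPos_iff_nonneg.2 (hΦ a))
    have h3 := smul_mem (by norm_num : (0 : ℝ) ≤ 1 / 2) (add_mem h1 h2)
    convert h3 using 1
    ext i j : 2
    have h4 : functionalMap S ((η : ℂ) • (1 : H →L[ℂ] H) + θ a) i j =
        η * toDual (F i j) unit + g (θ a) i j := by
      rw [map_add, map_smul, ← hg, hι.1]
      rfl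
    have h5 : functionalMap S ((η : ℂ) • (1 : H →L[ℂ] H) - θ a) i j =
        η * toDual (F i j) unit - g (θ a) i j := by
      rw [map_sub, map_smul, ← hg, hι.1]
      rfl
    simp only [Matrix.smul_apply, Matrix.add_apply, Matrix.of_apply, h4, h5]
    push_cast
    module
  -- The kernel reproduces `F.map Φ` plus the error terms `g(θ a) • Φ(coord a)`, which the matrices
  -- of `hR` cancel. By unitality of `β`, the term `r • 1` becomes `r` times `F(1)`.
  have hfin := add_mem hQ (sum_mem Finset.univ _ fun a _ => hR a)
  convert hfin using 1
  ext i j : 2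
  have hD1 : ∑ p, D i p j p = toDual (F i j) unit := by
    rw [← hg, hι.1, ← hβ]
    change _ = g (β' 1) i j
    rw [hgβ]
    simp [CStarMatrix.one_apply]
  have hDα : ∑ p, ∑ q, D i p j q • Φ (ofMap f α p q) =
      Φ (F i j) + ∑ a, g (θ a) i j • Φ (coord f b a) := by
    rw [map_eq_sum_coord f b Φ (F i j), ← Finset.sum_add_distrib]
    simp only [← map_smul, ← map_sum]
    rw [map_eq_sum_coord f b Φ]
    refine Finset.sum_congr rfl fun a _ => ?_
    have h1 : g (θ a) i j = g (β' (α (b a))) i j - g (ι (b a)) i j := by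
      change g (β' (α (b a)) - ι (b a)) i j = _
      rw [map_sub]
      rfl
    rw [h1, hg, hgβ]
    simp only [map_sum, map_smul, LinearMap.sum_apply, LinearMap.smul_apply, toDual_ofMap,
      smul_eq_mul]
    module
  have hD2 : ∑ p, ∑ q, D i p j q • ((r : ℂ) • matUnit A n) p q =
      ((r : ℂ) * toDual (F i j) unit) • (1 : A) := by
    rw [← hD1, Finset.mul_sum, Finset.sum_smul]
    refine Finset.sum_congr rfl fun p _ => ?_
    rw [Finset.sum_eq_single p]
    · simp only [matUnit, Matrix.smul_apply, Matrix.diagonal_apply_eq, unit_eq_one, smul_smul,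
        mul_comm]
    · intro q _ hq
      simp [matUnit, hq.symm, unit_eq_one]
    · simp
  simp only [Matrix.add_apply, Matrix.smul_apply, Matrix.of_apply, Matrix.sum_apply,
    Matrix.map_apply, smul_add, Finset.sum_add_distrib, Finset.sum_sub_distrib, hDα]
  simp only [Matrix.smul_apply] at hD2
  rw [hD2]
  simp only [Finset.sum_const, Finset.card_univ, Fintype.card_fin]
  rw [← Nat.cast_smul_eq_nsmul ℂ]
  push_cast
  module

end NearlyCP

end OperatorSystem

/-! ### Almost contractive unital maps are almost hermitian and almost positive. -/

namespace OperatorSystem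

section AlmostPositive

variable {V : Type u} [AddCommGroup V] [Module ℂ V] [StarAddMonoid V] [StarModule ℂ V]
  {A : Type v} [CStarAlgebra A]

/-- The hermitian part of a linear map. -/
noncomputable def hermPart (φ : V →ₗ[ℂ] A) : V →ₗ[ℂ] A where
  toFun x := (1 / 2 : ℂ) • (φ x + star (φ (star x)))
  map_add' x y := by
    simp only [map_add, star_add]
    module
  map_smul' c x := by
    simp only [map_smul, star_smul, star_star, RingHom.id_apply]
    module

theorem hermPart_apply (φ : V →ₗ[ℂ] A) (x : V) :
    hermPart φ x = (1 / 2 : ℂ) • (φ x + star (φ (star x))) := rfl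

theorem hermPart_unit [OperatorSystem V] {φ : V →ₗ[ℂ] A} (h1 : φ unit = 1) : hermPart φ unit = 1 := by
  rw [hermPart_apply, star_unit, h1, star_one]
  module

theorem isSelfAdjoint_hermPart (φ : V →ₗ[ℂ] A) {x : V} (hx : IsSelfAdjoint x) :
    IsSelfAdjoint (hermPart φ x) := by
  rw [hermPart_apply, hx.star_eq, isSelfAdjoint_iff]
  simp [add_comm]

theorem norm_hermPart_le (φ : V →ₗ[ℂ] A) {x : V} (hx : IsSelfAdjoint x) :
    ‖hermPart φ x‖ ≤ ‖φ x‖ := by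
  rw [hermPart_apply, hx.star_eq, norm_smul]
  have h := norm_add_le (φ x) (star (φ x))
  rw [norm_star] at h
  have h2 : ‖(1 / 2 : ℂ)‖ = 1 / 2 := by norm_num
  rw [h2]
  linarith

theorem sub_hermPart (φ : V →ₗ[ℂ] A) {x : V} (hx : IsSelfAdjoint x) :
    φ x - hermPart φ x = (1 / 2 : ℂ) • (φ x - star (φ x)) := by
  rw [hermPart_apply, hx.star_eq]
  module

variable [OperatorSystem V] [PartialOrder A] [StarOrderedRing A]

theorem matNorm_le_of_isHermitian_bound {n : ℕ} {z : Matrix (Fin n) (Fin n) V} {c s τ : ℝ}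
    (hc : 0 < c) (hs : 0 < s) (hsτ : s * s = c * c + τ * τ)
    (h₁ : (c : ℂ) • matUnit V n + z ∈ posCone n) (h₂ : (c : ℂ) • matUnit V n - z ∈ posCone n) :
    matNorm (z + (Complex.I * τ) • matUnit V n) ≤ s :=
  matNorm_le hs.le (block_add_smul_I_mem hc hs hsτ h₁ h₂)

theorem diagonal_mem {n : ℕ} {x : V} (hx : IsPos x) :
    (Matrix.diagonal fun _ : Fin n => x) ∈ posCone n := by
  have h := smul_pos_mem (P := (1 : Matrix (Fin n) (Fin n) ℂ)) (fun c => by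
    simp only [Matrix.one_apply, mul_ite, mul_one, mul_zero, ite_mul, zero_mul,
      Finset.sum_ite_eq, Finset.mem_univ, if_true]
    exact Finset.sum_nonneg fun i _ => star_mul_self_nonneg _) hx
  convert h using 1
  ext i j : 2
  by_cases hij : i = j <;> simp [hij]

theorem norm_le_of_nonneg {b : A} {r : ℝ} (hr : 0 < r) (h₁ : 0 ≤ (r : ℂ) • (1 : A) + b)
    (h₂ : 0 ≤ (r : ℂ) • (1 : A) - b) : ‖b‖ ≤ r := by
  have h := block_add_smul_I_mem (V := A) (n := 1) (z := Matrix.of fun _ _ => b) (τ := 0) hr hr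
    (by simp) (by
      refine (congrArg (· ∈ posCone (V := A) 1) ?_).mpr (isPos_iff_nonneg.2 h₁)
      ext i j : 2
      simp [matUnit, Subsingleton.elim i j, unit_eq_one]) (by
      refine (congrArg (· ∈ posCone (V := A) 1) ?_).mpr (isPos_iff_nonneg.2 h₂)
      ext i j : 2
      simp [matUnit, Subsingleton.elim i j, unit_eq_one])
  rw [Complex.ofReal_zero, mul_zero, zero_smul, add_zero] at h
  rw [← CStarMatrix.norm_ofMatrix_one]
  exact norm_le_of_block_mem hr h

/-- Shifting `y` by `± iτ` shifts its imaginary part by `± τ`, so the two norm bounds force the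
imaginary part to lie between `-(R - τ)` and `R - τ`. -/
theorem norm_sub_star_le {y : A} {R τ η : ℝ} (hη : 0 < η) (hR : R - τ ≤ η)
    (h₁ : ‖y + (Complex.I * τ) • (1 : A)‖ ≤ R)
    (h₂ : ‖y + (Complex.I * (-τ : ℝ)) • (1 : A)‖ ≤ R) :
    ‖(1 / 2 : ℂ) • (y - star y)‖ ≤ η := by
  let im : A → A := fun z => (-Complex.I / 2) • (z - star z)
  have hnI : ‖-Complex.I / 2‖ = 1 / 2 := by simp
  have him : ∀ z, ‖im z‖ ≤ ‖z‖ := fun z => by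
    have h := norm_sub_le z (star z)
    rw [norm_star] at h
    change ‖(-Complex.I / 2) • (z - star z)‖ ≤ _
    rw [norm_smul, hnI]
    linarith
  have hsa : ∀ z, IsSelfAdjoint (im z) := fun z => by
    rw [isSelfAdjoint_iff]
    change star ((-Complex.I / 2) • (z - star z)) = (-Complex.I / 2) • (z - star z)
    simp only [star_smul, star_sub, star_star, star_div₀, star_neg, RCLike.star_def,
      Complex.conj_I, map_ofNat]
    module
  have hadd : ∀ t : ℝ, im (y + (Complex.I * t) • (1 : A)) = im y + (t : ℂ) • (1 : A) := fun t => by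
    change (-Complex.I / 2) • (y + (Complex.I * t) • (1 : A) -
      star (y + (Complex.I * t) • (1 : A))) = (-Complex.I / 2) • (y - star y) + (t : ℂ) • (1 : A)
    simp only [star_smul, star_add, star_one, star_mul', RCLike.star_def, Complex.conj_I,
      Complex.conj_ofReal]
    have h : (t : ℂ) • (1 : A) = (-(Complex.I * Complex.I) * t) • (1 : A) := by simp
    rw [h]
    module
  have h3 := CStarAlgebra.nonneg_of_norm_le (hsa _).neg
    ((norm_neg (im _)).trans_le ((him _).trans h₁))
  have h4 := CStarAlgebra.nonneg_of_norm_le (hsa _) ((him _).trans h₂)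
  rw [hadd] at h3 h4
  have hpos : 0 ≤ ((η - (R - τ) : ℝ) : ℂ) • (1 : A) := by
    rw [Complex.coe_smul]
    exact smul_nonneg (by linarith) zero_le_one
  have h5 : ‖im y‖ ≤ η := by
    refine norm_le_of_nonneg hη ?_ ?_
    · convert add_nonneg h4 hpos using 1
      push_cast
      module
    · convert add_nonneg h3 hpos using 1
      push_cast
      module
  have h6 : ‖im y‖ = ‖(1 / 2 : ℂ) • (y - star y)‖ := by
    change ‖(-Complex.I / 2) • (y - star y)‖ = _
    rw [norm_smul, norm_smul, hnI]
    norm_num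
  rwa [← h6]

variable {φ : V →ₗ[ℂ] A} {n : ℕ} {c₀ : ℝ}

/-- The bound is assumed on level `n` only; it passes to single elements through constant diagonal
matrices, read at one diagonal entry, which exists because `0 < n`. -/
theorem norm_map_add_smul_I_le (h1 : φ unit = 1) (hn : 0 < n) (h0 : 0 ≤ c₀)
    (hφ : ∀ x : Matrix (Fin n) (Fin n) V, ‖CStarMatrix.ofMatrix (x.map φ)‖ ≤ c₀ * matNorm x)
    {x : V} {c s τ : ℝ} (hc : 0 < c) (hs : 0 < s) (hsτ : s * s = c * c + τ * τ)
    (h₁ : IsPos ((c : ℂ) • unit + x)) (h₂ : IsPos ((c : ℂ) • unit - x)) :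
    ‖φ x + (Complex.I * τ) • (1 : A)‖ ≤ c₀ * s := by
  have h := matNorm_le_of_isHermitian_bound (n := n) (z := Matrix.diagonal fun _ => x) hc hs hsτ
    (by
      convert diagonal_mem (n := n) h₁ using 1
      ext i j : 2
      by_cases hij : i = j <;> simp [matUnit, hij])
    (by
      convert diagonal_mem (n := n) h₂ using 1
      ext i j : 2
      by_cases hij : i = j <;> simp [matUnit, hij])
  have h2 := (hφ _).trans (mul_le_mul_of_nonneg_left h h0)
  refine le_trans ?_ h2
  have h3 := CStarMatrix.norm_entry_le_norm (M := CStarMatrix.ofMatrix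
    (((Matrix.diagonal fun _ : Fin n => x) + (Complex.I * τ) • matUnit V n).map φ))
    (i := ⟨0, hn⟩) (j := ⟨0, hn⟩)
  refine le_trans (le_of_eq ?_) h3
  congr 1
  simp [CStarMatrix.ofMatrix_apply, matUnit, h1]

theorem norm_sub_hermPart_le (h1 : φ unit = 1) (hn : 0 < n) (h0 : 0 ≤ c₀)
    (hφ : ∀ x : Matrix (Fin n) (Fin n) V, ‖CStarMatrix.ofMatrix (x.map φ)‖ ≤ c₀ * matNorm x)
    {x : V} {c τ η : ℝ} (hc : 0 < c) (hη : 0 < η)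
    (hτ : c₀ * Real.sqrt (c * c + τ * τ) - τ ≤ η)
    (h₁ : IsPos ((c : ℂ) • unit + x)) (h₂ : IsPos ((c : ℂ) • unit - x)) (hx : IsSelfAdjoint x) :
    ‖φ x - hermPart φ x‖ ≤ η := by
  have hpos : 0 < c * c + τ * τ :=
    add_pos_of_pos_of_nonneg (by positivity) (mul_self_nonneg τ)
  have hs := Real.mul_self_sqrt hpos.le
  rw [sub_hermPart φ hx]
  refine norm_sub_star_le hη hτ (norm_map_add_smul_I_le h1 hn h0 hφ hc (Real.sqrt_pos.2 hpos) hs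
    h₁ h₂) (norm_map_add_smul_I_le h1 hn h0 hφ hc (Real.sqrt_pos.2 hpos) ?_ h₁ h₂)
  rw [hs]
  ring

/-- If the amplification of a unital map is almost contractive, then the amplification of its
hermitian part is almost positive. -/
theorem hermPart_almost_positive (h1 : φ unit = 1) (h0 : 0 ≤ c₀)
    (hφ : ∀ x : Matrix (Fin n) (Fin n) V, ‖CStarMatrix.ofMatrix (x.map φ)‖ ≤ c₀ * matNorm x)
    {x : Matrix (Fin n) (Fin n) V} {c : ℝ} (hc : 0 < c) (hx : x ∈ posCone n)
    (hxc : (c : ℂ) • matUnit V n - x ∈ posCone n) :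
    ((c / 2 * (c₀ - 1) : ℝ) : ℂ) • matUnit A n + x.map (hermPart φ) ∈ posCone n := by
  -- Centring `x` at the midpoint of the order interval from `0` to `c` gives norm at most `c / 2`.
  -- The image has norm at most `c₀ c / 2`, so undoing the shift loses only `(c / 2)(c₀ - 1)`.
  have hz := matNorm_le_of_isHermitian_bound (z := x - ((c / 2 : ℝ) : ℂ) • matUnit V n) (τ := 0)
    (half_pos hc) (half_pos hc) (by simp) (by simpa using hx) (by
      convert hxc using 1
      push_cast
      module)
  rw [Complex.ofReal_zero, mul_zero, zero_smul, add_zero] at hz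
  have hN := (hφ _).trans (mul_le_mul_of_nonneg_left hz h0)
  set z := x - ((c / 2 : ℝ) : ℂ) • matUnit V n with hzdef
  set Z : CStarMatrix (Fin n) (Fin n) A := CStarMatrix.ofMatrix (z.map φ) with hZ
  have hzh : z.IsHermitian :=
    (isHermitian hx).sub (by
      rw [Matrix.IsHermitian, Matrix.conjTranspose_smul, (matUnit_isHermitian n).eq,
        RCLike.star_def, Complex.conj_ofReal])
  have hZ' : CStarMatrix.ofMatrix (z.map (hermPart φ)) = (1 / 2 : ℂ) • (Z + star Z) := by
    ext i j
    have := congrFun (congrFun hzh i) j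
    rw [Matrix.conjTranspose_apply] at this
    change hermPart φ (z i j) = (1 / 2 : ℂ) • (φ (z i j) + star (φ (z j i)))
    rw [hermPart_apply, ← this, star_star]
  have hsa : IsSelfAdjoint (CStarMatrix.ofMatrix (z.map (hermPart φ))) := by
    rw [hZ', isSelfAdjoint_iff]
    simp [add_comm]
  have hN' : ‖CStarMatrix.ofMatrix (z.map (hermPart φ))‖ ≤ c₀ * (c / 2) := by
    have h := norm_add_le Z (star Z)
    rw [norm_star] at h
    rw [hZ', norm_smul]
    have h2 : ‖(1 / 2 : ℂ)‖ = 1 / 2 := by norm_num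
    rw [h2]
    linarith
  have h := CStarAlgebra.nonneg_of_norm_le hsa hN'
  rw [mem_posCone_iff]
  convert h using 1
  ext i j
  change ((c / 2 * (c₀ - 1) : ℝ) : ℂ) • (matUnit A n i j) + hermPart φ (x i j) =
    ((c₀ * (c / 2) : ℝ) : ℂ) • (1 : CStarMatrix (Fin n) (Fin n) A) i j + hermPart φ (z i j)
  have h3 : hermPart φ (z i j) = hermPart φ (x i j) - ((c / 2 : ℝ) : ℂ) • matUnit A n i j := by
    rw [hzdef, Matrix.sub_apply, Matrix.smul_apply, map_sub, map_smul]
    by_cases hij : i = j <;> simp [matUnit, hij, hermPart_unit h1, unit_eq_one]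
  have h4 : (1 : CStarMatrix (Fin n) (Fin n) A) i j = matUnit A n i j := rfl
  rw [h3, h4]
  push_cast
  module

end AlmostPositive

/-- For large `τ` the difference `√(c² + τ²) - τ` is about `c² / (2τ)`; `τ = 2c² / κ` makes it at
most `κ / 4`, and `ε₀` then keeps `ετ` below `κ / 2`. -/
theorem exists_sqrt_bound {c κ : ℝ} (hκ : 0 < κ) :
    ∃ τ ε₀ : ℝ, 0 < ε₀ ∧ ε₀ ≤ 1 ∧ ∀ ε, 0 ≤ ε → ε ≤ ε₀ →
      (1 + ε) * Real.sqrt (c * c + τ * τ) - τ ≤ κ := by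
  have hτ : 0 ≤ 2 * c ^ 2 / κ := by positivity
  refine ⟨2 * c ^ 2 / κ, min 1 (κ / (2 * (2 * c ^ 2 / κ) + 1)), by positivity, min_le_left _ _, ?_⟩
  intro ε h0 hε
  set τ := 2 * c ^ 2 / κ with hτdef
  have h1 : Real.sqrt (c * c + τ * τ) ≤ τ + κ / 4 := by
    refine Real.sqrt_le_iff.2 ⟨by positivity, ?_⟩
    have h : τ * κ = 2 * c ^ 2 := by rw [hτdef]; field_simp
    nlinarith [sq_nonneg κ]
  have h2 := hε.trans (min_le_left _ _)
  have h3 : ε * (2 * τ + 1) ≤ κ := (le_div_iff₀ (by positivity)).1 (hε.trans (min_le_right _ _))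
  have h4 : (1 + ε) * Real.sqrt (c * c + τ * τ) ≤ (1 + ε) * (τ + κ / 4) :=
    mul_le_mul_of_nonneg_left h1 (by linarith)
  nlinarith

section Sub

variable {V : Type u} [AddCommGroup V] [Module ℂ V] [StarAddMonoid V] [StarModule ℂ V]
  [OperatorSystem V] (S : Subsystem V)

theorem matNorm_subsystem {n : ℕ} (x : Matrix (Fin n) (Fin n) S.toSubmodule) :
    matNorm x = matNorm (x.map S.toSubmodule.subtype) := by
  have h : ∀ t : ℝ, (block t x).map S.toSubmodule.subtype =
      block t (x.map S.toSubmodule.subtype) := fun t => by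
    have h1 : ∀ i j, ((matUnit S.toSubmodule n i j : S.toSubmodule) : V) = matUnit V n i j := by
      intro i j
      by_cases hij : i = j
      · subst hij
        simp only [matUnit, Matrix.diagonal_apply_eq]
        rfl
      · simp [matUnit, hij]
    refine ext_blk (fun i j => ?_) (fun i j => ?_) (fun i j => by simp [block]; rfl) fun i j => ?_ <;>
      simp [block, h1]
  rw [matNorm_eq, matNorm_eq]
  simp_rw [← h]
  rfl

theorem IsUCP.restrict {A : Type v} [CStarAlgebra A] [PartialOrder A] [StarOrderedRing A]
    {ψ : V →ₗ[ℂ] A} (hψ : IsUCP ψ) : IsUCP (ψ ∘ₗ S.toSubmodule.subtype) :=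
  ⟨hψ.1, fun n x hx => hψ.2 n (x.map S.toSubmodule.subtype) hx⟩

variable (V) in
/-- The whole space, as a subsystem. -/
def topSubsystem : Subsystem V :=
  { (⊤ : Submodule ℂ V) with
    star_mem' := fun _ _ => trivial
    unit_mem' := trivial }

variable (V) in
/-- The identification of the whole space with the top subsystem. -/
def toTop : V →ₗ[ℂ] (topSubsystem V).toSubmodule :=
  LinearMap.codRestrict _ LinearMap.id fun _ => trivial

instance [FiniteDimensional ℂ V] : FiniteDimensional ℂ (topSubsystem V).toSubmodule :=
  inferInstanceAs (FiniteDimensional ℂ (⊤ : Submodule ℂ V))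

end Sub

end OperatorSystem

/-! ### Exactness of a system implies CP-stability of its dual. -/

namespace OperatorSystem

section AbstractMaps

variable {V : Type u} [AddCommGroup V] [Module ℂ V] [StarAddMonoid V] [StarModule ℂ V]
  [OperatorSystem V] {A : Type v} [CStarAlgebra A] [PartialOrder A] [StarOrderedRing A]

theorem IsUnitalCompleteOrderEmbedding.isPos_iff {ι : V →ₗ[ℂ] A}
    (hι : IsUnitalCompleteOrderEmbedding ι) {x : V} :
    IsPos x ↔ 0 ≤ ι x :=
  ⟨fun h => isPos_iff_nonneg.1 ((hι.2 1 _).1 h), fun h => (hι.2 1 _).2 (isPos_iff_nonneg.2 h)⟩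

theorem ampNormLT_one {θ : V →ₗ[ℂ] A} {c r : ℝ} (hc : c < r)
    (h : ∀ x, ‖θ x‖ ≤ c * matNorm (Matrix.of fun _ _ : Fin 1 => x)) : AmpNormLT θ 1 r := by
  refine ⟨c, hc, fun x => ?_⟩
  obtain ⟨y, rfl⟩ : ∃ y : V, x = Matrix.of fun _ _ => y := ⟨x 0 0, by
    ext i j : 2
    rw [Subsingleton.elim i 0, Subsingleton.elim j 0]
    rfl⟩
  exact (CStarMatrix.norm_ofMatrix_one (θ y)).trans_le (h y)

end AbstractMaps

section ExactToStable

variable {E : Type u} [AddCommGroup E] [Module ℂ E] [StarAddMonoid E] [StarModule ℂ E]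
  [OperatorSystem E] {f : FaithfulState E}

open OSDual

/-- Through `M_0(ℂ)` unitality forces `1 = 0` in `B(H)`, so every element of `E` would be positive.
CP-stability requires a positive amplification index. -/
theorem pos_of_ucp_factorization [Nontrivial E] {H : Type u} [NormedAddCommGroup H]
    [InnerProductSpace ℂ H] [CompleteSpace H] {ι : E →ₗ[ℂ] (H →L[ℂ] H)}
    (hι : IsUnitalCompleteOrderEmbedding ι) {n : ℕ}
    {β : CStarMatrix (Fin n) (Fin n) ℂ →CP (H →L[ℂ] H)} (hβ : β 1 = 1) : 0 < n := by
  rcases Nat.eq_zero_or_pos n with rfl | h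
  · exfalso
    have h0 : (1 : CStarMatrix (Fin 0) (Fin 0) ℂ) = 0 := by
      ext i
      exact i.elim0
    have h1 : (0 : H →L[ℂ] H) = 1 := by rw [← hβ, h0, map_zero]
    obtain ⟨x, hx⟩ := exists_ne (0 : E)
    have h3 : ∀ z : H →L[ℂ] H, z = 0 := fun z => by rw [← mul_one z, ← h1, mul_zero]
    have h2 : ∀ y : E, IsPos y := fun y => hι.isPos_iff.2 (h3 (ι y)).ge
    exact hx (congrFun (congrFun (eq_zero (h2 x) (h2 (-x))) 0) 0)
  · exact h

variable [FiniteDimensional ℂ E]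

/-- The defect is measured against the unital map `x ↦ x(1)1`, so adding `δ` times that map repairs
positivity on every level at once, and dividing by `1 + δ` restores unitality. -/
theorem exists_isUCP_near {A : Type v} [CStarAlgebra A] [PartialOrder A] [StarOrderedRing A]
    {Φ : OSDual f →ₗ[ℂ] A} (h1 : Φ unit = 1) {δ : ℝ} (hδ : 0 ≤ δ)
    (hΦ : ∀ (m : ℕ), ∀ F ∈ posCone (V := OSDual f) m,
      (δ : ℂ) • (Matrix.of fun i j => toDual (F i j) unit • (1 : A)) + F.map Φ ∈ posCone m) :
    ∃ ψ : OSDual f →ₗ[ℂ] A, IsUCP ψ ∧ ∀ x, ‖Φ x - ψ x‖ ≤ δ * (‖Φ x‖ + ‖toDual x unit‖) := by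
  let ev : OSDual f →ₗ[ℂ] A :=
    (LinearMap.toSpanSingleton ℂ A 1) ∘ₗ (LinearMap.applyₗ (unit : E) ∘ₗ toDual)
  have hev : ∀ x, ev x = toDual x unit • (1 : A) := fun _ => rfl
  have hpos : 0 < 1 + δ := by linarith
  have hne : ((1 + δ : ℝ) : ℂ) ≠ 0 := by exact_mod_cast hpos.ne'
  refine ⟨(((1 + δ)⁻¹ : ℝ) : ℂ) • ((δ : ℂ) • ev + Φ), ⟨?_, fun m F hF => ?_⟩, fun x => ?_⟩
  · rw [LinearMap.smul_apply, LinearMap.add_apply, LinearMap.smul_apply, hev, toDual_unit_unit, h1,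
      one_smul, Complex.ofReal_inv, inv_smul_eq_iff₀ hne]
    push_cast
    module
  · refine mem_posCone_iff.1 ?_
    convert smul_mem (r := (1 + δ)⁻¹) (by positivity) (hΦ m F hF) using 1
    ext i j : 2
    simp [hev]
  · have h : Φ x - ((((1 + δ)⁻¹ : ℝ) : ℂ) • ((δ : ℂ) • ev + Φ)) x =
        ((δ / (1 + δ) : ℝ) : ℂ) • (Φ x - ev x) := by
      have : (1 - ((1 + δ)⁻¹ : ℝ) : ℂ) = ((δ / (1 + δ) : ℝ) : ℂ) := by
        rw [← Complex.ofReal_one, ← Complex.ofReal_sub]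
        congr 1
        field_simp
        ring
      rw [smul_sub, ← this]
      have h2 : (((1 + δ)⁻¹ : ℝ) : ℂ) * δ = ((δ / (1 + δ) : ℝ) : ℂ) := by
        rw [← Complex.ofReal_mul]
        congr 1
        field_simp
      simp only [LinearMap.smul_apply, LinearMap.add_apply, smul_add, smul_smul, h2, ← this]
      module
    rw [h, norm_smul, Complex.norm_real, Real.norm_of_nonneg (by positivity)]
    have h3 : ‖ev x‖ ≤ ‖toDual x unit‖ := by
      rw [hev, norm_smul]
      exact mul_le_of_le_one_right (norm_nonneg _) (CStarAlgebra.norm_one_le_one A)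
    refine mul_le_mul (div_le_self hδ (by linarith)) ?_ (norm_nonneg _) hδ
    exact (norm_sub_le _ _).trans (by linarith)

theorem norm_apply_le_sum_coord {A : Type v} [CStarAlgebra A] {d : ℕ}
    {b : Module.Basis (Fin d) ℂ E} (hb : ∀ a, IsPos (b a)) {θ : OSDual f →ₗ[ℂ] A} {κ : ℝ}
    (hθ : ∀ a, ‖θ (coord f b a)‖ ≤ κ) (x : OSDual f) :
    ‖θ x‖ ≤ κ * (∑ a, (f.toLinearMap (b a)).re) * matNorm (Matrix.of fun _ _ : Fin 1 => x) := by
  rw [map_eq_sum_coord f b θ x]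
  refine (norm_sum_le _ _).trans ?_
  rw [mul_assoc, Finset.sum_mul, Finset.mul_sum]
  refine Finset.sum_le_sum fun a _ => ?_
  rw [norm_smul, mul_comm]
  exact mul_le_mul (hθ a) (norm_toDual_apply_le x (hb a)) (norm_nonneg _)
    ((norm_nonneg _).trans (hθ a))

/-- The quantitative form of CP-stability for the dual of an exact system. -/
theorem exists_near_of_isExact [Nontrivial E] (hE : IsExact E) {δ : ℝ} (hδ : 0 < δ) :
    ∃ (n : ℕ) (ε : ℝ), 0 < n ∧ 0 < ε ∧
      ∀ (A : Type v) [CStarAlgebra A] [PartialOrder A] [StarOrderedRing A]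
        (φ : OSDual f →ₗ[ℂ] A), φ unit = 1 →
        (∀ x : Matrix (Fin n) (Fin n) (OSDual f),
          ‖CStarMatrix.ofMatrix (x.map φ)‖ ≤ (1 + ε) * matNorm x) →
        ∃ ψ : OSDual f →ₗ[ℂ] A, IsUCP ψ ∧
          ∀ x, ‖φ x - ψ x‖ ≤ δ * matNorm (Matrix.of fun _ _ : Fin 1 => x) := by
  classical
  obtain ⟨H, _, _, _, ι, hι, hE⟩ := hE
  obtain ⟨d, b, hb⟩ := exists_isPos_basis E
  have hsa := star_coord f b hb
  obtain ⟨c, hc, hcb⟩ := exists_common_bound hsa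
  set C := 2 * c with hC
  set D := C + ∑ a, ‖toDual (coord f b a) unit‖ with hD
  set G := ∑ a, (f.toLinearMap (b a)).re with hG
  have hD0 : 0 ≤ D := by positivity
  have hG0 : 0 ≤ G := Finset.sum_nonneg fun a _ => (Complex.nonneg_iff.1 (f.nonneg' _ (hb a))).1
  -- On each coordinate functional, `κ` bounds the distance to the hermitian part and `κ * D` that
  -- from there to the u.c.p. map; `G` converts these bounds into a norm bound.
  obtain ⟨κ, hκ, hκδ⟩ : ∃ κ : ℝ, 0 < κ ∧ (κ + κ * D) * G ≤ δ := by
    refine ⟨δ / ((1 + D) * G + 1), by positivity, ?_⟩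
    have : (δ / ((1 + D) * G + 1) + δ / ((1 + D) * G + 1) * D) * G =
        δ * (((1 + D) * G) / ((1 + D) * G + 1)) := by ring
    rw [this]
    exact mul_le_of_le_one_right hδ.le ((div_le_one (by positivity)).2 (by linarith))
  have hη : 0 < κ / (2 * (d * C + 1)) := by positivity
  obtain ⟨n, α, β, hα, hβ, hαβ⟩ := hE (Finset.univ.image b) _ hη
  have hn := pos_of_ucp_factorization hι hβ
  have hαm := ofMap_mem (f := f) hα
  -- An order bound for `α` in `M_n(E^*)`. With `ε ≤ κ / cα`, almost contractivity costs at most `κ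
  -- / 2` in positivity there; the choice of `η` spends the other `κ / 2`.
  obtain ⟨cα, hcα, hαc⟩ := exists_smul_unit_add_mem (V := OSDual f) (isHermitian hαm).neg
  obtain ⟨τ, ε₀, hε₀, hε₁, hτ⟩ := exists_sqrt_bound (c := c) hκ
  have hε : 0 < min ε₀ (κ / cα) := by positivity
  refine ⟨n, min ε₀ (κ / cα), hn, hε, fun A _ _ _ φ h1 hφ => ?_⟩
  set ε := min ε₀ (κ / cα) with hεdef
  have hε2 : ε ≤ 1 := (min_le_left _ _).trans hε₁
  have h0 : 0 ≤ 1 + ε := by linarith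
  have hb1 : ∀ a, ‖hermPart φ (coord f b a)‖ ≤ C := fun a => by
    refine (norm_hermPart_le φ (hsa a)).trans ?_
    have h := norm_map_add_smul_I_le h1 hn h0 hφ (τ := 0) hc hc (by simp) (hcb a).1 (hcb a).2
    rw [Complex.ofReal_zero, mul_zero, zero_smul, add_zero] at h
    refine h.trans ?_
    rw [hC]
    exact mul_le_mul_of_nonneg_right (by linarith) hc.le
  have hb2 : ∀ a, ‖φ (coord f b a) - hermPart φ (coord f b a)‖ ≤ κ := fun a =>
    norm_sub_hermPart_le h1 hn h0 hφ hc hκ (hτ ε hε.le (min_le_left _ _)) (hcb a).1 (hcb a).2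
      (hsa a)
  have hr := hermPart_almost_positive h1 h0 hφ hcα hαm (by
    rw [sub_eq_add_neg]
    exact hαc)
  have hsaΦ := fun a => isSelfAdjoint_hermPart φ (hsa a)
  have hΦ := fun a => CStarAlgebra.nonneg_of_norm_le (hsaΦ a) (hb1 a)
  have hΦ' : ∀ a, 0 ≤ (C : ℂ) • (1 : A) - hermPart φ (coord f b a) := fun a => by
    rw [sub_eq_add_neg]
    exact CStarAlgebra.nonneg_of_norm_le (hsaΦ a).neg ((norm_neg _).trans_le (hb1 a))
  have hnear := fun (m : ℕ) (F : Matrix (Fin m) (Fin m) (OSDual f)) (hF : F ∈ posCone m) =>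
    nearly_completelyPositive hι hα hβ hb
      (fun a => (hαβ (b a) (Finset.mem_image_of_mem _ (Finset.mem_univ a))).le) hΦ hΦ' hr hF
  have hC0 : 0 < C := by positivity
  obtain ⟨ψ, hψ, hψn⟩ := exists_isUCP_near (hermPart_unit h1) (by
    have : 0 ≤ cα / 2 * (1 + ε - 1) := mul_nonneg (by positivity) (by linarith)
    positivity) hnear
  have hδ' : cα / 2 * (1 + ε - 1) + d * (κ / (2 * (d * C + 1)) * C) ≤ κ := by
    have h2 : cα / 2 * (1 + ε - 1) ≤ κ / 2 := by
      have := (le_div_iff₀ hcα).1 (min_le_right ε₀ (κ / cα))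
      rw [← hεdef] at this
      linarith
    have h3 : d * (κ / (2 * (d * C + 1)) * C) ≤ κ / 2 := by
      have : d * (κ / (2 * (d * C + 1)) * C) = κ / 2 * ((d * C) / (d * C + 1)) := by
        field_simp
      rw [this]
      exact mul_le_of_le_one_right (by positivity) ((div_le_one (by positivity)).2 (by linarith))
    linarith
  refine ⟨ψ, hψ, fun x => ?_⟩
  have h4 : ∀ a, ‖(φ - ψ) (coord f b a)‖ ≤ κ + κ * D := fun a => by
    have h5 := norm_add_le (φ (coord f b a) - hermPart φ (coord f b a))
      (hermPart φ (coord f b a) - ψ (coord f b a))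
    rw [sub_add_sub_cancel] at h5
    refine h5.trans (add_le_add (hb2 a) ((hψn _).trans ?_))
    refine mul_le_mul hδ' (add_le_add (hb1 a) ?_) (by positivity) hκ.le
    exact Finset.single_le_sum (f := fun a => ‖toDual (coord f b a) unit‖)
      (fun i _ => norm_nonneg _) (Finset.mem_univ a)
  exact (norm_apply_le_sum_coord hb h4 x).trans
    (mul_le_mul_of_nonneg_right hκδ (matNorm_nonneg _))

theorem cpStable_of_isExact [Nontrivial E] (hE : IsExact E) (f : FaithfulState E) :
    CPStable.{u, v} (OSDual f) := by
  intro E₀ _ δ hδ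
  obtain ⟨n, ε, hn, hε, h⟩ := exists_near_of_isExact (f := f) hE (half_pos hδ)
  -- The dual is finite-dimensional, so the larger subsystem may be all of it, whatever `E₀` is.
  refine ⟨topSubsystem _, fun _ _ => trivial, inferInstance, n, ε, hn, hε, fun A _ _ _ φ h1 hφ => ?_⟩
  obtain ⟨c, hc, hφ⟩ := hφ
  obtain ⟨ψ, hψ, hφψ⟩ := h A (φ ∘ₗ toTop _) h1 fun x => by
    refine (hφ (x.map (toTop _))).trans ?_
    rw [matNorm_subsystem]
    exact mul_le_mul_of_nonneg_right hc.le (matNorm_nonneg _)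
  refine ⟨ψ ∘ₗ E₀.toSubmodule.subtype, hψ.restrict E₀, ampNormLT_one (half_lt_self hδ) fun y => ?_⟩
  rw [matNorm_subsystem]
  exact hφψ y.1

end ExactToStable

end OperatorSystem

/-! ### Unital normalisation, matrix-valued states and finite sums. -/

theorem Matrix.exists_conjTranspose_mul_self_eq {n : ℕ} {P : Matrix (Fin n) (Fin n) ℂ}
    (hP : ∀ c : Fin n → ℂ, 0 ≤ ∑ i, ∑ j, star (c i) * P i j * c j) {r : ℝ} (hr : 0 < r) :
    ∃ R R' : Matrix (Fin n) (Fin n) ℂ, R * R' = 1 ∧ R' * R = 1 ∧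
      R'ᴴ * R' = P + (r : ℂ) • (1 : Matrix (Fin n) (Fin n) ℂ) := by
  have h0 : 0 ≤ (CStarMatrix.ofMatrix P : CStarMatrix (Fin n) (Fin n) ℂ) :=
    CStarMatrix.nonneg_iff_form.2 fun a => by
      simpa [CStarMatrix.form, CStarMatrix.ofMatrix_apply] using hP a
  have hh : P.IsHermitian := (IsSelfAdjoint.of_nonneg h0 : IsSelfAdjoint (CStarMatrix.ofMatrix P))
  have hps : P.PosSemidef := Matrix.PosSemidef.of_dotProduct_mulVec_nonneg hh fun c => by
    convert hP c using 1
    simp only [dotProduct, Matrix.mulVec, Pi.star_apply, Finset.mul_sum, mul_assoc]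
  have hpd : (P + (r : ℂ) • (1 : Matrix (Fin n) (Fin n) ℂ)).PosDef :=
    Matrix.PosDef.posSemidef_add hps (Matrix.PosDef.one.smul (by exact_mod_cast hr))
  have h1 : 0 ≤ (CStarMatrix.ofMatrix (P + (r : ℂ) • (1 : Matrix (Fin n) (Fin n) ℂ)) :
      CStarMatrix (Fin n) (Fin n) ℂ) := CStarMatrix.nonneg_iff_form.2 fun a => by
    convert hpd.posSemidef.dotProduct_mulVec_nonneg a using 1
    simp only [CStarMatrix.form, CStarMatrix.ofMatrix_apply, dotProduct, Matrix.mulVec,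
      Pi.star_apply, Finset.mul_sum, mul_assoc]
  obtain ⟨B, hB⟩ : ∃ B : Matrix (Fin n) (Fin n) ℂ,
      P + (r : ℂ) • (1 : Matrix (Fin n) (Fin n) ℂ) = Bᴴ * B := by
    obtain ⟨N, hN⟩ := CStarAlgebra.exists_eq_star_mul_self h1
    exact ⟨CStarMatrix.ofMatrix.symm N, hN⟩
  have hdet : IsUnit B.det := by
    have h1 := hpd.isUnit
    rw [hB, Matrix.isUnit_iff_isUnit_det, Matrix.det_mul] at h1
    exact isUnit_of_mul_isUnit_right h1
  exact ⟨B⁻¹, B, Matrix.nonsing_inv_mul _ hdet, Matrix.mul_nonsing_inv _ hdet, hB.symm⟩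

namespace OperatorSystem

namespace OSDual

variable {E : Type u} [AddCommGroup E] [Module ℂ E] [StarAddMonoid E] [StarModule ℂ E]
  [OperatorSystem E] {f : FaithfulState E}

theorem pair_scalarConj_left {n m : ℕ} (a : Matrix (Fin n) (Fin m) ℂ)
    (F : Matrix (Fin n) (Fin n) (OSDual f)) (y : Matrix (Fin m) (Fin m) E) :
    pair (scalarConj a F) y = pair F (scalarConj aᵀ y) := by
  rw [pair_scalarConj]
  simp only [pair_apply, scalarConj, Matrix.of_apply, map_sum, map_smul, LinearMap.sum_apply,
    LinearMap.smul_apply, smul_eq_mul, Matrix.transpose_apply]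
  exact sum4 fun k i l j => star (a k i) * a l j * toDual (F k l) (y i j)

theorem functionalMap_pair_apply {n : ℕ} (F : Matrix (Fin n) (Fin n) (OSDual f)) (v : E)
    (i j : Fin n) : functionalMap (pair F) v i j = toDual (F i j) v := pair_single F i j v

theorem map_mem_posCone_iff {n m : ℕ} {G : Matrix (Fin n) (Fin n) (OSDual f)}
    {x : Matrix (Fin m) (Fin m) E} :
    x.map (functionalMap (pair G)) ∈ posCone m ↔
      ∀ c : Matrix (Fin m) (Fin n) ℂ, 0 ≤ pair G (scalarConj c x) := by
  rw [mem_posCone_iff, CStarMatrix.nonneg_iff_quadratic]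
  refine forall_congr' fun c => ?_
  exact iff_of_eq (congrArg (0 ≤ ·) (sum_functionalMap (pair G) x c))

/-- Conjugation moves across the pairing by transposition, so substituting `c R'ᵀ` for `c` undoes
`R`: normalising a generator does not weaken its positivity test. -/
theorem pair_nonneg_of_scalarConj {n m : ℕ} {T : Matrix (Fin n) (Fin n) (OSDual f)}
    {R R' : Matrix (Fin n) (Fin n) ℂ} (hR : R * R' = 1) {x : Matrix (Fin m) (Fin m) E}
    (h : ∀ c : Matrix (Fin m) (Fin n) ℂ, 0 ≤ pair (scalarConj R T) (scalarConj c x))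
    (c : Matrix (Fin m) (Fin n) ℂ) : 0 ≤ pair T (scalarConj c x) := by
  have h1 := h (c * R'ᵀ)
  rwa [← scalarConj_scalarConj, ← pair_scalarConj_left, scalarConj_scalarConj, hR,
    scalarConj_one] at h1

variable [FiniteDimensional ℂ E]

/-- A positive matrix of functionals whose value at the unit is the identity matrix. -/
def IsUnitalPos {n : ℕ} (G : Matrix (Fin n) (Fin n) (OSDual f)) : Prop :=
  G ∈ posCone n ∧ ∀ i j, toDual (G i j) unit = (1 : Matrix (Fin n) (Fin n) ℂ) i j

theorem IsUnitalPos.isUCP {n : ℕ} {G : Matrix (Fin n) (Fin n) (OSDual f)} (hG : IsUnitalPos G) :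
    IsUCP (functionalMap (pair G)) := by
  refine ⟨?_, fun m x hx => functionalMap_mem (mem_posCone_iff_pair.1 hG.1) hx⟩
  ext i j
  rw [functionalMap_pair_apply, hG.2]
  rfl

/-- Since `f(1) = 1`, the scalar matrix `T(1)` is at least `r`, hence of the form `R'ᴴ R'` with `R'`
invertible; conjugating by the inverse makes the value at the unit the identity. -/
theorem exists_isUnitalPos_scalarConj {n : ℕ} {T : Matrix (Fin n) (Fin n) (OSDual f)} {r : ℝ}
    (hr : 0 < r) (hT : T - (r : ℂ) • matUnit (OSDual f) n ∈ posCone n) :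
    ∃ R R' : Matrix (Fin n) (Fin n) ℂ, R * R' = 1 ∧ R' * R = 1 ∧ IsUnitalPos (scalarConj R T) := by
  obtain ⟨R, R', h1, h2, h3⟩ := Matrix.exists_conjTranspose_mul_self_eq
    (P := Matrix.of fun i j => toDual ((T - (r : ℂ) • matUnit (OSDual f) n) i j) unit)
    (fun c => by
      have h := functionalMap_form_nonneg (mem_posCone_iff_pair.1 hT) isPos_unit c
      simp only [functionalMap_pair_apply] at h
      exact h) hr
  refine ⟨R, R', h1, h2, scalarConj_mem _ ?_, fun i j => ?_⟩
  · have := add_mem hT (smul_matUnit_mem (V := OSDual f) (n := n) hr.le)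
    rwa [sub_add_cancel] at this
  · have h4 : (Matrix.of fun i j => toDual ((T - (r : ℂ) • matUnit (OSDual f) n) i j) unit) +
        (r : ℂ) • (1 : Matrix (Fin n) (Fin n) ℂ) = Matrix.of fun i j => toDual (T i j) unit := by
      ext i j
      by_cases hij : i = j <;> simp [matUnit, hij, toDual_unit_unit]
    have h5 : Rᴴ * (R'ᴴ * R') * R = 1 := by
      rw [mul_assoc, mul_assoc, h2, mul_one, ← Matrix.conjTranspose_mul, h2,
        Matrix.conjTranspose_one]
    rw [← h5, h3, h4, scalarConj_apply]
    simp only [map_sum, map_smul, LinearMap.sum_apply, LinearMap.smul_apply, smul_eq_mul,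
      Matrix.mul_apply, Finset.sum_mul, Matrix.conjTranspose_apply, Matrix.of_apply]
    rw [Finset.sum_comm]
    exact Finset.sum_congr rfl fun _ _ => Finset.sum_congr rfl fun _ _ => by ring

/-- The Choi--Effros theorem in finite dimensions: unital completely positive maps into matrix
algebras determine the matrix cones. -/
theorem mem_posCone_of_forall_isUnitalPos (f : FaithfulState E) {n : ℕ}
    {x : Matrix (Fin n) (Fin n) E}
    (h : ∀ G : Matrix (Fin n) (Fin n) (OSDual f), IsUnitalPos G →
      x.map (functionalMap (pair G)) ∈ posCone n) : x ∈ posCone n := by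
  have hpos : ∀ F : Matrix (Fin n) (Fin n) (OSDual f), F ∈ posCone n → 0 ≤ pair F x := by
    intro F hF
    -- The value of `F` at the unit may be singular; a multiple of the order unit makes
    -- normalisation possible, and `r` then tends to `0`.
    have h1 : ∀ r : ℝ, 0 < r → 0 ≤ pair F x + (r : ℂ) * pair (matUnit (OSDual f) n) x := by
      intro r hr
      obtain ⟨R, R', h1, h2, h3⟩ := exists_isUnitalPos_scalarConj
        (T := F + (r : ℂ) • matUnit (OSDual f) n) hr (by rwa [add_sub_cancel_right])
      have h4 := pair_nonneg_of_scalarConj h1 (map_mem_posCone_iff.1 (h _ h3)) 1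
      rw [scalarConj_one] at h4
      convert h4 using 1
      simp [pair_apply, Finset.sum_add_distrib, Finset.mul_sum]
    have h2 : Filter.Tendsto (fun r : ℝ => pair F x + (r : ℂ) * pair (matUnit (OSDual f) n) x)
        (nhdsWithin 0 (Set.Ioi 0))
        (nhds (pair F x + ((0 : ℝ) : ℂ) * pair (matUnit (OSDual f) n) x)) := by
      refine Filter.Tendsto.mono_left (Continuous.tendsto ?_ 0) nhdsWithin_le_nhds
      fun_prop
    rw [Complex.ofReal_zero, zero_mul, add_zero] at h2
    refine ge_of_tendsto h2 ?_
    filter_upwards [self_mem_nhdsWithin] with r hr using h1 r hr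
  have hw : ∀ F : Matrix (Fin n) (Fin n) (OSDual f), F ∈ posCone n → pair F (x - xᴴ) = 0 := by
    intro F hF
    have h1 := pair_conjTranspose F xᴴ
    rw [(isHermitian hF).eq, Matrix.conjTranspose_conjTranspose,
      (IsSelfAdjoint.of_nonneg (hpos F hF)).star_eq] at h1
    rw [map_sub, h1, sub_self]
  have hherm : (Complex.I • (x - xᴴ)).IsHermitian := by
    simp only [Matrix.IsHermitian, Matrix.conjTranspose_smul, Matrix.conjTranspose_sub,
      Matrix.conjTranspose_conjTranspose, RCLike.star_def, Complex.conj_I]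
    module
  have h0 : Complex.I • (x - xᴴ) = 0 := by
    refine eq_zero (mem_posCone_of_pair f hherm fun F hF => ?_)
      (mem_posCone_of_pair f hherm.neg fun F hF => ?_)
    · rw [map_smul, hw F hF, smul_zero, Complex.zero_re]
    · rw [map_neg, map_smul, hw F hF, smul_zero, neg_zero, Complex.zero_re]
  have hx : x.IsHermitian :=
    (sub_eq_zero.1 ((smul_eq_zero.1 h0).resolve_left Complex.I_ne_zero)).symm
  exact mem_posCone_of_pair f hx fun F hF => (Complex.nonneg_iff.1 (hpos F hF)).1

end OSDual

section FiniteSum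

variable {V : Type u} [AddCommGroup V] [Module ℂ V] {M K : ℕ}

/-- The direct sum of finitely many maps into `M_K(ℂ)`. -/
noncomputable def finiteSum (φ : Fin M → (V →ₗ[ℂ] CStarMatrix (Fin K) (Fin K) ℂ)) :
    V →ₗ[ℂ] CStarMatrix (Fin (M * K)) (Fin (M * K)) ℂ where
  toFun v := CStarMatrix.ofMatrix (Matrix.of fun i j =>
    if (finProdFinEquiv.symm i).1 = (finProdFinEquiv.symm j).1 then
      φ (finProdFinEquiv.symm i).1 v (finProdFinEquiv.symm i).2 (finProdFinEquiv.symm j).2 else 0)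
  map_add' v w := by
    ext i j
    simp only [CStarMatrix.add_apply, CStarMatrix.ofMatrix_apply, Matrix.of_apply, map_add]
    split_ifs <;> simp
  map_smul' c v := by
    ext i j
    simp only [CStarMatrix.smul_apply, CStarMatrix.ofMatrix_apply, Matrix.of_apply, map_smul,
      RingHom.id_apply]
    split_ifs <;> simp

theorem finiteSum_apply (φ : Fin M → (V →ₗ[ℂ] CStarMatrix (Fin K) (Fin K) ℂ)) (v : V)
    (k l : Fin M) (i j : Fin K) :
    finiteSum φ v (finProdFinEquiv (k, i)) (finProdFinEquiv (l, j)) =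
      if k = l then φ k v i j else 0 := by
  change (if (finProdFinEquiv.symm (finProdFinEquiv (k, i))).1 = _ then _ else _) = _
  simp only [Equiv.symm_apply_apply]

theorem finiteSum_quadratic (φ : Fin M → (V →ₗ[ℂ] CStarMatrix (Fin K) (Fin K) ℂ)) {m : ℕ}
    (x : Matrix (Fin m) (Fin m) V) (c : Fin m → Fin (M * K) → ℂ) :
    ∑ p, ∑ q, ∑ i, ∑ j, star (c p i) * finiteSum φ (x p q) i j * c q j =
      ∑ k, ∑ p, ∑ q, ∑ i, ∑ j, star (c p (finProdFinEquiv (k, i))) * φ k (x p q) i j *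
        c q (finProdFinEquiv (k, j)) := by
  have h : ∀ p q, ∑ i, ∑ j, star (c p i) * finiteSum φ (x p q) i j * c q j =
      ∑ k, ∑ i, ∑ j, star (c p (finProdFinEquiv (k, i))) * φ k (x p q) i j *
        c q (finProdFinEquiv (k, j)) := by
    intro p q
    rw [← finProdFinEquiv.sum_comp, Fintype.sum_prod_type]
    refine Finset.sum_congr rfl fun k _ => Finset.sum_congr rfl fun i _ => ?_
    rw [← finProdFinEquiv.sum_comp, Fintype.sum_prod_type, Finset.sum_eq_single k]
    · simp only [finiteSum_apply, if_true]
    · intro l _ hl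
      simp [finiteSum_apply, hl.symm]
    · simp
  simp only [h]
  calc _ = ∑ p, ∑ k, ∑ q, ∑ i, ∑ j, star (c p (finProdFinEquiv (k, i))) * φ k (x p q) i j *
        c q (finProdFinEquiv (k, j)) := Finset.sum_congr rfl fun _ _ => Finset.sum_comm
    _ = _ := Finset.sum_comm

theorem map_finiteSum_mem_iff {φ : Fin M → (V →ₗ[ℂ] CStarMatrix (Fin K) (Fin K) ℂ)} {m : ℕ}
    {x : Matrix (Fin m) (Fin m) V} :
    x.map (finiteSum φ) ∈ posCone m ↔ ∀ k, x.map (φ k) ∈ posCone m := by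
  simp only [mem_posCone_iff, CStarMatrix.nonneg_iff_quadratic, CStarMatrix.ofMatrix_apply,
    Matrix.map_apply, finiteSum_quadratic]
  constructor
  · intro h k c
    refine (h fun p i => if (finProdFinEquiv.symm i).1 = k then
      c p (finProdFinEquiv.symm i).2 else 0).trans_eq ?_
    rw [Finset.sum_eq_single k]
    · simp
    · intro l _ hl
      simp [hl]
    · simp
  · exact fun h c => Finset.sum_nonneg fun k _ => h k _

theorem isUCP_finiteSum [StarAddMonoid V] [StarModule ℂ V] [OperatorSystem V]
    {φ : Fin M → (V →ₗ[ℂ] CStarMatrix (Fin K) (Fin K) ℂ)} (hφ : ∀ k, IsUCP (φ k)) :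
    IsUCP (finiteSum φ) := by
  refine ⟨?_, fun n x hx => map_finiteSum_mem_iff.2 fun k => (hφ k).2 n x hx⟩
  ext i j
  obtain ⟨⟨k, i⟩, rfl⟩ := finProdFinEquiv.surjective i
  obtain ⟨⟨l, j⟩, rfl⟩ := finProdFinEquiv.surjective j
  rw [finiteSum_apply, (hφ k).1, CStarMatrix.one_apply, CStarMatrix.one_apply]
  by_cases hk : k = l <;> simp [hk]

end FiniteSum

end OperatorSystem

/-! ### From CP-stability of the dual to maps that almost reflect positivity. -/

namespace OperatorSystem

namespace OSDual

variable {E : Type u} [AddCommGroup E] [Module ℂ E] [StarAddMonoid E] [StarModule ℂ E]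
  [OperatorSystem E] {f : FaithfulState E}

/-- Evaluation of functionals at the entries of a matrix over `E`. -/
def evalMap (f : FaithfulState E) {N : ℕ} (y : Matrix (Fin N) (Fin N) E) :
    OSDual f →ₗ[ℂ] CStarMatrix (ULift.{v} (Fin N)) (ULift.{v} (Fin N)) ℂ where
  toFun x := CStarMatrix.ofMatrix (Matrix.of fun i j => toDual x (y i.down j.down))
  map_add' x z := by
    ext i j
    simp [CStarMatrix.ofMatrix_apply]
  map_smul' c x := by
    ext i j
    simp [CStarMatrix.ofMatrix_apply]

theorem evalMap_apply {N : ℕ} (y : Matrix (Fin N) (Fin N) E) (x : OSDual f)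
    (i j : ULift.{v} (Fin N)) : evalMap f y x i j = toDual x (y i.down j.down) := rfl

theorem sum_evalMap {N m : ℕ} (y : Matrix (Fin N) (Fin N) E)
    (Z : Matrix (Fin m) (Fin m) (OSDual f)) (c : Fin m → ULift.{v} (Fin N) → ℂ) :
    ∑ p, ∑ q, ∑ i, ∑ j, star (c p i) * evalMap f y (Z p q) i j * c q j =
      pair Z (scalarConj (Matrix.of fun i p => c p (ULift.up i)) y) := by
  rw [pair_scalarConj]
  have h : ∀ p q, ∑ i, ∑ j, star (c p i) * evalMap f y (Z p q) i j * c q j =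
      ∑ i, ∑ j, star (c p (ULift.up i)) * c q (ULift.up j) * toDual (Z p q) (y i j) := by
    intro p q
    rw [← Equiv.ulift.symm.sum_comp]
    refine Finset.sum_congr rfl fun i _ => ?_
    rw [← Equiv.ulift.symm.sum_comp]
    refine Finset.sum_congr rfl fun j _ => ?_
    rw [evalMap_apply]
    simp only [Equiv.ulift_symm_apply]
    ring
  simp only [h, Matrix.of_apply]
  exact Finset.sum_congr rfl fun p _ => Finset.sum_comm

theorem evalMap_star {N : ℕ} {y : Matrix (Fin N) (Fin N) E} (hy : y.IsHermitian) (x : OSDual f) :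
    evalMap.{u, v} f y (star x) = star (evalMap f y x) := by
  ext i j
  rw [CStarMatrix.star_apply, evalMap_apply, evalMap_apply, toDual_star]
  rw [← hy.apply i.down j.down, star_star]

variable [FiniteDimensional ℂ E]

theorem evalMap_unit {N : ℕ} {y : Matrix (Fin N) (Fin N) E}
    (hy : ∀ i j, f.toLinearMap (y i j) = (1 : Matrix (Fin N) (Fin N) ℂ) i j) :
    evalMap.{u, v} f y unit = 1 := by
  ext i j
  rw [evalMap_apply, toDual_unit, hy, CStarMatrix.one_apply, Matrix.one_apply]
  by_cases h : i = j
  · simp [h]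
  · rw [if_neg h, if_neg fun h' => h (ULift.down_injective h')]

/-- Nonnegativity on finitely many generators of the positive cone makes the amplification of
an evaluation map almost contractive. -/
theorem norm_evalMap_le {k M N : ℕ} {T : Fin M → Matrix (Fin (k + k)) (Fin (k + k)) (OSDual f)}
    {ε : ℝ}
    (hT : ∀ S : Matrix (Fin (k + k)) (Fin (k + k)) (OSDual f) →ₗ[ℂ] ℂ, (∀ i, 0 ≤ (S (T i)).re) →
      ∀ x ∈ posCone (k + k), matUnit (OSDual f) (k + k) - x ∈ posCone (k + k) →
        0 ≤ (S x).re + ε * (S (matUnit (OSDual f) (k + k))).re)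
    {y : Matrix (Fin N) (Fin N) E} (hy : y.IsHermitian)
    (hy1 : ∀ i j, f.toLinearMap (y i j) = (1 : Matrix (Fin N) (Fin N) ℂ) i j)
    (hyT : ∀ i (c : Matrix (Fin N) (Fin (k + k)) ℂ), 0 ≤ pair (T i) (scalarConj c y))
    (hε : 0 ≤ ε) (x : Matrix (Fin k) (Fin k) (OSDual f)) :
    ‖CStarMatrix.ofMatrix (x.map (evalMap.{u, v} f y))‖ ≤ (1 + 2 * ε) * matNorm x := by
  refine le_mul_matNorm fun t ht hx => ?_
  have hs : 0 < (1 + 2 * ε) * t := by positivity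
  refine norm_le_of_block_mem hs ?_
  rw [← block_map (evalMap_unit hy1) (evalMap_star hy), mem_posCone_iff,
    CStarMatrix.nonneg_iff_quadratic]
  intro c
  refine le_of_le_of_eq ?_ (sum_evalMap y (block ((1 + 2 * ε) * t) x) c).symm
  set a : Matrix (Fin N) (Fin (k + k)) ℂ := Matrix.of fun i p => c p (ULift.up i)
  let S : Matrix (Fin (k + k)) (Fin (k + k)) (OSDual f) →ₗ[ℂ] ℂ :=
    { toFun := fun F => pair F (scalarConj a y)
      map_add' := fun F G => by simp [pair_apply, Finset.sum_add_distrib]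
      map_smul' := fun c F => by simp [pair_apply, Finset.mul_sum] }
  -- The generators are tested on `block t x / (2t)`, which lies between `0` and `1`. The loss `ε`
  -- there becomes `2εt` after rescaling.
  have h1 := hT S (fun i => (Complex.nonneg_iff.1 (hyT i a)).1)
    ((((2 * t)⁻¹ : ℝ) : ℂ) • block t x) (smul_mem (by positivity) hx) (by
      have := smul_mem (r := (2 * t)⁻¹) (by positivity) (block_neg_mem hx)
      rw [← block_add_block_neg, smul_sub, smul_smul, ← Complex.ofReal_mul,
        inv_mul_cancel₀ (by positivity), Complex.ofReal_one, one_smul] at this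
      exact this)
  have h2 : block ((1 + 2 * ε) * t) x = ((2 * t : ℝ) : ℂ) • ((((2 * t)⁻¹ : ℝ) : ℂ) • block t x +
      (ε : ℂ) • matUnit (OSDual f) (k + k)) := by
    rw [smul_add, smul_smul, ← Complex.ofReal_mul, mul_inv_cancel₀ (by positivity),
      Complex.ofReal_one, one_smul, smul_smul, ← Complex.ofReal_mul,
      add_comm (block t x), ← block_add]
    congr 1
    ring
  have hre : 0 ≤ (S (block ((1 + 2 * ε) * t) x)).re := by
    rw [h2, map_smul, smul_eq_mul, Complex.re_ofReal_mul]
    refine mul_nonneg (by positivity) ?_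
    rw [map_add, Complex.add_re, map_smul S (ε : ℂ), smul_eq_mul, Complex.re_ofReal_mul]
    exact h1
  -- The generators control real parts only; the value is real because both matrices are hermitian.
  have him : star (pair (block ((1 + 2 * ε) * t) x) (scalarConj a y)) =
      pair (block ((1 + 2 * ε) * t) x) (scalarConj a y) := by
    have h := pair_conjTranspose (block ((1 + 2 * ε) * t) x) (scalarConj a y)
    rwa [(block_isHermitian _ _).eq, conjTranspose_scalarConj, hy.eq, eq_comm] at h
  exact Complex.nonneg_iff.2 ⟨hre, (Complex.conj_eq_iff_im.1 him).symm⟩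

/-- CP-stability of the dual turns almost contractive evaluation maps into almost positive
matrices. -/
theorem exists_near_positive (h : CPStable.{u, v} (OSDual f)) {δ : ℝ} (hδ : 0 < δ) :
    ∃ (k : ℕ) (ε : ℝ), 0 < k ∧ 0 < ε ∧ ∀ (N : ℕ) (y : Matrix (Fin N) (Fin N) E), y.IsHermitian →
      (∀ i j, f.toLinearMap (y i j) = (1 : Matrix (Fin N) (Fin N) ℂ) i j) →
      (∀ x : Matrix (Fin k) (Fin k) (OSDual f),
        ‖CStarMatrix.ofMatrix (x.map (evalMap.{u, v} f y))‖ ≤ (1 + ε) * matNorm x) →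
      y + (δ : ℂ) • matUnit E N ∈ posCone N := by
  obtain ⟨d, b, hb⟩ := exists_isPos_basis E
  have hsa := star_coord f b hb
  -- The order bound `∑ b_a ≤ B` and the norms of the coordinate functionals fix the tolerance,
  -- independently of `N` and `y`.
  obtain ⟨B, hB, hBb⟩ := exists_isPos_add (x := -∑ a, b a)
    (IsSelfAdjoint.neg (isSelfAdjoint_sum _ fun a _ => (hb a).isSelfAdjoint))
  set K := ∑ a, matNorm (Matrix.of fun _ _ : Fin 1 => coord f b a) with hK
  have hK0 : 0 ≤ K := Finset.sum_nonneg fun a _ => matNorm_nonneg _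
  have hδ₁ : 0 < δ / ((K + 1) * B) := by positivity
  obtain ⟨S', hS', -, k, ε, hk, hε, hst⟩ := h (topSubsystem _) inferInstance _ hδ₁
  refine ⟨k, ε / 2, hk, by positivity, fun N y hy hy1 hn => ?_⟩
  -- The lifted index type puts the target algebra in the universe that CP-stability quantifies
  -- over. Passing from `ε` to `ε / 2` supplies the strict inequality it asks for.
  obtain ⟨ψ, hψ, c, hc, hψn⟩ := hst _ (evalMap.{u, v} f y ∘ₗ S'.toSubmodule.subtype)
    (evalMap_unit hy1) ⟨1 + ε / 2, by linarith, fun x => by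
      rw [matNorm_subsystem]
      exact hn (x.map S'.toSubmodule.subtype)⟩
  let e := toTop (OSDual f)
  let θ : OSDual f →ₗ[ℂ] CStarMatrix (ULift.{v} (Fin N)) (ULift.{v} (Fin N)) ℂ :=
    evalMap f y - ψ ∘ₗ e
  set κ := δ / ((K + 1) * B) * K with hκ
  have hθ : ∀ a, ‖θ (coord f b a)‖ ≤ κ := by
    intro a
    have h1 := hψn (Matrix.of fun _ _ => e (coord f b a))
    rw [matNorm_subsystem] at h1
    have h2 := (CStarMatrix.norm_ofMatrix_one (θ (coord f b a))).symm.trans_le h1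
    refine h2.trans (mul_le_mul hc.le ?_ (matNorm_nonneg _) hδ₁.le)
    exact Finset.single_le_sum (f := fun a => matNorm (Matrix.of fun _ _ : Fin 1 => coord f b a))
      (fun i _ => matNorm_nonneg _) (Finset.mem_univ a)
  have hψpos : ∀ x : OSDual f, IsPos x → 0 ≤ ψ (e x) := fun x hx =>
    hψ.isPos (show IsPos (e x) from hx)
  have hθs : ∀ a, IsSelfAdjoint (θ (coord f b a)) := by
    intro a
    refine IsSelfAdjoint.sub ?_ ?_
    · rw [isSelfAdjoint_iff, ← evalMap_star hy, (hsa a).star_eq]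
    · rw [isSelfAdjoint_iff]
      have := map_star_of_pos (φ := ψ ∘ₗ e) hψpos (coord f b a)
      rw [(hsa a).star_eq] at this
      exact this.symm
  -- The matrix over `E` whose evaluation map is `ψ`; complete positivity of `ψ` makes it positive
  -- by bipolar duality.
  let z : Matrix (Fin N) (Fin N) E := Matrix.of fun i j =>
    ∑ a, ψ (e (coord f b a)) (ULift.up i) (ULift.up j) • b a
  have hpair : ∀ F ∈ posCone (V := OSDual f) N, 0 ≤ pair F z := by
    intro F hF
    have h1 := CStarMatrix.nonneg_iff_quadratic.1
      (hψ.2 N (F.map e) (show (F.map e).map (topSubsystem _).toSubmodule.subtype ∈ posCone N from hF))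
      fun p i => if ULift.up p = i then 1 else 0
    have h2 : ∀ i j, toDual (F i j) (z i j) = ψ (e (F i j)) (ULift.up i) (ULift.up j) := by
      intro i j
      let ent : CStarMatrix (ULift.{v} (Fin N)) (ULift.{v} (Fin N)) ℂ →ₗ[ℂ] ℂ :=
        { toFun := fun M => M (ULift.up i) (ULift.up j)
          map_add' := fun _ _ => rfl
          map_smul' := fun _ _ => rfl }
      have h3 := map_eq_sum_coord f b (ent ∘ₗ ψ ∘ₗ e) (F i j)
      refine Eq.trans ?_ h3.symm
      simp only [z, Matrix.of_apply, map_sum, map_smul, smul_eq_mul]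
      exact Finset.sum_congr rfl fun a _ => mul_comm _ _
    rw [pair_apply]
    simp only [h2]
    simpa [CStarMatrix.ofMatrix_apply, apply_ite, ite_mul] using h1
  have hzh : z.IsHermitian := by
    ext i j
    rw [Matrix.conjTranspose_apply]
    simp only [z, Matrix.of_apply, star_sum, star_smul, (hb _).isSelfAdjoint.star_eq]
    refine Finset.sum_congr rfl fun a _ => ?_
    congr 1
    have h1 := map_star_of_pos (φ := ψ ∘ₗ e) hψpos (coord f b a)
    rw [(hsa a).star_eq] at h1
    exact (congrFun (congrFun h1 (ULift.up i)) (ULift.up j)).symm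
  have hz : z ∈ posCone N := mem_posCone_of_pair f hzh fun F hF =>
    (Complex.nonneg_iff.1 (hpair F hF)).1
  have hW : ∀ a, (Matrix.of fun i j => ((κ : ℂ) • (1 : Matrix (Fin N) (Fin N) ℂ) i j +
      θ (coord f b a) (ULift.up i) (ULift.up j)) • b a) ∈ posCone N := by
    intro a
    refine smul_pos_mem (P := Matrix.of fun i j => (κ : ℂ) • (1 : Matrix (Fin N) (Fin N) ℂ) i j +
      θ (coord f b a) (ULift.up i) (ULift.up j)) (fun c => ?_) (hb a)
    have h1 := CStarMatrix.form_nonneg (CStarAlgebra.nonneg_of_norm_le (hθs a) (hθ a))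
      fun i => c i.down
    rw [CStarMatrix.form, ← Equiv.ulift.symm.sum_comp] at h1
    refine h1.trans_eq (Finset.sum_congr rfl fun i _ => ?_)
    rw [← Equiv.ulift.symm.sum_comp]
    refine Finset.sum_congr rfl fun j _ => ?_
    simp only [Equiv.ulift_symm_apply, CStarMatrix.add_apply, CStarMatrix.smul_apply,
      CStarMatrix.one_apply, Matrix.one_apply, Matrix.of_apply, ULift.up_inj]
  have hrest : (Matrix.diagonal fun _ => ((κ : ℝ) : ℂ) • ((B : ℂ) • unit + -∑ a, b a)) ∈
      posCone (V := E) N := diagonal_mem (hBb.smul (by positivity))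
  have hlast : 0 ≤ δ - κ * B := by
    have : κ * B = δ * (K / (K + 1)) := by
      rw [hκ]
      field_simp
    rw [this, sub_nonneg]
    exact mul_le_of_le_one_right hδ.le ((div_le_one (by positivity)).2 (by linarith))
  -- Here `y = z + ∑ θ_a ⊗ b_a` with `θ_a ≥ -κ`, so `y ≥ -κ ∑ b_a ≥ -κB ≥ -δ`.
  convert add_mem (add_mem (add_mem hz (sum_mem Finset.univ _ fun a _ => hW a)) hrest)
    (smul_matUnit_mem hlast) using 1
  ext i j : 2
  have h5 : y i j = z i j + ∑ a, θ (coord f b a) (ULift.up i) (ULift.up j) • b a := by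
    have h6 : ∀ a, θ (coord f b a) (ULift.up i) (ULift.up j) =
        b.repr (y i j) a - ψ (e (coord f b a)) (ULift.up i) (ULift.up j) := fun a => rfl
    simp only [z, Matrix.of_apply, h6, sub_smul, Finset.sum_sub_distrib, add_sub_cancel]
    exact (b.sum_repr _).symm
  simp only [Matrix.add_apply, Matrix.smul_apply, Matrix.sum_apply, Matrix.of_apply, h5, add_smul,
    Finset.sum_add_distrib]
  by_cases hij : i = j
  · subst hij
    simp only [matUnit, Matrix.diagonal_apply_eq, Matrix.one_apply_eq, ← Finset.smul_sum]
    push_cast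
    simp only [smul_eq_mul, mul_one]
    module
  · simp [matUnit, hij]

end OSDual

end OperatorSystem

namespace OperatorSystem

namespace OSDual

variable {E : Type u} [AddCommGroup E] [Module ℂ E] [StarAddMonoid E] [StarModule ℂ E]
  [OperatorSystem E] {f : FaithfulState E}

theorem isUnitalPos_compression {N : ℕ} {y : Matrix (Fin N) (Fin N) E}
    (hy : ∀ c : Fin N → ℂ, 0 ≤ ∑ i, ∑ j, star (c i) * f.toLinearMap (y i j) * c j) {r : ℝ}
    (hr : 0 < r) :
    ∃ R R' : Matrix (Fin N) (Fin N) ℂ, R * R' = 1 ∧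
      (∀ i j, (R'ᴴ * R') i j = f.toLinearMap (y i j) + r * (1 : Matrix (Fin N) (Fin N) ℂ) i j) ∧
      ∀ i j, f.toLinearMap (scalarConj R (y + (r : ℂ) • matUnit E N) i j) =
        (1 : Matrix (Fin N) (Fin N) ℂ) i j := by
  obtain ⟨R, R', h1, h2, h3⟩ := Matrix.exists_conjTranspose_mul_self_eq
    (P := Matrix.of fun i j => f.toLinearMap (y i j)) hy hr
  have h3' : ∀ i j, (R'ᴴ * R') i j =
      f.toLinearMap (y i j) + r * (1 : Matrix (Fin N) (Fin N) ℂ) i j := fun i j => by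
    rw [h3]
    rfl
  refine ⟨R, R', h1, h3', fun i j => ?_⟩
  have h4 : ∀ i j, f.toLinearMap ((y + (r : ℂ) • matUnit E N) i j) = (R'ᴴ * R') i j := by
    intro i j
    have : f.toLinearMap unit = 1 := f.map_unit'
    rw [h3']
    by_cases hij : i = j
    · subst hij
      simp [matUnit, this]
    · simp [matUnit, hij]
  have h5 : Rᴴ * (R'ᴴ * R') * R = 1 := by
    rw [mul_assoc, mul_assoc, h2, mul_one, ← Matrix.conjTranspose_mul, h2,
      Matrix.conjTranspose_one]
  rw [← h5, scalarConj_apply]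
  simp only [map_sum, map_smul, smul_eq_mul, h4]
  rw [Matrix.mul_apply]
  simp only [Matrix.mul_apply (M := Rᴴ), Finset.sum_mul, Matrix.conjTranspose_apply]
  rw [Finset.sum_comm]
  exact Finset.sum_congr rfl fun _ _ => Finset.sum_congr rfl fun _ _ => by ring

variable [FiniteDimensional ℂ E]

/-- If the dual is CP-stable, there are unital completely positive maps into matrix algebras
that almost reflect positivity on all matrix levels. -/
theorem exists_almost_reflecting (h : CPStable.{u, v} (OSDual f)) {δ : ℝ} (hδ : 0 < δ) :
    ∃ (n : ℕ) (α : E →ₗ[ℂ] CStarMatrix (Fin n) (Fin n) ℂ), IsUCP α ∧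
      ∀ (N : ℕ) (y : Matrix (Fin N) (Fin N) E), y.IsHermitian → y.map α ∈ posCone N →
        y + (δ : ℂ) • (Matrix.of fun i j => f.toLinearMap (y i j) • unit) ∈ posCone N := by
  obtain ⟨k, ε, hk, hε, hnear⟩ := exists_near_positive h hδ
  obtain ⟨M, T, hT, hTgen⟩ := exists_finite_generators (OSDual f) (k + k)
    (show 0 < ε / 2 by positivity)
  -- The size `k + k` is that of the blocks defining the norm on level `k`. The order unit is added
  -- to the list because pairing with it forces the matrix `f(y)` to be positive.
  let T' : Fin (M + 1) → Matrix (Fin (k + k)) (Fin (k + k)) (OSDual f) :=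
    Fin.cons (matUnit (OSDual f) (k + k)) T
  have hT' : ∀ i, ∃ R R' : Matrix (Fin (k + k)) (Fin (k + k)) ℂ, R * R' = 1 ∧ R' * R = 1 ∧
      IsUnitalPos (scalarConj R (T' i)) := by
    intro i
    refine Fin.cases ?_ (fun i => ?_) i
    · refine exists_isUnitalPos_scalarConj (r := 1) one_pos ?_
      change matUnit (OSDual f) (k + k) - _ ∈ _
      rw [Complex.ofReal_one, one_smul, sub_self]
      exact zero_mem _
    · obtain ⟨r, hr, h⟩ := hT i
      exact exists_isUnitalPos_scalarConj hr h
  choose R R' hR hR' hG using hT'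
  refine ⟨_, finiteSum fun i => functionalMap (pair (scalarConj (R i) (T' i))),
    isUCP_finiteSum fun i => (hG i).isUCP, fun N y hy hα => ?_⟩
  have hpair : ∀ i (c : Matrix (Fin N) (Fin (k + k)) ℂ), 0 ≤ pair (T' i) (scalarConj c y) :=
    fun i => pair_nonneg_of_scalarConj (hR i) (map_mem_posCone_iff.1 (map_finiteSum_mem_iff.1 hα i))
  have hf : ∀ c : Fin N → ℂ, 0 ≤ ∑ i, ∑ j, star (c i) * f.toLinearMap (y i j) * c j := by
    intro c
    let p : Fin (k + k) := ⟨0, by omega⟩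
    have h1 := hpair 0 (Matrix.of fun i q => if q = p then c i else 0)
    change 0 ≤ pair (Matrix.diagonal fun _ => stateElt f) _ at h1
    rw [pair_diagonal, Finset.sum_eq_single p] at h1
    · simp only [scalarConj_apply, Matrix.of_apply, if_true, map_sum, map_smul, smul_eq_mul] at h1
      refine h1.trans_eq (Finset.sum_congr rfl fun i _ => Finset.sum_congr rfl fun j _ => ?_)
      ring
    · intro q _ hq
      simp [scalarConj_apply, hq]
    · simp
  refine archimedean fun s hs => ?_
  -- Replacing `y` by `y + r` also changes `f(y)` by `r`, so the total perturbation is `r(1 + δ) =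
  -- s`.
  have hr : 0 < s / (1 + δ) := by positivity
  set r := s / (1 + δ) with hrs
  obtain ⟨Q, Q', hQ, hQ'', hQ1⟩ := isUnitalPos_compression hf hr
  have hyr : (y + (r : ℂ) • matUnit E N).IsHermitian := by
    refine hy.add ?_
    rw [Matrix.IsHermitian, Matrix.conjTranspose_smul, (matUnit_isHermitian N).eq,
      RCLike.star_def, Complex.conj_ofReal]
  have hy' : (scalarConj Q (y + (r : ℂ) • matUnit E N)).IsHermitian := by
    rw [Matrix.IsHermitian, conjTranspose_scalarConj, hyr.eq]
  have hTpos : ∀ i, T' i ∈ posCone (k + k) := by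
    intro i
    have := scalarConj_mem (R' i) (hG i).1
    rwa [scalarConj_scalarConj, hR, scalarConj_one] at this
  have hpair' : ∀ i (c : Matrix (Fin N) (Fin (k + k)) ℂ),
      0 ≤ pair (T i) (scalarConj c (scalarConj Q (y + (r : ℂ) • matUnit E N))) := by
    intro i c
    rw [scalarConj_scalarConj, scalarConj_add, map_add]
    exact add_nonneg (hpair i.succ _) (mem_posCone_iff_pair.1 (hTpos i.succ) _
      (scalarConj_mem _ (smul_matUnit_mem hr.le)))
  have h2 := hnear N _ hy' hQ1 fun x => by
    have h3 := norm_evalMap_le hTgen hy' hQ1 hpair' (by positivity) x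
    rwa [mul_div_cancel₀ _ (two_ne_zero' ℝ)] at h3
  -- Undoing the compression turns the error `δ` into `δ Q'ᴴ Q' = δ (f(y) + r)`, which is why the
  -- final error is relative to `f(y)`.
  have h4 := scalarConj_mem Q' h2
  rw [scalarConj_add, scalarConj_scalarConj, hQ, scalarConj_one, scalarConj_smul, matUnit,
    scalarConj_diagonal] at h4
  convert h4 using 1
  ext i j : 2
  have hs' : (s : ℂ) = r * (1 + δ) := by
    rw [hrs]
    push_cast
    rw [div_mul_cancel₀]
    exact_mod_cast (by positivity : (1 + δ) ≠ 0)
  simp only [Matrix.add_apply, Matrix.smul_apply, Matrix.of_apply, hQ'', hs']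
  by_cases hij : i = j
  · subst hij
    simp only [Matrix.diagonal_apply_eq, Matrix.one_apply_eq]
    module
  · simp [hij]

end OSDual

end OperatorSystem

/-! ### Block diagonal operators and Hilbert sums of u.c.p. maps. -/

section BlockDiagonal

variable {I : Type u} {G : I → Type*} [∀ i, NormedAddCommGroup (G i)]
  [∀ i, InnerProductSpace ℂ (G i)]

theorem lp.norm_apply_rpow_le {C : ℝ} (hC : 0 ≤ C) {T : ∀ i, G i →L[ℂ] G i} (hT : ∀ i, ‖T i‖ ≤ C)
    (v : ∀ i, G i) (i : I) : ‖T i (v i)‖ ^ (2 : ENNReal).toReal ≤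
      C ^ (2 : ENNReal).toReal * ‖v i‖ ^ (2 : ENNReal).toReal := by
  rw [← Real.mul_rpow hC (norm_nonneg _)]
  exact Real.rpow_le_rpow (norm_nonneg _) ((T i).le_of_opNorm_le (hT i) _) ENNReal.toReal_nonneg

/-- The block diagonal operator on a Hilbert sum. -/
noncomputable def lp.blockDiagonal (T : ∀ i, G i →L[ℂ] G i) (C : ℝ) (hC : 0 ≤ C)
    (hT : ∀ i, ‖T i‖ ≤ C) : lp G 2 →L[ℂ] lp G 2 :=
  LinearMap.mkContinuous
    { toFun := fun v => ⟨fun i => T i (v i), memℓp_gen (Summable.of_nonneg_of_le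
        (fun i => by positivity) (lp.norm_apply_rpow_le hC hT v)
        (((lp.memℓp v).summable (by norm_num)).mul_left _))⟩
      map_add' := fun v w => by
        ext i
        exact map_add (T i) (v i) (w i)
      map_smul' := fun c v => by
        ext i
        exact map_smul (T i) c (v i) } C fun v => by
    refine lp.norm_le_of_forall_sum_le (by norm_num) (by positivity) fun s => ?_
    rw [Real.mul_rpow hC (norm_nonneg _)]
    refine (Finset.sum_le_sum fun i _ => lp.norm_apply_rpow_le hC hT v i).trans ?_
    rw [← Finset.mul_sum]
    exact mul_le_mul_of_nonneg_left (lp.sum_rpow_le_norm_rpow (by norm_num) v s) (by positivity)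

theorem lp.blockDiagonal_apply {T : ∀ i, G i →L[ℂ] G i} {C : ℝ} {hC : 0 ≤ C}
    {hT : ∀ i, ‖T i‖ ≤ C} (v : lp G 2) (i : I) : lp.blockDiagonal T C hC hT v i = T i (v i) := rfl

theorem lp.norm_blockDiagonal_le {T : ∀ i, G i →L[ℂ] G i} {C : ℝ} {hC : 0 ≤ C}
    {hT : ∀ i, ‖T i‖ ≤ C} : ‖lp.blockDiagonal T C hC hT‖ ≤ C :=
  LinearMap.mkContinuous_norm_le _ hC _

end BlockDiagonal

namespace CStarMatrix

/-- The action of `M_N(ℂ)` on the Euclidean space. -/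
noncomputable def toEuclidean (N : ℕ) : CStarMatrix (Fin N) (Fin N) ℂ ≃⋆ₐ[ℂ]
    (EuclideanSpace ℂ (Fin N) →L[ℂ] EuclideanSpace ℂ (Fin N)) :=
  ofMatrixStarAlgEquiv.symm.trans Matrix.toEuclideanCLM

theorem toEuclidean_apply {N : ℕ} (T : CStarMatrix (Fin N) (Fin N) ℂ)
    (v : EuclideanSpace ℂ (Fin N)) (i : Fin N) : toEuclidean N T v i = ∑ j, T i j * v j := rfl

theorem norm_toEuclidean_le {N : ℕ} (T : CStarMatrix (Fin N) (Fin N) ℂ) :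
    ‖toEuclidean N T‖ ≤ ‖T‖ := NonUnitalStarAlgHom.norm_apply_le (toEuclidean N) T

theorem inner_toEuclidean {N : ℕ} (T : CStarMatrix (Fin N) (Fin N) ℂ)
    (v w : EuclideanSpace ℂ (Fin N)) :
    inner ℂ v (toEuclidean N T w) = ∑ i, ∑ j, star (v i) * T i j * w j := by
  rw [PiLp.inner_apply]
  refine Finset.sum_congr rfl fun i _ => ?_
  rw [toEuclidean_apply, RCLike.inner_apply, Finset.sum_mul]
  refine Finset.sum_congr rfl fun j _ => ?_
  rw [starRingEnd_apply]
  ring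

end CStarMatrix

namespace OperatorSystem

section HilbertSum

variable {V : Type*} [AddCommGroup V] [Module ℂ V] [StarAddMonoid V] [StarModule ℂ V]
  [OperatorSystem V] {I : Type u} {N : I → ℕ}

/-- The direct sum of unital completely positive maps into matrix algebras, acting on the
Hilbert sum of the Euclidean spaces. -/
noncomputable def hilbertSum (φ : ∀ i, V →ₗ[ℂ] CStarMatrix (Fin (N i)) (Fin (N i)) ℂ)
    (hφ : ∀ i, IsUCP (φ i)) : V →ₗ[ℂ] (lp (fun i => EuclideanSpace ℂ (Fin (N i))) 2 →L[ℂ]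
      lp (fun i => EuclideanSpace ℂ (Fin (N i))) 2) where
  toFun x := lp.blockDiagonal (fun i => CStarMatrix.toEuclidean (N i) (φ i x))
    (matNorm (Matrix.of fun _ _ : Fin 1 => x)) (matNorm_nonneg _) fun i =>
      (CStarMatrix.norm_toEuclidean_le _).trans ((hφ i).norm_le x)
  map_add' x y := by
    ext v i : 3
    rw [lp.blockDiagonal_apply, map_add, map_add]
    rfl
  map_smul' c x := by
    ext v i : 3
    rw [lp.blockDiagonal_apply, map_smul, map_smul]
    rfl

variable {φ : ∀ i, V →ₗ[ℂ] CStarMatrix (Fin (N i)) (Fin (N i)) ℂ} {hφ : ∀ i, IsUCP (φ i)}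

theorem hilbertSum_apply (x : V) (v : lp (fun i => EuclideanSpace ℂ (Fin (N i))) 2) (i : I) :
    hilbertSum φ hφ x v i = CStarMatrix.toEuclidean (N i) (φ i x) (v i) := rfl

/-- The quadratic form on the Hilbert sum is the sum of the forms of the summands, and vectors
supported in one summand recover each of them. -/
theorem map_hilbertSum_mem_iff {m : ℕ} {x : Matrix (Fin m) (Fin m) V} :
    x.map (hilbertSum φ hφ) ∈ posCone m ↔ ∀ i, x.map (φ i) ∈ posCone m := by
  classical
  rw [mem_posCone_iff, CStarMatrix.nonneg_iff_inner]
  constructor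
  · intro h i
    rw [mem_posCone_iff, CStarMatrix.nonneg_iff_quadratic]
    intro c
    refine (h fun p => lp.single 2 i (WithLp.toLp 2 (c p))).trans_eq ?_
    refine Finset.sum_congr rfl fun p _ => Finset.sum_congr rfl fun q _ => ?_
    rw [lp.inner_single_left]
    change inner ℂ _ (hilbertSum φ hφ (x p q) _ i) = _
    rw [hilbertSum_apply, lp.single_apply_self, CStarMatrix.inner_toEuclidean]
    rfl
  · intro h v
    have hsum := hasSum_sum (s := Finset.univ) fun p _ => hasSum_sum (s := Finset.univ) fun q _ =>
      lp.hasSum_inner (𝕜 := ℂ) (v p) (hilbertSum φ hφ (x p q) (v q))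
    refine hsum.nonneg fun i => ?_
    have h1 := h i
    rw [mem_posCone_iff, CStarMatrix.nonneg_iff_quadratic] at h1
    refine (h1 fun p => v p i).trans_eq ?_
    refine Finset.sum_congr rfl fun p _ => Finset.sum_congr rfl fun q _ => ?_
    rw [hilbertSum_apply, CStarMatrix.inner_toEuclidean]
    rfl

theorem hilbertSum_unit : hilbertSum φ hφ unit = 1 := by
  ext v i : 3
  rw [hilbertSum_apply, (hφ i).1, map_one]
  rfl

theorem norm_hilbertSum_sub_le {W : Type*} [AddCommGroup W] [Module ℂ W] [StarAddMonoid W]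
    [StarModule ℂ W] [OperatorSystem W]
    {ψ : ∀ i, W →ₗ[ℂ] CStarMatrix (Fin (N i)) (Fin (N i)) ℂ} {hψ : ∀ i, IsUCP (ψ i)} {x : V} {y : W}
    {C : ℝ} (hC : 0 ≤ C) (h : ∀ i, ‖φ i x - ψ i y‖ ≤ C) :
    ‖hilbertSum φ hφ x - hilbertSum ψ hψ y‖ ≤ C := by
  have h1 : hilbertSum φ hφ x - hilbertSum ψ hψ y =
      lp.blockDiagonal (fun i => CStarMatrix.toEuclidean (N i) (φ i x - ψ i y)) C hC
        fun i => (CStarMatrix.norm_toEuclidean_le _).trans (h i) := by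
    ext v i : 3
    rw [lp.blockDiagonal_apply, map_sub]
    rfl
  rw [h1]
  exact lp.norm_blockDiagonal_le

end HilbertSum

/-! ### Uniform approximate factorizations and exactness. -/

namespace OSDual

variable {E : Type u} [AddCommGroup E] [Module ℂ E] [StarAddMonoid E] [StarModule ℂ E]
  [OperatorSystem E] [FiniteDimensional ℂ E] {f : FaithfulState E}

/-- An almost reflecting map almost factors every unital completely positive map into a matrix
algebra. -/
theorem exists_almost_factorization {n : ℕ} {α : E →ₗ[ℂ] CStarMatrix (Fin n) (Fin n) ℂ}
    (hα : IsUCP α) {δ : ℝ} (hδ : 0 < δ)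
    (h : ∀ (N : ℕ) (y : Matrix (Fin N) (Fin N) E), y.IsHermitian → y.map α ∈ posCone N →
      y + (δ : ℂ) • (Matrix.of fun i j => f.toLinearMap (y i j) • unit) ∈ posCone N)
    {N : ℕ} {G : Matrix (Fin N) (Fin N) (OSDual f)} (hG : IsUnitalPos G) :
    ∃ β : CStarMatrix (Fin n) (Fin n) ℂ →ₗ[ℂ] CStarMatrix (Fin N) (Fin N) ℂ, IsUCP β ∧
      ∀ x, ‖β (α x) - functionalMap (pair G) x‖ ≤
        δ * (‖f.toLinearMap x‖ + matNorm (Matrix.of fun _ _ : Fin 1 => x)) := by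
  let twist : Matrix (Fin N) (Fin N) E →ₗ[ℂ] Matrix (Fin N) (Fin N) E :=
    { toFun := fun y => y + (δ : ℂ) • (Matrix.of fun i j => f.toLinearMap (y i j) • unit)
      map_add' := fun y z => by
        ext i j : 2
        simp only [Matrix.add_apply, Matrix.smul_apply, Matrix.of_apply, map_add]
        module
      map_smul' := fun c y => by
        ext i j : 2
        simp only [Matrix.add_apply, Matrix.smul_apply, Matrix.of_apply, map_smul, smul_eq_mul,
          RingHom.id_apply]
        module }
  have hpos : 0 < 1 + δ := by linarith
  have hne : ((1 + δ : ℝ) : ℂ) ≠ 0 := by exact_mod_cast hpos.ne'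
  -- Adding `δ f(y) ⊗ 1` makes the functional of `G` nonnegative wherever `α(y)` is positive, so it
  -- extends along `α`. The extension is the desired `β`, and the factor `(1 + δ)⁻¹` makes it
  -- unital.
  obtain ⟨S, hS, hSα⟩ := exists_positive_extension α hα.map_star unit star_unit hα.1
    ((((1 + δ)⁻¹ : ℝ) : ℂ) • (pair G ∘ₗ twist)) fun y hy hyα => by
      rw [LinearMap.smul_apply, smul_eq_mul]
      refine mul_nonneg (by exact_mod_cast (inv_pos.2 hpos).le) ?_
      exact mem_posCone_iff_pair.1 hG.1 _ (h N y hy hyα)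
  have hβ : ∀ x, functionalMap S (α x) = (((1 + δ)⁻¹ : ℝ) : ℂ) •
      (functionalMap (pair G) x + ((δ : ℂ) * f.toLinearMap x) • 1) := by
    intro x
    ext i j
    have h1 := hSα (Matrix.single i j x)
    have h2 : (Matrix.single i j x).map α = Matrix.single i j (α x) := by
      ext k l : 2
      by_cases hkl : i = k ∧ j = l <;> simp [hkl]
    have h3 : twist (Matrix.single i j x) =
        Matrix.single i j (x + ((δ : ℂ) * f.toLinearMap x) • unit) := by
      ext k l : 2
      change Matrix.single i j x k l + (δ : ℂ) • f.toLinearMap (Matrix.single i j x k l) • unit = _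
      by_cases hkl : i = k ∧ j = l <;> simp [hkl, mul_smul]
    rw [functionalMap_apply, ← h2, h1, LinearMap.smul_apply, LinearMap.comp_apply, h3, pair_single,
      map_add, map_smul, hG.2]
    simp only [CStarMatrix.smul_apply, CStarMatrix.add_apply, functionalMap_pair_apply]
    rfl
  have h1 : functionalMap S 1 = 1 := by
    rw [← hα.1, hβ, hG.isUCP.1, show f.toLinearMap unit = 1 from f.map_unit', mul_one,
      Complex.ofReal_inv, inv_smul_eq_iff₀ hne]
    push_cast
    module
  refine ⟨functionalMap S, ⟨h1, fun m x hx => functionalMap_mem hS hx⟩, fun x => ?_⟩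
  have h4 : functionalMap S (α x) - functionalMap (pair G) x =
      ((δ / (1 + δ) : ℝ) : ℂ) • (f.toLinearMap x • 1 - functionalMap (pair G) x) := by
    have h5 : (((1 + δ)⁻¹ : ℝ) : ℂ) = 1 - ((δ / (1 + δ) : ℝ) : ℂ) := by
      rw [← Complex.ofReal_one, ← Complex.ofReal_sub]
      congr 1
      field_simp
      ring
    have h6 : (((1 + δ)⁻¹ : ℝ) : ℂ) * δ = ((δ / (1 + δ) : ℝ) : ℂ) := by
      rw [← Complex.ofReal_mul]
      congr 1
      field_simp
    rw [hβ, smul_add, smul_smul, ← mul_assoc, h6, h5]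
    module
  rw [h4, norm_smul, Complex.norm_real, Real.norm_of_nonneg (by positivity)]
  refine mul_le_mul (div_le_self hδ.le (by linarith)) ((norm_sub_le _ _).trans (add_le_add ?_
    (hG.isUCP.norm_le x))) (norm_nonneg _) hδ.le
  rw [norm_smul]
  exact mul_le_of_le_one_right (norm_nonneg _) (CStarAlgebra.norm_one_le_one _)

theorem isExact_of_cpStable (h : CPStable.{u, v} (OSDual f)) : IsExact E := by
  -- All u.c.p. maps from `E` into matrix algebras; indexing them by matrices over the dual keeps
  -- the Hilbert space in the universe of `E`.
  let I := Σ N : ℕ, {G : Matrix (Fin N) (Fin N) (OSDual f) // IsUnitalPos G}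
  have hφ : ∀ i : I, IsUCP (functionalMap (pair i.2.1)) := fun i => i.2.2.isUCP
  refine ⟨lp (fun i : I => EuclideanSpace ℂ (Fin i.1)) 2, inferInstance, inferInstance,
    inferInstance, hilbertSum (fun i : I => functionalMap (pair i.2.1)) hφ,
    ⟨hilbertSum_unit, fun n x => ⟨fun hx => ?_, fun hx => ?_⟩⟩, fun F ε hε => ?_⟩
  · exact map_hilbertSum_mem_iff.2 fun i => (hφ i).2 n x hx
  · exact mem_posCone_of_forall_isUnitalPos f fun G hG =>
      map_hilbertSum_mem_iff.1 hx (⟨n, G, hG⟩ : I)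
  set B := ∑ x ∈ F, (‖f.toLinearMap x‖ + matNorm (Matrix.of fun _ _ : Fin 1 => x)) with hB
  have hterm : ∀ x, 0 ≤ ‖f.toLinearMap x‖ + matNorm (Matrix.of fun _ _ : Fin 1 => x) := fun x =>
    add_nonneg (norm_nonneg _) (matNorm_nonneg _)
  have hB0 : 0 ≤ B := Finset.sum_nonneg fun x _ => hterm x
  have hδ : 0 < ε / (B + 1) := by positivity
  obtain ⟨n, α, hα, hαr⟩ := exists_almost_reflecting h hδ
  -- The map `α` and the error bound do not depend on `i`, so the `β i` assemble into one map out of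
  -- `M_n(ℂ)` and the approximation survives in operator norm.
  choose β hβ hβα using fun i : I => exists_almost_factorization hα hδ hαr i.2.2
  let β' : CStarMatrix (Fin n) (Fin n) ℂ →CP (lp (fun i : I => EuclideanSpace ℂ (Fin i.1)) 2 →L[ℂ]
      lp (fun i : I => EuclideanSpace ℂ (Fin i.1)) 2) :=
    { hilbertSum β hβ with
      map_cstarMatrix_nonneg' := fun k M hM =>
        (map_hilbertSum_mem_iff (hφ := hβ)).2 fun i => (hβ i).2 k M hM }
  have hβ' : ∀ z, β' z = hilbertSum β hβ z := fun _ => rfl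
  refine ⟨n, α, β', hα, (hβ' 1).trans hilbertSum_unit, fun x hx => ?_⟩
  rw [hβ']
  refine (norm_hilbertSum_sub_le (hφ := hβ) (hψ := hφ) (mul_nonneg hδ.le (hterm x))
    fun i => hβα i x).trans_lt ?_
  have h1 : ‖f.toLinearMap x‖ + matNorm (Matrix.of fun _ _ : Fin 1 => x) ≤ B :=
    Finset.single_le_sum (f := fun x => ‖f.toLinearMap x‖ + matNorm (Matrix.of fun _ _ : Fin 1 => x))
      (fun x _ => hterm x) hx
  calc _ ≤ ε / (B + 1) * B := mul_le_mul_of_nonneg_left h1 hδ.le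
    _ < ε := by
      rw [div_mul_eq_mul_div, div_lt_iff₀ (by positivity)]
      nlinarith

end OSDual

end OperatorSystem

theorem mainTheorem4 {E : Type u} [AddCommGroup E] [Module ℂ E] [StarAddMonoid E]
    [StarModule ℂ E] [OperatorSystem E] [FiniteDimensional ℂ E] [Nontrivial E] :
    Nonempty (OperatorSystem.FaithfulState E) ∧
      ∀ f : OperatorSystem.FaithfulState E,
        OperatorSystem.IsExact E ↔ OperatorSystem.CPStable.{u, v} (OperatorSystem.OSDual f) := by
  exact ⟨OperatorSystem.nonempty_faithfulState E, fun f =>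
    ⟨fun h => OperatorSystem.cpStable_of_isExact h f, OperatorSystem.OSDual.isExact_of_cpStable⟩⟩
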